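/- Let $N\ge 1$, let $G\subseteq\mathbb R^N$ be open, and let $V:G\to\mathbb R$ be a real-analytic Morse function (all its critical points are non-degenerate) with exactly one critical point $q_c$ in $G$. Assume $V(q_c)=0$, let $\mathfrak H_V(q_c)$ be the Hessian of $V$ at $q_c$, and let $k$ be the index of $q_c$, i.e. the number of negative eigenvalues of $\mathfrak H_V(q_c)$. For a set $\Gamma\subseteq G$ let $$\Omega_{N}^{\Gamma}(v)=\int_{\Gamma}\delta\bigl(V(q)-Nv\bigr)\,dq=\lim_{\varepsilon\downarrow0}\frac{1}{2\varepsilon}\,\mathrm{vol}\{q\in\Gamma:|V(q)-Nv|<\varepsilon\}$$ be its density of states. Put $\Theta(x)=1$ for $x\ge0$, $\Theta(x)=0$ for $x<0$, and $$\Omega_N^{\rm na}(v)=\frac{(N\pi)^{N/2}}{N\,\Gamma(N/2)\sqrt{|\det[\mathfrak H_V(q_c)/2]|}}\;h_{N,k\bmod 4}(v),$$ $$h_{N,k\bmod4}(v)=\begin{cases}(-1)^{k/2}\,v^{(N-2)/2}\,\Theta(v)&k\text{ even},\\(-1)^{(k+1)/2}\,v^{(N-2)/2}\,\pi^{-1}\ln|v|&N\text{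 even},\ k\text{ odd},\\(-1)^{(N-k)/2}\,(-v)^{(N-2)/2}\,\Theta(-v)&N,k\text{ odd};\end{cases}$$ the function $h_{N,k\bmod4}$ depends on $N$, $k\bmod4$ and $v$ only. By Morse coordinates at $q_c$ we mean bianalytic coordinates $x=(x_1,\dots,x_N)$, defined on an open neighbourhood of $q_c$ in $G$, with $x(q_c)=0$ and $V=-\sum_{i\le k}x_i^2+\sum_{i>k}x_i^2$. Such coordinates exist. For any of them, there is $r_0>0$ such that the coordinates take all values $|x|\le r_0$, and for every $0<r<r_0$ the following holds for the region $\Gamma=U_r=\{|x|<r\}$, and more generally for every region $\Gamma$ with $U_r\subseteq\Gamma\subseteq G$ (for instance $\Gamma=G$) for which the contribution $\Omega_N^{\Gamma\setminus U_r}(v)$ of the points away from $q_c$ exists for all small $v\ne0$ and agrees there with a function analytic at $v=0$: 1. $\Omega_N^{\Gamma}(v)$ exists and is finite for all sufficiently small $v\neq0$, and it is nonanalytic at $v=0$: no function that is analytic at $0$ agrees with it for all sufficiently small $v\ne0$. 2. The leading order nonanalyticity of $\Omega_N^\Gamma$ at $v=0$ is $\Omega_N^{\rm na}$: there are functions $A,B$,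 analytic at $0$, with $B(0)=1$ and $$\Omega_N^\Gamma(v)=A(v)+B(v)\,\Omega_N^{\rm na}(v)\qquad\text{for all sufficiently small }v\ne0 .$$ -/

import Mathlib

open Set Filter Topology MeasureTheory

noncomputable section

namespace DensityOfStates

/-- The Hessian matrix of `V` at `q` in the standard coordinates of `ℝ^N`. -/
def hessian {N : ℕ} (V : EuclideanSpace ℝ (Fin N) → ℝ) (q : EuclideanSpace ℝ (Fin N)) :
    Matrix (Fin N) (Fin N) ℝ :=
  Matrix.of fun i j =>
    fderiv ℝ (fun y => fderiv ℝ V y (EuclideanSpace.single j 1)) q (EuclideanSpace.single i 1)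

/-- The Morse index: the number of negative eigenvalues of the Hessian, with multiplicity. -/
def morseIndex {N : ℕ} (V : EuclideanSpace ℝ (Fin N) → ℝ) (q : EuclideanSpace ℝ (Fin N)) : ℕ :=
  Multiset.card ((hessian V q).charpoly.roots.filter fun μ => μ < 0)

/-- `V` is an analytic Morse function on `G`: real-analytic, and every critical point in `G`
is non-degenerate. -/
structure IsMorseOn {N : ℕ} (V : EuclideanSpace ℝ (Fin N) → ℝ)
    (G : Set (EuclideanSpace ℝ (Fin N))) : Prop where
  analytic : AnalyticOnNhd ℝ V G
  nondegenerate : ∀ q ∈ G, fderiv ℝ V q = 0 → (hessian V q).det ≠ 0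

/-- `φ` is a chart `q ↦ x` of Morse coordinates inside `G`, centred at `q₀`, bianalytic, with
`V = -x₁² - ⋯ - x_k² + x_{k+1}² + ⋯ + x_N²`. -/
structure IsMorseChart {N : ℕ} (V : EuclideanSpace ℝ (Fin N) → ℝ)
    (G : Set (EuclideanSpace ℝ (Fin N))) (q₀ : EuclideanSpace ℝ (Fin N)) (k : ℕ)
    (φ : OpenPartialHomeomorph (EuclideanSpace ℝ (Fin N)) (EuclideanSpace ℝ (Fin N))) :
    Prop where
  source_subset : φ.source ⊆ G
  mem_source : q₀ ∈ φ.source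
  map_center : φ q₀ = 0
  analytic : AnalyticOnNhd ℝ φ φ.source
  analytic_symm : AnalyticOnNhd ℝ φ.symm φ.target
  normal_form : ∀ x ∈ φ.target,
    V (φ.symm x) = ∑ i : Fin N, if (i : ℕ) < k then -(x i) ^ 2 else (x i) ^ 2

/-- The value at `v` of the configurational density of states of `V` on `Γ`,
`∫_Γ δ(V(q) - N v) dq`, exists and equals the finite number `ω`. Here `δ` is the limit of
`(2 ε)⁻¹ 1_{(-ε, ε)}` as `ε ↓ 0`. -/
def HasDensityAt {N : ℕ} (V : EuclideanSpace ℝ (Fin N) → ℝ)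
    (Γ : Set (EuclideanSpace ℝ (Fin N))) (v ω : ℝ) : Prop :=
  0 ≤ ω ∧
    Tendsto
      (fun ε : ℝ => volume {q | q ∈ Γ ∧ |V q - N * v| < ε} / ENNReal.ofReal (2 * ε))
      (𝓝[>] 0) (𝓝 (ENNReal.ofReal ω))

/-- `Ω` is the density of states of `V` on `Γ` at all levels `v ≠ 0` near `0`. (At `v = 0` itself
the density may be infinite or depend on the regularization of `δ`.) -/
def IsDensityNearZero {N : ℕ} (V : EuclideanSpace ℝ (Fin N) → ℝ)
    (Γ : Set (EuclideanSpace ℝ (Fin N))) (Ω : ℝ → ℝ) : Prop :=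
  ∀ᶠ v in 𝓝[≠] (0 : ℝ), HasDensityAt V Γ v (Ω v)

/-- `f` is nonanalytic at `0`, whatever value it is given at `0`. -/
def NonanalyticAtZero (f : ℝ → ℝ) : Prop :=
  ∀ F : ℝ → ℝ, AnalyticAt ℝ F 0 → ¬ f =ᶠ[𝓝[≠] 0] F

/-- `g` is the leading order nonanalyticity of `f` at `0`: up to an analytic function, `f` is `g`
times an analytic factor `B` with `B 0 = 1`, so that the corrections to `g` are
`g` times an analytic function vanishing at `0`. -/
def IsLeadingNonanalyticity (f g : ℝ → ℝ) : Prop :=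
  ∃ A B : ℝ → ℝ, AnalyticAt ℝ A 0 ∧ AnalyticAt ℝ B 0 ∧ B 0 = 1 ∧
    ∀ᶠ v in 𝓝[≠] (0 : ℝ), f v = A v + B v * g v

/-- The Heaviside step function. -/
def heaviside (x : ℝ) : ℝ := if 0 ≤ x then 1 else 0

/-- The universal function `h_{N, κ}` of `v`, where `κ` is the index modulo `4`. In the second
branch `N ≥ 2` is even whenever the function is used, so `(N - 2) / 2` is exact in `ℕ`; in the
first and third branches the power is taken at a positive base wherever the step function does not
vanish and `v ≠ 0`. -/
def universalSingularity (N κ : ℕ) (v : ℝ) : ℝ :=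
  if Even κ then
    (-1) ^ (κ / 2) * v ^ (((N : ℝ) - 2) / 2) * heaviside v
  else if Even N then
    (-1) ^ ((κ + 1) / 2) * v ^ ((N - 2) / 2) * (Real.pi⁻¹ * Real.log |v|)
  else
    (-1) ^ (((N : ℤ) - κ) / 2) * (-v) ^ (((N : ℝ) - 2) / 2) * heaviside (-v)

/-- The leading nonanalytic term `Ω^na` caused by a critical point `q₀` of index `k`. -/
def leadingTerm {N : ℕ} (V : EuclideanSpace ℝ (Fin N) → ℝ) (q₀ : EuclideanSpace ℝ (Fin N))
    (k : ℕ) (v : ℝ) : ℝ :=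
  (N * Real.pi) ^ ((N : ℝ) / 2) /
      (N * Real.Gamma ((N : ℝ) / 2) * √|((2 : ℝ)⁻¹ • hessian V q₀).det|) *
    universalSingularity N (k % 4) v

/-- The density of states of `V` on `Γ` exists at all levels `v ≠ 0` near `0`, is nonanalytic at
`0`, and `g` is its leading order nonanalyticity. -/
def HasSingularDensity {N : ℕ} (V : EuclideanSpace ℝ (Fin N) → ℝ)
    (Γ : Set (EuclideanSpace ℝ (Fin N))) (g : ℝ → ℝ) : Prop :=
  ∃ Ω : ℝ → ℝ, IsDensityNearZero V Γ Ω ∧ NonanalyticAtZero Ω ∧ IsLeadingNonanalyticity Ω g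

/-- The density of states of `V` on `S` is analytic at the level `0`. -/
def HasAnalyticDensity {N : ℕ} (V : EuclideanSpace ℝ (Fin N) → ℝ)
    (S : Set (EuclideanSpace ℝ (Fin N))) : Prop :=
  ∃ R : ℝ → ℝ, AnalyticAt ℝ R 0 ∧ IsDensityNearZero V S R

end DensityOfStates

end

/-! In a Morse chart `φ` the volume of the part of U_r where |V - N v| < ε becomes the integral of
the Jacobian J = |det D φ.symm| over the part of a ball where the diagonal quadratic form Q is
within ε of N v, and J is analytic and positive near 0. So the question is the density, at E = N v,
of the image under Q of the measure J dx on a small ball.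

For indefinite Q, take polar coordinates separately in the k negative and the N - k positive
directions, with radii s and t, so that Q = t² - s². With ξ = s + t and η = t - s a level set is the
hyperbola ξ η = E, and the density is half the integral of P(ξ, E/ξ) dξ/ξ from √|E| to the point
where the hyperbola leaves the ball. Here P is s^(k-1) t^(N-k-1) times the spherical integral of J,
a convergent double power series in ξ and η. Integrating term by term
(`GeomBound.integral_hyperbola`), a monomial ξ^i η^j with i ≠ j yields boundary terms, and one with
i = j yields a logarithm. The outer end depends analytically on E, so every singularity comes from
the inner end ξ = √|E|, η = ±ξ, and from log|E|. The spherical integral is even in s and in t; this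
symmetry cancels many of the inner terms, and the parities of k and N decide which survive
(`singular_expansion`).

The leading constant is always a Beta function: s² = t² - ξ η imposes on the relevant sums of
coefficients the recursion B(x+1, y) = B(x, y) - B(x, y+1). Multiplied by the areas of the two
spheres it becomes π^(N/2)/Γ(N/2), whatever k is. Definite forms need only ordinary polar
coordinates and E = t² (`exists_radialDensity`).

The determinant enters through H/2 = Dᵀ diag(±1) D with D = D φ(q_c), which gives J(0) =
|det(H/2)|^(-1/2). The limit ε → 0 exists because the density is continuous off E = 0. The universal
function is nonanalytic because it vanishes on exactly one side of 0 or contains a logarithm, and an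
analytic contribution from outside U_r only changes A.

Charts exist by the analytic Morse lemma: Hadamard's lemma applied twice writes V(y) = b_y(y-q, y-q)
with b_y symmetric and analytic in y; an analytic square root of b_q⁻¹ b_y near the identity carries
b_y to b_q, and the spectral theorem diagonalises b_q. -/

namespace DensityOfStates

open Finset.HasAntidiagonal (antidiagonal sigmaAntidiagonalEquivProd)

/-! ### Double power series -/

/-- Geometric bound for the coefficients of a double power series. -/
def GeomBound (C M : ℝ) (p : ℕ → ℕ → ℝ) : Prop := ∀ i j, |p i j| ≤ C * M ^ (i + j)

/-- The sum of a double power series. -/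
noncomputable def doubleSum (p : ℕ → ℕ → ℝ) (x y : ℝ) : ℝ :=
  ∑' ij : ℕ × ℕ, p ij.1 ij.2 * x ^ ij.1 * y ^ ij.2

theorem GeomBound.nonneg {C M : ℝ} {p : ℕ → ℕ → ℝ} (h : GeomBound C M p) : 0 ≤ C := by
  simpa using (abs_nonneg _).trans (h 0 0)

theorem summable_geometric_prod {a b : ℝ} (ha : 0 ≤ a) (ha' : a < 1) (hb : 0 ≤ b) (hb' : b < 1) :
    Summable fun ij : ℕ × ℕ => a ^ ij.1 * b ^ ij.2 :=
  (summable_geometric_of_lt_one ha ha').mul_of_nonneg (summable_geometric_of_lt_one hb hb')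
    (fun _ => pow_nonneg ha _) (fun _ => pow_nonneg hb _)

theorem GeomBound.norm_term_le {C M : ℝ} {p : ℕ → ℕ → ℝ} (h : GeomBound C M p) (x y : ℝ)
    (ij : ℕ × ℕ) :
    ‖p ij.1 ij.2 * x ^ ij.1 * y ^ ij.2‖ ≤ C * ((M * |x|) ^ ij.1 * (M * |y|) ^ ij.2) := by
  rw [norm_mul, norm_mul, norm_pow, norm_pow, Real.norm_eq_abs, Real.norm_eq_abs, Real.norm_eq_abs]
  calc |p ij.1 ij.2| * |x| ^ ij.1 * |y| ^ ij.2
      ≤ (C * M ^ (ij.1 + ij.2)) * |x| ^ ij.1 * |y| ^ ij.2 := by gcongr; exact h _ _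
    _ = _ := by rw [mul_pow, mul_pow, pow_add]; ring

theorem GeomBound.summable_norm {C M : ℝ} {p : ℕ → ℕ → ℝ} (h : GeomBound C M p) (hM : 0 ≤ M)
    {x y : ℝ} (hx : M * |x| < 1) (hy : M * |y| < 1) :
    Summable fun ij : ℕ × ℕ => ‖p ij.1 ij.2 * x ^ ij.1 * y ^ ij.2‖ :=
  Summable.of_nonneg_of_le (fun _ => norm_nonneg _) (h.norm_term_le x y)
    ((summable_geometric_prod (by positivity) hx (by positivity) hy).mul_left C)

theorem GeomBound.hasSum {C M : ℝ} {p : ℕ → ℕ → ℝ} (h : GeomBound C M p) (hM : 0 ≤ M)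
    {x y : ℝ} (hx : M * |x| < 1) (hy : M * |y| < 1) :
    HasSum (fun ij : ℕ × ℕ => p ij.1 ij.2 * x ^ ij.1 * y ^ ij.2) (doubleSum p x y) :=
  (h.summable_norm hM hx hy).of_norm.hasSum

theorem GeomBound.hasSum_antidiagonal {C M : ℝ} {p : ℕ → ℕ → ℝ} (h : GeomBound C M p) (hM : 0 ≤ M)
    {x y : ℝ} (hx : M * |x| < 1) (hy : M * |y| < 1) :
    HasSum (fun n => ∑ ij ∈ antidiagonal n, p ij.1 ij.2 * x ^ ij.1 * y ^ ij.2)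
      (doubleSum p x y) := by
  have hs := h.hasSum hM hx hy
  rw [← (sigmaAntidiagonalEquivProd (A := ℕ)).hasSum_iff] at hs
  have := hs.sigma (fun n => (hasSum_fintype _))
  refine this.congr_fun fun n => ?_
  rw [← Finset.sum_coe_sort (antidiagonal n)]
  rfl

/-- The formal multilinear series on `ℝ × ℝ` of a double power series. -/
noncomputable def doubleSeries (p : ℕ → ℕ → ℝ) : FormalMultilinearSeries ℝ (ℝ × ℝ) ℝ := fun n =>
  ∑ ij ∈ antidiagonal n, p ij.1 ij.2 •
    (ContinuousMultilinearMap.mkPiAlgebra ℝ (Fin n) ℝ).compContinuousLinearMap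
      fun m => if (m : ℕ) < ij.1 then ContinuousLinearMap.fst ℝ ℝ ℝ
        else ContinuousLinearMap.snd ℝ ℝ ℝ

theorem prod_ite_lt_eq_pow {n i j : ℕ} (h : i + j = n) (x y : ℝ) :
    ∏ m : Fin n, (if (m : ℕ) < i then x else y) = x ^ i * y ^ j := by
  subst h
  rw [Fin.prod_univ_add]
  simp

theorem doubleSeries_apply (p : ℕ → ℕ → ℝ) (n : ℕ) (z : ℝ × ℝ) :
    doubleSeries p n (fun _ => z) =
      ∑ ij ∈ antidiagonal n, p ij.1 ij.2 * z.1 ^ ij.1 * z.2 ^ ij.2 := by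
  simp only [doubleSeries, sum_apply]
  refine Finset.sum_congr rfl fun ij hij => ?_
  rw [Finset.HasAntidiagonal.mem_antidiagonal] at hij
  have : ∀ m : Fin n, (if (m : ℕ) < ij.1 then ContinuousLinearMap.fst ℝ ℝ ℝ
        else ContinuousLinearMap.snd ℝ ℝ ℝ) z = if (m : ℕ) < ij.1 then z.1 else z.2 := by
    intro m; split_ifs <;> rfl
  simp only [smul_apply,
    ContinuousMultilinearMap.compContinuousLinearMap_apply,
    ContinuousMultilinearMap.mkPiAlgebra_apply, this, prod_ite_lt_eq_pow hij, smul_eq_mul,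
    mul_assoc]

/-- There are n + 1 monomials of degree n and n + 1 ≤ 2^n; this is where M is replaced by 2M, so
analyticity is claimed on a smaller ball than convergence. -/
theorem GeomBound.norm_doubleSeries_le {C M : ℝ} {p : ℕ → ℕ → ℝ} (h : GeomBound C M p)
    (hM : 0 ≤ M) (n : ℕ) : ‖doubleSeries p n‖ ≤ C * (2 * M) ^ n := by
  have hC := h.nonneg
  calc ‖doubleSeries p n‖ ≤ ∑ ij ∈ antidiagonal n, C * M ^ n := by
        refine norm_sum_le_of_le _ fun ij hij => ?_
        rw [Finset.HasAntidiagonal.mem_antidiagonal] at hij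
        rw [norm_smul, ← hij, Real.norm_eq_abs]
        have h1 : ‖(ContinuousMultilinearMap.mkPiAlgebra ℝ (Fin (ij.1 + ij.2)) ℝ).compContinuousLinearMap
            fun m => if (m : ℕ) < ij.1 then ContinuousLinearMap.fst ℝ ℝ ℝ
            else ContinuousLinearMap.snd ℝ ℝ ℝ‖ ≤ 1 := by
          refine (ContinuousMultilinearMap.norm_compContinuousLinearMap_le _ _).trans ?_
          rw [ContinuousMultilinearMap.norm_mkPiAlgebra, one_mul]
          refine Finset.prod_le_one (fun _ _ => norm_nonneg _) fun m _ => ?_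
          split_ifs
          · exact ContinuousLinearMap.norm_fst_le ℝ ℝ ℝ
          · exact ContinuousLinearMap.norm_snd_le ℝ ℝ ℝ
        calc _ ≤ (C * M ^ (ij.1 + ij.2)) * 1 := by gcongr; exact h _ _
          _ = _ := mul_one _
    _ = (n + 1 : ℕ) * (C * M ^ n) := by simp
    _ ≤ (2 ^ n : ℕ) * (C * M ^ n) := by
        gcongr
        exact Nat.lt_two_pow_self
    _ = _ := by push_cast; rw [mul_pow]; ring

theorem GeomBound.analyticAt_doubleSum {C M : ℝ} {p : ℕ → ℕ → ℝ} (h : GeomBound C M p)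
    (hM : 0 < M) {z : ℝ × ℝ} (hz : 2 * M * ‖z‖ < 1) :
    AnalyticAt ℝ (fun z : ℝ × ℝ => doubleSum p z.1 z.2) z := by
  set r : NNReal := ⟨(2 * M)⁻¹, by positivity⟩ with hr
  have hr' : (r : ℝ) = (2 * M)⁻¹ := rfl
  have key : HasFPowerSeriesOnBall (fun z : ℝ × ℝ => doubleSum p z.1 z.2) (doubleSeries p) 0 r := by
    refine ⟨FormalMultilinearSeries.le_radius_of_bound _ C fun n => ?_, ?_, ?_⟩
    · rw [hr', inv_pow]
      have := h.norm_doubleSeries_le hM.le n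
      rw [← div_eq_mul_inv, div_le_iff₀ (by positivity)]
      exact this
    · simp only [ENNReal.coe_pos, ← NNReal.coe_pos, hr']; positivity
    · intro y hy
      have hy' : ‖y‖ < (2 * M)⁻¹ := by
        simpa [Metric.mem_eball, edist_zero_right, enorm_lt_coe, ← NNReal.coe_lt_coe, hr'] using hy
      have hy2 : M * ‖y‖ < 1 := by
        have := (lt_inv_mul_iff₀ (show 0 < 2 * M by positivity)).1 ((mul_one (2 * M)⁻¹).symm ▸ hy')
        nlinarith [norm_nonneg y]
      have h1 : M * |y.1| < 1 := lt_of_le_of_lt (by gcongr; exact norm_fst_le y) hy2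
      have h2 : M * |y.2| < 1 := lt_of_le_of_lt (by gcongr; exact norm_snd_le y) hy2
      simp only [zero_add, doubleSeries_apply]
      exact h.hasSum_antidiagonal hM.le h1 h2
  refine key.analyticAt_of_mem ?_
  have : ‖z‖ < (2 * M)⁻¹ := by
    rw [← mul_one (2 * M)⁻¹, lt_inv_mul_iff₀ (by positivity)]
    exact hz
  simpa [Metric.mem_eball, edist_zero_right, enorm_lt_coe, ← NNReal.coe_lt_coe, hr'] using this

/-! ### Power series along a plane -/

section Plane

variable {E : Type*} [NormedAddCommGroup E] [NormedSpace ℝ E]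

/-- The coefficient of `ξ ^ i * η ^ (n - i)` in `p n (ξ • u + η • w, …, ξ • u + η • w)`. -/
noncomputable def planeCoeff (p : FormalMultilinearSeries ℝ E ℝ) (n i : ℕ) (u w : E) : ℝ :=
  ∑ S ∈ Finset.powersetCard i (Finset.univ : Finset (Fin n)),
    p n (S.piecewise (fun _ => u) (fun _ => w))

/-- Multilinear expansion over the set S of slots that receive ξ • u; grouping by the cardinality of
S gives one coefficient for each bidegree. -/
theorem apply_smul_add_smul (p : FormalMultilinearSeries ℝ E ℝ) (n : ℕ) (u w : E) (ξ η : ℝ) :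
    p n (fun _ => ξ • u + η • w) =
      ∑ ij ∈ antidiagonal n, planeCoeff p (ij.1 + ij.2) ij.1 u w * ξ ^ ij.1 * η ^ ij.2 := by
  have h1 : p n (fun _ => ξ • u + η • w) =
      ∑ S : Finset (Fin n), ξ ^ S.card * η ^ (n - S.card) *
        p n (S.piecewise (fun _ => u) (fun _ => w)) := by
    have := (p n).map_add_univ (fun _ => ξ • u) (fun _ => η • w)
    refine this.trans (Finset.sum_congr rfl fun S _ => ?_)
    have h2 : S.piecewise (fun _ => ξ • u) (fun _ => η • w) = fun m =>
        (S.piecewise (fun _ => ξ) (fun _ => η) : Fin n → ℝ) m •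
          (S.piecewise (fun _ => u) (fun _ => w) : Fin n → E) m := by
      funext m
      by_cases hm : m ∈ S <;> simp [hm]
    rw [h2, (p n).map_smul_univ, smul_eq_mul]
    congr 1
    rw [Finset.prod_piecewise]
    simp [Finset.card_sdiff]
  rw [h1, Finset.Nat.sum_antidiagonal_eq_sum_range_succ_mk, ← Finset.powerset_univ,
    Finset.sum_powerset]
  simp only [Finset.card_univ, Fintype.card_fin]
  refine Finset.sum_congr rfl fun i hi => ?_
  have hi' : i + (n - i) = n := by
    have := Finset.mem_range.1 hi
    omega
  have hc : planeCoeff p (i + (n - i)) i u w = planeCoeff p n i u w := by rw [hi']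
  simp only [hc]
  rw [planeCoeff, Finset.sum_mul, Finset.sum_mul]
  refine Finset.sum_congr rfl fun S hS => ?_
  rw [(Finset.mem_powersetCard.1 hS).2]
  ring

/-- The bound 1/2 on the two vectors pays for the binomial count: C(n, i) ≤ 2^n subsets against
(1/2)^n. The directions of ξ and η used later have norm at most 1/2. -/
theorem abs_planeCoeff_le (p : FormalMultilinearSeries ℝ E ℝ) (n i : ℕ) {u w : E}
    (hu : ‖u‖ ≤ 1 / 2) (hw : ‖w‖ ≤ 1 / 2) : |planeCoeff p n i u w| ≤ ‖p n‖ := by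
  calc |planeCoeff p n i u w|
      ≤ ∑ S ∈ Finset.powersetCard i (Finset.univ : Finset (Fin n)), ‖p n‖ * (1 / 2) ^ n := by
        rw [planeCoeff, ← Real.norm_eq_abs]
        refine norm_sum_le_of_le _ fun S _ => ?_
        refine ((p n).le_opNorm _).trans ?_
        gcongr
        refine (Finset.prod_le_prod (g := fun _ => (1 / 2 : ℝ)) (fun _ _ => norm_nonneg _)
          fun m _ => ?_).trans (by simp)
        by_cases hm : m ∈ S
        · simpa [hm] using hu
        · simpa [hm] using hw
    _ ≤ ‖p n‖ := by
        rw [Finset.sum_const, Finset.card_powersetCard, Finset.card_univ, Fintype.card_fin,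
          nsmul_eq_mul]
        have : (n.choose i : ℝ) ≤ 2 ^ n := by exact_mod_cast Nat.choose_le_two_pow n i
        calc (n.choose i : ℝ) * (‖p n‖ * (1 / 2) ^ n) ≤ 2 ^ n * (‖p n‖ * (1 / 2) ^ n) := by gcongr
          _ = _ := by rw [one_div, inv_pow]; field_simp

/-- Complementation of the set of slots. -/
theorem planeCoeff_swap (p : FormalMultilinearSeries ℝ E ℝ) (i j : ℕ) (u w : E) :
    planeCoeff p (i + j) i u w = planeCoeff p (i + j) j w u := by
  refine Finset.sum_nbij' (fun S => Sᶜ) (fun S => Sᶜ) ?_ ?_ ?_ ?_ ?_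
  · intro S hS
    simp only [Finset.mem_powersetCard, Finset.subset_univ, true_and] at hS ⊢
    rw [Finset.card_compl, hS]; simp
  · intro S hS
    simp only [Finset.mem_powersetCard, Finset.subset_univ, true_and] at hS ⊢
    rw [Finset.card_compl, hS]; simp
  · simp
  · simp
  · intro S _
    congr 1
    funext m
    by_cases hm : m ∈ S <;> simp [hm]

theorem planeCoeff_neg (p : FormalMultilinearSeries ℝ E ℝ) (n i : ℕ) (u w : E) :
    planeCoeff p n i (-u) (-w) = (-1) ^ n * planeCoeff p n i u w := by
  rw [planeCoeff, planeCoeff, Finset.mul_sum]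
  refine Finset.sum_congr rfl fun S _ => ?_
  have h2 : S.piecewise (fun _ => -u) (fun _ => -w) = fun m =>
      (-1 : ℝ) • (S.piecewise (fun _ => u) (fun _ => w) : Fin n → E) m := by
    funext m
    by_cases hm : m ∈ S <;> simp [hm]
  rw [h2, (p n).map_smul_univ]
  simp

theorem continuous_planeCoeff (p : FormalMultilinearSeries ℝ E ℝ) (n i : ℕ) :
    Continuous fun z : E × E => planeCoeff p n i z.1 z.2 := by
  refine continuous_finsetSum _ fun S _ => (p n).cont.comp ?_
  refine continuous_pi fun m => ?_
  by_cases hm : m ∈ S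
  · simpa [hm] using continuous_fst
  · simpa [hm] using continuous_snd

/-- Expansion of an analytic function along the plane spanned by `u` and `w`. -/
theorem hasSum_planeCoeff {f : E → ℝ} {p : FormalMultilinearSeries ℝ E ℝ} {ρ : ENNReal}
    (hf : HasFPowerSeriesOnBall f p 0 ρ) {C M : ℝ} (hM : 0 ≤ M) (hp : ∀ n, ‖p n‖ ≤ C * M ^ n)
    {u w : E} (hu : ‖u‖ ≤ 1 / 2) (hw : ‖w‖ ≤ 1 / 2) {ξ η : ℝ} (hξ : M * |ξ| < 1)
    (hη : M * |η| < 1) (hmem : ξ • u + η • w ∈ Metric.eball (0 : E) ρ) :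
    HasSum (fun ij : ℕ × ℕ => planeCoeff p (ij.1 + ij.2) ij.1 u w * ξ ^ ij.1 * η ^ ij.2)
      (f (ξ • u + η • w)) := by
  have hb : GeomBound C M fun i j => planeCoeff p (i + j) i u w := fun i j =>
    (abs_planeCoeff_le p _ _ hu hw).trans (hp _)
  have hs := hb.hasSum_antidiagonal hM hξ hη
  have h2 := hf.hasSum hmem
  simp only [zero_add] at h2
  have := hs.unique (h2.congr_fun fun n => (apply_smul_add_smul p n u w ξ η).symm)
  rw [← this]
  exact hb.hasSum hM hξ hη

end Plane

/-! ### Multiplication of double power series by linear forms -/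

/-- Coefficients of `ξ` times a double power series in `ξ, η`. -/
def mulX (p : ℕ → ℕ → ℝ) : ℕ → ℕ → ℝ
  | 0, _ => 0
  | i + 1, j => p i j

/-- Coefficients of `η` times a double power series in `ξ, η`. -/
def mulY (p : ℕ → ℕ → ℝ) : ℕ → ℕ → ℝ
  | _, 0 => 0
  | i, j + 1 => p i j

/-- Coefficients of `(ξ - η) / 2` times a double power series in `ξ, η`. -/
noncomputable def mulS (p : ℕ → ℕ → ℝ) (i j : ℕ) : ℝ := (mulX p i j - mulY p i j) / 2

/-- Coefficients of `(ξ + η) / 2` times a double power series in `ξ, η`. -/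
noncomputable def mulT (p : ℕ → ℕ → ℝ) (i j : ℕ) : ℝ := (mulX p i j + mulY p i j) / 2

/-- Coefficients of `((ξ - η) / 2) ^ a * ((ξ + η) / 2) ^ b` times a double power series. -/
noncomputable def mulST (a b : ℕ) (p : ℕ → ℕ → ℝ) : ℕ → ℕ → ℝ := mulS^[a] (mulT^[b] p)

/-- Properties are carried through the factors t = (ξ + η)/2 first and then s = (ξ - η)/2, the order
in which `mulST` applies them. -/
theorem mulST_induction {Q : ℕ → ℕ → (ℕ → ℕ → ℝ) → Prop} {p : ℕ → ℕ → ℝ} (h0 : Q 0 0 p)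
    (hT : ∀ b q, Q 0 b q → Q 0 (b + 1) (mulT q))
    (hS : ∀ a b q, Q a b q → Q (a + 1) b (mulS q)) (a b : ℕ) : Q a b (mulST a b p) := by
  have h1 : Q 0 b (mulT^[b] p) := by
    induction b with
    | zero => exact h0
    | succ b ih => rw [Function.iterate_succ_apply']; exact hT _ _ ih
  induction a with
  | zero => exact h1
  | succ a ih => rw [mulST, Function.iterate_succ_apply']; exact hS _ _ _ ih

/-- The index shift lowers the available power of M by one; M ≥ 1 keeps the same constants. -/
theorem GeomBound.mulX {C M : ℝ} {p : ℕ → ℕ → ℝ} (h : GeomBound C M p) (hM : 1 ≤ M) :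
    GeomBound C M (mulX p) := by
  have hC := h.nonneg
  rintro (_ | i) j
  · simp only [DensityOfStates.mulX, abs_zero]; positivity
  · refine (h i j).trans ?_
    gcongr
    omega

theorem GeomBound.mulY {C M : ℝ} {p : ℕ → ℕ → ℝ} (h : GeomBound C M p) (hM : 1 ≤ M) :
    GeomBound C M (mulY p) := by
  have hC := h.nonneg
  rintro i (_ | j)
  · simp only [DensityOfStates.mulY, abs_zero]; positivity
  · refine (h i j).trans ?_
    gcongr
    omega

theorem GeomBound.mulS {C M : ℝ} {p : ℕ → ℕ → ℝ} (h : GeomBound C M p) (hM : 1 ≤ M) :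
    GeomBound C M (mulS p) := by
  intro i j
  have h1 := abs_le.1 (h.mulX hM i j)
  have h2 := abs_le.1 (h.mulY hM i j)
  rw [DensityOfStates.mulS, abs_le]
  constructor <;> linarith

theorem GeomBound.mulT {C M : ℝ} {p : ℕ → ℕ → ℝ} (h : GeomBound C M p) (hM : 1 ≤ M) :
    GeomBound C M (mulT p) := by
  intro i j
  have h1 := abs_le.1 (h.mulX hM i j)
  have h2 := abs_le.1 (h.mulY hM i j)
  rw [DensityOfStates.mulT, abs_le]
  constructor <;> linarith

theorem GeomBound.mulST {C M : ℝ} {p : ℕ → ℕ → ℝ} (h : GeomBound C M p) (hM : 1 ≤ M) (a b : ℕ) :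
    GeomBound C M (mulST a b p) :=
  mulST_induction (Q := fun _ _ q => GeomBound C M q) h (fun _ _ hq => hq.mulT hM)
    (fun _ _ _ hq => hq.mulS hM) a b

theorem hasSum_mulX {p : ℕ → ℕ → ℝ} {x y s : ℝ}
    (h : HasSum (fun ij : ℕ × ℕ => p ij.1 ij.2 * x ^ ij.1 * y ^ ij.2) s) :
    HasSum (fun ij : ℕ × ℕ => mulX p ij.1 ij.2 * x ^ ij.1 * y ^ ij.2) (x * s) := by
  have hinj : Function.Injective fun ij : ℕ × ℕ => (ij.1 + 1, ij.2) := by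
    rintro ⟨a, b⟩ ⟨c, d⟩ h
    simpa using h
  rw [← hinj.hasSum_iff]
  · refine (h.mul_left x).congr_fun fun ij => ?_
    simp only [Function.comp, mulX]
    ring
  · rintro ⟨i, j⟩ hij
    cases i with
    | zero => simp [mulX]
    | succ i => exact (hij ⟨(i, j), rfl⟩).elim

theorem hasSum_mulY {p : ℕ → ℕ → ℝ} {x y s : ℝ}
    (h : HasSum (fun ij : ℕ × ℕ => p ij.1 ij.2 * x ^ ij.1 * y ^ ij.2) s) :
    HasSum (fun ij : ℕ × ℕ => mulY p ij.1 ij.2 * x ^ ij.1 * y ^ ij.2) (y * s) := by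
  have hinj : Function.Injective fun ij : ℕ × ℕ => (ij.1, ij.2 + 1) := by
    rintro ⟨a, b⟩ ⟨c, d⟩ h
    simpa using h
  rw [← hinj.hasSum_iff]
  · refine (h.mul_left y).congr_fun fun ij => ?_
    simp only [Function.comp, mulY]
    ring
  · rintro ⟨i, j⟩ hij
    cases j with
    | zero => simp [mulY]
    | succ j => exact (hij ⟨(i, j), rfl⟩).elim

theorem hasSum_mulST {p : ℕ → ℕ → ℝ} {x y s : ℝ}
    (h : HasSum (fun ij : ℕ × ℕ => p ij.1 ij.2 * x ^ ij.1 * y ^ ij.2) s) (a b : ℕ) :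
    HasSum (fun ij : ℕ × ℕ => mulST a b p ij.1 ij.2 * x ^ ij.1 * y ^ ij.2)
      (((x - y) / 2) ^ a * ((x + y) / 2) ^ b * s) := by
  refine mulST_induction (Q := fun a b q =>
    HasSum (fun ij : ℕ × ℕ => q ij.1 ij.2 * x ^ ij.1 * y ^ ij.2)
      (((x - y) / 2) ^ a * ((x + y) / 2) ^ b * s)) (by simpa using h) ?_ ?_ a b
  · intro b q hq
    have := ((hasSum_mulX hq).add (hasSum_mulY hq)).div_const 2
    rw [show ((x - y) / 2) ^ 0 * ((x + y) / 2) ^ (b + 1) * s =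
      (x * (((x - y) / 2) ^ 0 * ((x + y) / 2) ^ b * s) +
        y * (((x - y) / 2) ^ 0 * ((x + y) / 2) ^ b * s)) / 2 by ring]
    refine this.congr_fun fun ij => ?_
    simp only [mulT]; ring
  · intro a b q hq
    have := ((hasSum_mulX hq).sub (hasSum_mulY hq)).div_const 2
    rw [show ((x - y) / 2) ^ (a + 1) * ((x + y) / 2) ^ b * s =
      (x * (((x - y) / 2) ^ a * ((x + y) / 2) ^ b * s) -
        y * (((x - y) / 2) ^ a * ((x + y) / 2) ^ b * s)) / 2 by ring]
    refine this.congr_fun fun ij => ?_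
    simp only [mulS]; ring

theorem mulX_swap {ε : ℝ} {p : ℕ → ℕ → ℝ} (h : ∀ i j, p j i = ε * p i j) (i j : ℕ) :
    mulX p j i = ε * mulY p i j := by
  cases j with
  | zero => simp [mulX, mulY]
  | succ j => exact h i j

theorem mulY_swap {ε : ℝ} {p : ℕ → ℕ → ℝ} (h : ∀ i j, p j i = ε * p i j) (i j : ℕ) :
    mulY p j i = ε * mulX p i j := by
  cases i with
  | zero => simp [mulX, mulY]
  | succ i => exact h i j

/-- Exchanging ξ and η changes the sign of s = (ξ - η)/2 and fixes t = (ξ + η)/2. -/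
theorem mulST_swap {p : ℕ → ℕ → ℝ} (h : ∀ i j, p j i = p i j) (a b i j : ℕ) :
    mulST a b p j i = (-1) ^ a * mulST a b p i j := by
  refine mulST_induction (Q := fun a b q => ∀ i j, q j i = (-1 : ℝ) ^ a * q i j)
    (by simpa using h) ?_ ?_ a b i j
  · intro b q hq i j
    rw [mulT, mulT, mulX_swap hq i j, mulY_swap hq i j]; ring
  · intro a b q hq i j
    rw [mulS, mulS, mulX_swap hq i j, mulY_swap hq i j]; ring

theorem mulST_eq_zero_of_odd {p : ℕ → ℕ → ℝ} (h : ∀ i j, Odd (i + j) → p i j = 0) (a b i j : ℕ)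
    (hij : Odd (i + j + (a + b))) : mulST a b p i j = 0 := by
  have key : ∀ (n : ℕ) (q : ℕ → ℕ → ℝ), (∀ i j, Odd (i + j + n) → q i j = 0) →
      ∀ i j, Odd (i + j + (n + 1)) → mulX q i j = 0 ∧ mulY q i j = 0 := by
    intro n q hq i j hij
    constructor
    · cases i with
      | zero => rfl
      | succ i => exact hq _ _ (by rw [Nat.odd_iff] at hij ⊢; omega)
    · cases j with
      | zero => rfl
      | succ j => exact hq _ _ (by rw [Nat.odd_iff] at hij ⊢; omega)
  refine mulST_induction (Q := fun a b q => ∀ i j, Odd (i + j + (a + b)) → q i j = 0)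
    (by simpa using h) ?_ ?_ a b i j hij
  · intro b q hq i j hij
    obtain ⟨h1, h2⟩ := key (0 + b) q hq i j (by convert hij using 1; omega)
    simp [mulT, h1, h2]
  · intro a b q hq i j hij
    obtain ⟨h1, h2⟩ := key (a + b) q hq i j (by convert hij using 1; omega)
    simp [mulS, h1, h2]

theorem mulST_eq_zero_of_lt (p : ℕ → ℕ → ℝ) (a b i j : ℕ) (hij : i + j < a + b) :
    mulST a b p i j = 0 := by
  have key : ∀ (n : ℕ) (q : ℕ → ℕ → ℝ), (∀ i j, i + j < n → q i j = 0) →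
      ∀ i j, i + j < n + 1 → mulX q i j = 0 ∧ mulY q i j = 0 := by
    intro n q hq i j hij
    constructor
    · cases i with
      | zero => rfl
      | succ i => exact hq _ _ (by omega)
    · cases j with
      | zero => rfl
      | succ j => exact hq _ _ (by omega)
  refine mulST_induction (Q := fun a b q => ∀ i j, i + j < a + b → q i j = 0)
    (by simp) ?_ ?_ a b i j hij
  · intro b q hq i j hij
    obtain ⟨h1, h2⟩ := key (0 + b) q hq i j (by omega)
    simp [mulT, h1, h2]
  · intro a b q hq i j hij
    obtain ⟨h1, h2⟩ := key (a + b) q hq i j (by omega)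
    simp [mulS, h1, h2]

/-- The coefficients of the constant `1`. -/
def unitCoeff (i j : ℕ) : ℝ := if i = 0 ∧ j = 0 then 1 else 0

/-- In the lowest degree a + b only the constant term of the series can contribute, so the leading
behaviour is that of s^a t^b itself. -/
theorem mulST_leading (p : ℕ → ℕ → ℝ) (a b i j : ℕ) (hij : i + j = a + b) :
    mulST a b p i j = p 0 0 * mulST a b unitCoeff i j := by
  set c := p 0 0 with hc
  have key : ∀ (n : ℕ) (q q' : ℕ → ℕ → ℝ), (∀ i j, i + j = n → q i j = c * q' i j) →
      ∀ i j, i + j = n + 1 → mulX q i j = c * mulX q' i j ∧ mulY q i j = c * mulY q' i j := by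
    intro n q q' hq i j hij
    constructor
    · cases i with
      | zero => simp [mulX]
      | succ i => exact hq _ _ (by omega)
    · cases j with
      | zero => simp [mulY]
      | succ j => exact hq _ _ (by omega)
  have hT : ∀ b i j, i + j = b → mulT^[b] p i j = c * mulT^[b] unitCoeff i j := by
    intro b
    induction b with
    | zero =>
      intro i j hij
      obtain ⟨rfl, rfl⟩ : i = 0 ∧ j = 0 := by omega
      simp [unitCoeff, hc]
    | succ b ih =>
      intro i j hij
      rw [Function.iterate_succ_apply', Function.iterate_succ_apply']
      obtain ⟨h1, h2⟩ := key b _ _ ih i j hij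
      rw [mulT, mulT, h1, h2]; ring
  induction a generalizing i j with
  | zero => exact hT b i j (by omega)
  | succ a ih =>
    rw [mulST, mulST, Function.iterate_succ_apply', Function.iterate_succ_apply']
    obtain ⟨h1, h2⟩ := key (a + b) _ _ ih i j (by omega)
    rw [mulS, mulS]
    simp only [mulST] at h1 h2
    rw [h1, h2]; ring

theorem mulX_mulY (p : ℕ → ℕ → ℝ) (i j : ℕ) : mulX (mulY p) i j = mulY (mulX p) i j := by
  cases i <;> cases j <;> rfl

theorem mulX_mulS (p : ℕ → ℕ → ℝ) (i j : ℕ) :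
    mulX (mulS p) i j = (mulX (mulX p) i j - mulX (mulY p) i j) / 2 := by
  cases i <;> simp [mulX, mulS]

theorem mulY_mulS (p : ℕ → ℕ → ℝ) (i j : ℕ) :
    mulY (mulS p) i j = (mulX (mulY p) i j - mulY (mulY p) i j) / 2 := by
  rw [mulX_mulY]
  cases j <;> simp [mulY, mulS]

theorem mulX_mulT (p : ℕ → ℕ → ℝ) (i j : ℕ) :
    mulX (mulT p) i j = (mulX (mulX p) i j + mulX (mulY p) i j) / 2 := by
  cases i <;> simp [mulX, mulT]

theorem mulY_mulT (p : ℕ → ℕ → ℝ) (i j : ℕ) :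
    mulY (mulT p) i j = (mulX (mulY p) i j + mulY (mulY p) i j) / 2 := by
  rw [mulX_mulY]
  cases j <;> simp [mulY, mulT]

theorem mulS_mulT_comm : Function.Commute mulS mulT := by
  intro p
  funext i j
  rw [mulS, mulT, mulX_mulS, mulY_mulS, mulX_mulT, mulY_mulT]
  ring

/-- The identity t² = s² + ξ η. -/
theorem mulT_mulT (p : ℕ → ℕ → ℝ) (i j : ℕ) :
    mulT (mulT p) i j = mulS (mulS p) i j + mulX (mulY p) i j := by
  rw [mulS, mulT, mulX_mulS, mulY_mulS, mulX_mulT, mulY_mulT]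
  ring

/-! ### Weighted sums of the coefficients of a given degree -/

/-- The sum of the coefficients of degree `n`, weighted by a function of `i - j`. -/
noncomputable def antidiagSum (w : ℤ → ℝ) (n : ℕ) (p : ℕ → ℕ → ℝ) : ℝ :=
  ∑ ij ∈ antidiagonal n, w ((ij.1 : ℤ) - ij.2) * p ij.1 ij.2

/-- Multiplication by ξ η moves (i, j) to (i + 1, j + 1) and keeps i - j; weights depending only on
i - j do not notice it. -/
theorem antidiagSum_mulX_mulY (w : ℤ → ℝ) (n : ℕ) (p : ℕ → ℕ → ℝ) :
    antidiagSum w (n + 2) (mulX (mulY p)) = antidiagSum w n p := by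
  rw [antidiagSum, Finset.Nat.sum_antidiagonal_succ, Finset.Nat.sum_antidiagonal_succ']
  simp [mulX, mulY, antidiagSum]

/-- The relation s² = t² - ξ η after weighting. It has the shape of `eulerBeta_add_one`, and so
reduces the exponent of s to 0 or 1. -/
theorem antidiagSum_mulST_add_two (w : ℤ → ℝ) (a b : ℕ) (p : ℕ → ℕ → ℝ) :
    antidiagSum w (a + b + 2) (mulST (a + 2) b p) =
      antidiagSum w (a + b + 2) (mulST a (b + 2) p) - antidiagSum w (a + b) (mulST a b p) := by
  have h1 : mulST a (b + 2) p = mulT (mulT (mulST a b p)) := by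
    have h := (mulS_mulT_comm.iterate_left a)
    rw [mulST, mulST, Function.iterate_succ_apply', Function.iterate_succ_apply', h, h]
  have h2 : mulST (a + 2) b p = mulS (mulS (mulST a b p)) := by
    rw [mulST, mulST, Function.iterate_succ_apply', Function.iterate_succ_apply']
  rw [h1, h2, ← antidiagSum_mulX_mulY w (a + b), antidiagSum, antidiagSum, antidiagSum,
    ← Finset.sum_sub_distrib]
  refine Finset.sum_congr rfl fun ij _ => ?_
  rw [mulT_mulT]; ring

theorem iterate_mulT_unitCoeff (n i j : ℕ) (h : i + j = n) :
    mulT^[n] unitCoeff i j = (n.choose i : ℝ) / 2 ^ n := by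
  induction n generalizing i j with
  | zero =>
    obtain ⟨rfl, rfl⟩ : i = 0 ∧ j = 0 := by omega
    simp [unitCoeff]
  | succ n ih =>
    rw [Function.iterate_succ_apply', mulT]
    cases i with
    | zero =>
      obtain rfl : j = n + 1 := by omega
      simp only [mulX, mulY, ih 0 n (by omega), Nat.choose_zero_right]
      rw [pow_succ]; field_simp; simp
    | succ i =>
      cases j with
      | zero =>
        obtain rfl : i = n := by omega
        simp only [mulX, mulY, ih i 0 (by omega), Nat.choose_self]
        rw [pow_succ]; field_simp; simp
      | succ j =>
        simp only [mulX, mulY]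
        rw [ih i (j + 1) (by omega), ih (i + 1) j (by omega), Nat.choose_succ_succ]
        push_cast
        rw [pow_succ]; field_simp

/-- The operator ξ ∂_ξ - η ∂_η multiplies ξ^i η^j by i - j and maps t^(n+1) to (n + 1) s t^n. Hence
division by i - j, as in the primitive, leaves plain binomial coefficients. -/
theorem mulST_one_unitCoeff (n i j : ℕ) (h : i + j = n + 1) :
    mulST 1 n unitCoeff i j =
      ((i : ℝ) - j) * ((n + 1).choose i / ((n + 1) * 2 ^ (n + 1))) := by
  rw [mulST, Function.iterate_one, mulS]
  cases i with
  | zero =>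
    obtain rfl : j = n + 1 := by omega
    simp only [mulX, mulY, iterate_mulT_unitCoeff n 0 n (by omega), Nat.choose_zero_right]
    push_cast
    rw [pow_succ]; field_simp; ring
  | succ i =>
    cases j with
    | zero =>
      obtain rfl : i = n := by omega
      simp only [mulX, mulY, iterate_mulT_unitCoeff i i 0 (by omega), Nat.choose_self]
      push_cast
      rw [pow_succ]; field_simp; ring
    | succ j =>
      simp only [mulX, mulY]
      rw [iterate_mulT_unitCoeff n i (j + 1) (by omega),
        iterate_mulT_unitCoeff n (i + 1) j (by omega)]
      have h1 : ((n : ℝ) + 1) * n.choose i = (n + 1).choose (i + 1) * (i + 1) := by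
        exact_mod_cast Nat.add_one_mul_choose_eq n i
      have h2 : ((n + 1).choose (i + 1) : ℝ) = n.choose i + n.choose (i + 1) := by
        exact_mod_cast Nat.choose_succ_succ n i
      have h3 : (n : ℝ) = i + j + 1 := by
        have : n = i + j + 1 := by omega
        exact_mod_cast this
      have h4 : (n.choose (i + 1) : ℝ) = (n + 1).choose (i + 1) - n.choose i := by linarith
      rw [h4]
      have hn : (n : ℝ) + 1 ≠ 0 := by positivity
      have h5 : (n.choose i : ℝ) = (n + 1).choose (i + 1) * (i + 1) / (n + 1) := by
        field_simp; linarith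
      rw [h5, pow_succ]
      push_cast
      field_simp
      rw [h3]
      ring

/-! ### Leading constants -/

/-- Euler's Beta function in terms of the Gamma function. -/
noncomputable def eulerBeta (x y : ℝ) : ℝ := Real.Gamma x * Real.Gamma y / Real.Gamma (x + y)

theorem eulerBeta_add_one {x y : ℝ} (hx : 0 < x) (hy : 0 < y) :
    eulerBeta (x + 1) y = eulerBeta x y - eulerBeta x (y + 1) := by
  have hG : Real.Gamma (x + y) ≠ 0 := (Real.Gamma_pos_of_pos (by positivity)).ne'
  have hxy : x + y ≠ 0 := by positivity
  rw [eulerBeta, eulerBeta, eulerBeta, Real.Gamma_add_one hx.ne', Real.Gamma_add_one hy.ne',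
    show x + 1 + y = x + y + 1 by ring, show x + (y + 1) = x + y + 1 by ring,
    Real.Gamma_add_one hxy]
  field_simp
  ring

/-- Base case of the logarithmic family: the coefficient of (ξ η)^b in t^(2b). Both sides satisfy
the same first-order recursion in b. -/
theorem centralBinom_div_four_pow (b : ℕ) :
    ((2 * b).choose b : ℝ) / 2 ^ (2 * b) = eulerBeta (1 / 2) (b + 1 / 2) / Real.pi := by
  have h0 : ∀ b : ℕ, (Nat.centralBinom b : ℝ) / 4 ^ b =
      eulerBeta (1 / 2) (b + 1 / 2) / Real.pi := by
    intro b
    induction b with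
    | zero =>
      have : √Real.pi * √Real.pi = Real.pi := Real.mul_self_sqrt Real.pi_pos.le
      simp only [eulerBeta, Nat.cast_zero, zero_add]
      rw [show (1 / 2 + 1 / 2 : ℝ) = 1 by norm_num, Real.Gamma_one, Real.Gamma_one_half_eq, this]
      simp
    | succ b ih =>
      have h1 : ((b : ℝ) + 1) * (b + 1).centralBinom = 2 * (2 * b + 1) * b.centralBinom := by
        exact_mod_cast Nat.succ_mul_centralBinom_succ b
      have h2 : eulerBeta (1 / 2) ((b + 1 : ℕ) + 1 / 2) =
          (b + 1 / 2) / (b + 1) * eulerBeta (1 / 2) (b + 1 / 2) := by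
        have hb : (b : ℝ) + 1 ≠ 0 := by positivity
        have hb2 : (b : ℝ) + 1 / 2 ≠ 0 := by positivity
        rw [eulerBeta, eulerBeta, show (1 / 2 + (b + 1 / 2) : ℝ) = b + 1 by ring,
          show (1 / 2 + ((b + 1 : ℕ) + 1 / 2) : ℝ) = b + 1 + 1 by push_cast; ring,
          Real.Gamma_add_one hb, show (((b + 1 : ℕ) : ℝ) + 1 / 2) = b + 1 / 2 + 1 by push_cast; ring,
          Real.Gamma_add_one hb2]
        field_simp
      have hb : (b : ℝ) + 1 ≠ 0 := by positivity
      have h3 : ((b + 1).centralBinom : ℝ) = 2 * (2 * b + 1) * b.centralBinom / (b + 1) := by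
        field_simp; linarith
      rw [h2, mul_div_assoc, ← ih, h3, pow_succ]
      field_simp
      ring
  rw [← h0 b, Nat.centralBinom, pow_mul]
  norm_num

/-- The weight isolates the coefficient of (ξ η)^(a+b) in s^(2a) t^(2b), which multiplies the
logarithm. The induction is on a with b free, because one step uses the values at b and at b + 1. -/
theorem antidiagSum_diagonal (a b : ℕ) :
    antidiagSum (fun m => if m = 0 then 1 else 0) (2 * a + 2 * b) (mulST (2 * a) (2 * b) unitCoeff) =
      (-1) ^ a * eulerBeta (a + 1 / 2) (b + 1 / 2) / Real.pi := by
  induction a generalizing b with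
  | zero =>
    have : antidiagSum (fun m => if m = 0 then 1 else 0) (2 * 0 + 2 * b)
        (mulST (2 * 0) (2 * b) unitCoeff) = ((2 * b).choose b : ℝ) / 2 ^ (2 * b) := by
      rw [antidiagSum, Finset.sum_eq_single (b, b)]
      · simp [mulST, iterate_mulT_unitCoeff (2 * b) b b (by omega)]
      · rintro ⟨i, j⟩ hij hne
        rw [if_neg, zero_mul]
        rw [Finset.HasAntidiagonal.mem_antidiagonal] at hij
        intro h
        apply hne
        simp only at h hij
        ext <;> simp <;> omega
      · intro h
        exact (h (by rw [Finset.HasAntidiagonal.mem_antidiagonal]; simp; omega)).elim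
    rw [this, centralBinom_div_four_pow]
    simp
  | succ a ih =>
    have h := antidiagSum_mulST_add_two (fun m => if m = 0 then 1 else 0) (2 * a) (2 * b) unitCoeff
    have h1 := ih (b + 1)
    rw [show 2 * a + 2 * (b + 1) = 2 * a + 2 * b + 2 by ring, show 2 * (b + 1) = 2 * b + 2 by ring]
      at h1
    rw [show 2 * (a + 1) + 2 * b = 2 * a + 2 * b + 2 by ring, show 2 * (a + 1) = 2 * a + 2 by ring,
      h, h1, ih b]
    have h2 := eulerBeta_add_one (x := a + 1 / 2) (y := b + 1 / 2) (by positivity) (by positivity)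
    push_cast
    rw [show (a : ℝ) + 1 + 1 / 2 = a + 1 / 2 + 1 by ring, h2,
      show (b : ℝ) + 1 + 1 / 2 = b + 1 / 2 + 1 by ring, pow_succ]
    ring

/-- For any weight, the recursion reduces an odd power of s to s t^n. It changes n by 2 only, so the
parity of the exponent of t is fixed by b while c varies in the induction. -/
theorem antidiagSum_of_base {w : ℤ → ℝ} {b : ℕ}
    (h0 : ∀ c : ℕ, antidiagSum w (1 + (b + 2 * c)) (mulST 1 (b + 2 * c) unitCoeff) =
      1 / ((b + 2 * c : ℕ) + 1)) (a c : ℕ) :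
    antidiagSum w (2 * a + 1 + (b + 2 * c)) (mulST (2 * a + 1) (b + 2 * c) unitCoeff) =
      (-1) ^ a * eulerBeta (a + 1) (((b + 2 * c : ℕ) + 1) / 2) / 2 := by
  induction a generalizing c with
  | zero =>
    simp only [mul_zero, zero_add, h0]
    have hy : (0 : ℝ) < ((b + 2 * c : ℕ) + 1) / 2 := by positivity
    rw [eulerBeta]
    have hG := (Real.Gamma_pos_of_pos hy).ne'
    simp only [Nat.cast_zero, zero_add, Real.Gamma_one]
    rw [add_comm 1, Real.Gamma_add_one hy.ne']
    field_simp
  | succ a ih =>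
    have h := antidiagSum_mulST_add_two w (2 * a + 1) (b + 2 * c) unitCoeff
    have h1 := ih (c + 1)
    rw [show 2 * a + 1 + (b + 2 * (c + 1)) = 2 * a + 1 + (b + 2 * c) + 2 by ring,
      show b + 2 * (c + 1) = b + 2 * c + 2 by ring] at h1
    rw [show 2 * (a + 1) + 1 + (b + 2 * c) = 2 * a + 1 + (b + 2 * c) + 2 by ring,
      show 2 * (a + 1) + 1 = 2 * a + 1 + 2 by ring, h, h1, ih c]
    have h2 := eulerBeta_add_one (x := a + 1) (y := ((b + 2 * c : ℕ) + 1) / 2) (by positivity)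
      (by positivity)
    rw [show (((b + 2 * c + 2 : ℕ) : ℝ) + 1) / 2 = ((b + 2 * c : ℕ) + 1) / 2 + 1 by push_cast; ring]
    push_cast at h2 ⊢
    rw [h2, pow_succ]
    ring

theorem sum_antidiagonal_choose (n : ℕ) :
    ∑ ij ∈ antidiagonal n, (n.choose ij.1 : ℝ) = 2 ^ n := by
  rw [Finset.Nat.sum_antidiagonal_eq_sum_range_succ_mk]
  exact_mod_cast Nat.sum_range_choose n

/-- For even n the degree n + 1 is odd, so i ≠ j throughout; the weight cancels the factor i - j and
leaves the sum of a row of binomials. -/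
theorem antidiagSum_inv_base (n : ℕ) (hn : Even n) :
    antidiagSum (fun m => 1 / (m : ℝ)) (1 + n) (mulST 1 n unitCoeff) = 1 / ((n : ℝ) + 1) := by
  have : antidiagSum (fun m => 1 / (m : ℝ)) (1 + n) (mulST 1 n unitCoeff) =
      ∑ ij ∈ antidiagonal (n + 1), ((n + 1).choose ij.1 : ℝ) * (1 / ((n + 1) * 2 ^ (n + 1))) := by
    rw [antidiagSum, add_comm 1 n]
    refine Finset.sum_congr rfl fun ij hij => ?_
    rw [Finset.HasAntidiagonal.mem_antidiagonal] at hij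
    rw [mulST_one_unitCoeff n _ _ hij]
    have : ((ij.1 : ℝ) - ij.2) ≠ 0 := by
      rw [sub_ne_zero]
      intro h
      have h' : ij.1 = ij.2 := by exact_mod_cast h
      rw [Nat.even_iff] at hn
      omega
    push_cast
    field_simp
  rw [this, ← Finset.sum_mul, sum_antidiagonal_choose]
  field_simp

/-- This weight is the difference between the inner ends for E > 0 and E < 0. The extra signs form
an alternating sum of binomials, which vanishes. -/
theorem antidiagSum_alternating_base (n : ℕ) (hn : Odd n) :
    antidiagSum (fun m => (1 - (-1) ^ (m / 2)) / (m : ℝ)) (1 + n) (mulST 1 n unitCoeff) =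
      1 / ((n : ℝ) + 1) := by
  obtain ⟨c, rfl⟩ := hn
  have : antidiagSum (fun m => (1 - (-1) ^ (m / 2)) / (m : ℝ)) (1 + (2 * c + 1))
      (mulST 1 (2 * c + 1) unitCoeff) =
      ∑ ij ∈ antidiagonal (2 * c + 1 + 1), (((2 * c + 1 + 1).choose ij.1 : ℝ) -
        (-1) ^ (c + 1) * ((-1) ^ ij.1 * (2 * c + 1 + 1).choose ij.1))
          * (1 / (((2 * c + 1 : ℕ) + 1) * 2 ^ (2 * c + 1 + 1))) := by
    rw [antidiagSum, add_comm 1]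
    refine Finset.sum_congr rfl fun ij hij => ?_
    rw [Finset.HasAntidiagonal.mem_antidiagonal] at hij
    rw [mulST_one_unitCoeff _ _ _ hij]
    have h1 : ((ij.1 : ℤ) - ij.2) / 2 = (ij.1 : ℤ) - (c + 1 : ℕ) := by omega
    have h2 : ((-1 : ℝ) ^ (((ij.1 : ℤ) - ij.2) / 2)) = (-1) ^ (c + 1) * (-1) ^ ij.1 := by
      rw [h1, zpow_sub₀ (by norm_num), zpow_natCast, zpow_natCast, div_eq_mul_inv, ← inv_pow,
        inv_neg_one, mul_comm]
    rw [h2]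
    -- On the diagonal the weight is 0/0 = 0, and the two binomial terms on the right cancel as
    -- well.
    by_cases h : ij.1 = ij.2
    · have h3 : ij.1 = c + 1 := by omega
      rw [← h, h3]
      have : ((-1 : ℝ) ^ (c + 1)) * (-1) ^ (c + 1) = 1 := by
        rw [← mul_pow]; norm_num
      rw [← mul_assoc ((-1 : ℝ) ^ (c + 1)) ((-1) ^ (c + 1)), this]
      simp
    · have : ((ij.1 : ℝ) - ij.2) ≠ 0 := by
        rw [sub_ne_zero]
        exact_mod_cast h
      push_cast
      field_simp
  rw [this, ← Finset.sum_mul, Finset.sum_sub_distrib, sum_antidiagonal_choose, ← Finset.mul_sum]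
  have h0 : ∑ ij ∈ antidiagonal (2 * c + 1 + 1),
      ((-1 : ℝ) ^ ij.1 * (2 * c + 1 + 1).choose ij.1) = 0 := by
    rw [Finset.Nat.sum_antidiagonal_eq_sum_range_succ_mk]
    have := Int.alternating_sum_range_choose_of_ne (n := 2 * c + 1 + 1) (by omega)
    exact_mod_cast this
  rw [h0]
  push_cast
  field_simp
  ring

theorem antidiagSum_inv (a n : ℕ) (hn : Even n) :
    antidiagSum (fun m => 1 / (m : ℝ)) (2 * a + 1 + n) (mulST (2 * a + 1) n unitCoeff) =
      (-1) ^ a * eulerBeta (a + 1) ((n + 1) / 2) / 2 := by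
  obtain ⟨c, rfl⟩ := hn
  have := antidiagSum_of_base (w := fun m => 1 / (m : ℝ)) (b := 0)
    (fun c => antidiagSum_inv_base _ ⟨c, by ring⟩) a c
  rwa [show 0 + 2 * c = c + c by ring] at this

theorem antidiagSum_alternating (a n : ℕ) (hn : Odd n) :
    antidiagSum (fun m => (1 - (-1) ^ (m / 2)) / (m : ℝ)) (2 * a + 1 + n)
      (mulST (2 * a + 1) n unitCoeff) = (-1) ^ a * eulerBeta (a + 1) ((n + 1) / 2) / 2 := by
  obtain ⟨c, rfl⟩ := hn
  have := antidiagSum_of_base (w := fun m => (1 - (-1) ^ (m / 2)) / (m : ℝ)) (b := 1)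
    (fun c => antidiagSum_alternating_base _ ⟨c, by ring⟩) a c
  rwa [show 1 + 2 * c = 2 * c + 1 by ring] at this

/-! ### Power series in one variable -/

/-- The sum of a power series. -/
noncomputable def powSum (b : ℕ → ℝ) (x : ℝ) : ℝ := ∑' n, b n * x ^ n

theorem powSum_zero (b : ℕ → ℝ) : powSum b 0 = b 0 := by
  rw [powSum, tsum_eq_single 0 (fun n hn => by simp [hn])]
  simp

/-- A power series in one variable is a double power series supported on j = 0, restricted to the
first axis. -/
theorem analyticAt_powSum {b : ℕ → ℝ} {C M : ℝ} (hb : ∀ n, |b n| ≤ C * M ^ n) (hM : 0 < M) :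
    AnalyticAt ℝ (powSum b) 0 := by
  have hC : 0 ≤ C := by simpa using (abs_nonneg _).trans (hb 0)
  let q : ℕ → ℕ → ℝ := fun i j => if j = 0 then b i else 0
  have hq : GeomBound C M q := by
    intro i j
    by_cases hj : j = 0
    · simpa [q, hj] using hb i
    · simp only [q, hj, if_false, abs_zero]; positivity
  have h1 := hq.analyticAt_doubleSum hM (z := ((0 : ℝ), (0 : ℝ))) (by simp)
  have h2 : AnalyticAt ℝ (fun x : ℝ => doubleSum q x 0) 0 :=
    AnalyticAt.comp₂ (h := fun z : ℝ × ℝ => doubleSum q z.1 z.2) (f := fun x : ℝ => x)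
      (g := fun _ => (0 : ℝ)) h1 analyticAt_id analyticAt_const
  convert h2 using 2 with x
  have hinj : Function.Injective fun i : ℕ => (i, 0) := fun i j h => by simpa using h
  rw [powSum, doubleSum, ← hinj.tsum_eq]
  · simp [q]
  · rintro ⟨i, j⟩ hij
    cases j with
    | zero => exact ⟨i, rfl⟩
    | succ j => simp [q] at hij

theorem analyticAt_sqrt {x : ℝ} (hx : 0 < x) : AnalyticAt ℝ Real.sqrt x :=
  (Real.contDiffAt_sqrt (n := ⊤) hx.ne').analyticAt

/-! ### The outer end of a hyperbola in a ball -/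

/-- The largest value of `ξ` with `ξ * η = E` and `ξ ^ 2 + η ^ 2 ≤ 2 * R`. -/
noncomputable def outerEnd (R E : ℝ) : ℝ := √(R + √(R ^ 2 - E ^ 2))

theorem outerEnd_pos {R : ℝ} (hR : 0 < R) (E : ℝ) : 0 < outerEnd R E :=
  Real.sqrt_pos.2 (by positivity)

theorem outerEnd_sq {R : ℝ} (hR : 0 < R) (E : ℝ) : outerEnd R E ^ 2 = R + √(R ^ 2 - E ^ 2) :=
  Real.sq_sqrt (by positivity)

theorem outerEnd_sq_le {R : ℝ} (hR : 0 < R) (E : ℝ) : outerEnd R E ^ 2 ≤ 2 * R := by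
  rw [outerEnd_sq hR]
  have : √(R ^ 2 - E ^ 2) ≤ R := by
    rw [Real.sqrt_le_left hR.le]
    nlinarith [sq_nonneg E]
  linarith

/-- Both radicands are positive at E = 0. The boundary of the ball therefore causes no singularity.
-/
theorem analyticAt_outerEnd {R : ℝ} (hR : 0 < R) : AnalyticAt ℝ (outerEnd R) 0 := by
  have h1 : AnalyticAt ℝ (fun E : ℝ => R ^ 2 - E ^ 2) 0 :=
    analyticAt_const.sub (analyticAt_id.pow 2)
  have h2 : AnalyticAt ℝ (fun E : ℝ => R + √(R ^ 2 - E ^ 2)) 0 :=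
    analyticAt_const.add ((analyticAt_sqrt (by simp; positivity)).fun_comp h1)
  exact (analyticAt_sqrt (by positivity)).fun_comp h2

theorem sqrt_abs_le_outerEnd {R E : ℝ} (hE : |E| ≤ R) : √|E| ≤ outerEnd R E :=
  Real.sqrt_le_sqrt (hE.trans (le_add_of_nonneg_right (Real.sqrt_nonneg _)))

/-! ### Integration of a double power series along a hyperbola -/

/-- Coefficients of the off-diagonal part of the primitive. -/
noncomputable def primCoeff (p : ℕ → ℕ → ℝ) (i j : ℕ) : ℝ := p i j / ((i : ℝ) - j)

theorem GeomBound.prim {C M : ℝ} {p : ℕ → ℕ → ℝ} (h : GeomBound C M p) :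
    GeomBound C M (primCoeff p) := by
  intro i j
  refine le_trans ?_ (h i j)
  rw [primCoeff, abs_div]
  by_cases hij : i = j
  · simp [hij]
  · refine div_le_self (abs_nonneg _) ?_
    have : (1 : ℤ) ≤ |(i : ℤ) - j| := Int.one_le_abs (by omega)
    exact_mod_cast this

/-- Coefficients of the diagonal part. -/
noncomputable def diagCoeff (p : ℕ → ℕ → ℝ) (i j : ℕ) : ℝ := if i = j then p i j else 0

theorem GeomBound.diag {C M : ℝ} {p : ℕ → ℕ → ℝ} (h : GeomBound C M p) (hM : 0 ≤ M) :
    GeomBound C M (diagCoeff p) := by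
  intro i j
  have hC := h.nonneg
  rw [diagCoeff]
  split_ifs
  · exact h i j
  · rw [abs_zero]; positivity

/-- On the hyperbola the monomial is E^j ξ^(i-j), whose integral against dξ/ξ is a power unless i =
j. The logarithmic coefficient E^i is kept as b^i (E/b)^i, so that it is a term of a double power
series at the same point. -/
theorem integral_term (p : ℕ → ℕ → ℝ) (i j : ℕ) (E : ℝ) {a b : ℝ} (ha : 0 < a) (hb : 0 < b) :
    ∫ ξ in a..b, p i j * ξ ^ i * (E / ξ) ^ j / ξ =
      primCoeff p i j * b ^ i * (E / b) ^ j - primCoeff p i j * a ^ i * (E / a) ^ j +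
        (Real.log b - Real.log a) * (diagCoeff p i j * b ^ i * (E / b) ^ j) := by
  have h0 : (0 : ℝ) ∉ uIcc a b := fun h => by
    have := (uIcc_subset_Icc (a₂ := min a b) (b₂ := max a b) ⟨min_le_left _ _, le_max_left _ _⟩
      ⟨min_le_right _ _, le_max_right _ _⟩ h).1
    exact absurd this (not_le.2 (lt_min ha hb))
  have hzpow : ∀ x : ℝ, x ≠ 0 → x ^ i * (E / x) ^ j = E ^ j * x ^ ((i : ℤ) - j) := by
    intro x hx
    rw [zpow_sub₀ hx, zpow_natCast, zpow_natCast, div_pow]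
    field_simp
  have h1 : ∫ ξ in a..b, p i j * ξ ^ i * (E / ξ) ^ j / ξ =
      ∫ ξ in a..b, p i j * E ^ j * ξ ^ ((i : ℤ) - j - 1) := by
    refine intervalIntegral.integral_congr fun ξ hξ => ?_
    have hξ0 : ξ ≠ 0 := fun h => h0 (h ▸ hξ)
    rw [mul_assoc (p i j), hzpow ξ hξ0, zpow_sub_one₀ hξ0]
    ring
  rw [h1, intervalIntegral.integral_const_mul]
  by_cases hij : i = j
  -- Here `primCoeff p i i` divides by i - i = 0 and is 0, so that only the logarithm is left.
  · subst hij
    have h2 : ∫ ξ in a..b, ξ ^ ((i : ℤ) - i - 1) = ∫ ξ in a..b, ξ⁻¹ := by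
      refine intervalIntegral.integral_congr fun ξ _ => ?_
      simp
    rw [h2, integral_inv h0, Real.log_div hb.ne' ha.ne', primCoeff, diagCoeff, if_pos rfl,
      mul_assoc (p i i) (b ^ i), hzpow b hb.ne']
    simp
    ring
  · have hne : ((i : ℤ) - j - 1) ≠ -1 := by omega
    rw [integral_zpow (Or.inr ⟨hne, h0⟩), diagCoeff, if_neg hij, primCoeff,
      mul_assoc _ (b ^ i), hzpow b hb.ne', mul_assoc _ (a ^ i), hzpow a ha.ne']
    push_cast
    rw [sub_add_cancel, sub_add_cancel]
    ring

/-- Termwise integration. Starting at a with a² = |E| keeps |E/ξ| ≤ a ≤ ξ ≤ b, hence inside the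
domain of convergence. -/
theorem GeomBound.integral_hyperbola {C M : ℝ} {p : ℕ → ℕ → ℝ} (h : GeomBound C M p)
    (hM : 0 < M) {E a b : ℝ} (ha : 0 < a) (hab : a ≤ b) (hE : |E| = a ^ 2) (hb : M * b < 1) :
    ∫ ξ in a..b, doubleSum p ξ (E / ξ) / ξ =
      doubleSum (primCoeff p) b (E / b) - doubleSum (primCoeff p) a (E / a) +
        (Real.log b - Real.log a) * doubleSum (diagCoeff p) b (E / b) := by
  have hb0 : 0 < b := ha.trans_le hab
  have hC := h.nonneg
  have hMa : M * a < 1 := lt_of_le_of_lt (by gcongr) hb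
  have hEdiv : ∀ ξ, a ≤ ξ → |E / ξ| ≤ a := by
    intro ξ hξ
    have hξ0 : 0 < ξ := ha.trans_le hξ
    rw [abs_div, hE, abs_of_pos hξ0, div_le_iff₀ hξ0, sq]
    gcongr
  have hsmall : ∀ ξ, a ≤ ξ → ξ ≤ b → M * |ξ| < 1 ∧ M * |E / ξ| < 1 := by
    intro ξ h1 h2
    rw [abs_of_pos (ha.trans_le h1)]
    exact ⟨lt_of_le_of_lt (by gcongr) hb, lt_of_le_of_lt (by gcongr; exact hEdiv ξ h1) hMa⟩
  have hsum : HasSum (fun ij : ℕ × ℕ => ∫ ξ in a..b, p ij.1 ij.2 * ξ ^ ij.1 * (E / ξ) ^ ij.2 / ξ)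
      (∫ ξ in a..b, doubleSum p ξ (E / ξ) / ξ) := by
    -- The majorant uses ξ ≤ b, |E/ξ| ≤ a and 1/ξ ≤ 1/a; it does not depend on ξ.
    refine intervalIntegral.hasSum_integral_of_dominated_convergence
      (fun ij _ => C * ((M * b) ^ ij.1 * (M * a) ^ ij.2) / a) ?_ ?_ ?_ ?_ ?_
    · intro ij
      refine Measurable.aestronglyMeasurable ?_
      fun_prop
    · refine fun ij => ae_of_all _ fun ξ hξ => ?_
      rw [uIoc_of_le hab] at hξ
      have hξ0 : 0 < ξ := ha.trans hξ.1
      rw [norm_div, Real.norm_eq_abs ξ, abs_of_pos hξ0]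
      refine div_le_div₀ (by positivity) ((h.norm_term_le _ _ _).trans ?_) ha hξ.1.le
      rw [abs_of_pos hξ0]
      gcongr
      · exact hξ.2
      · exact hEdiv ξ hξ.1.le
    · exact ae_of_all _ fun ξ _ => ((summable_geometric_prod (by positivity) hb (by positivity)
        hMa).mul_left C).div_const a
    · exact intervalIntegrable_const
    · refine ae_of_all _ fun ξ hξ => ?_
      rw [uIoc_of_le hab] at hξ
      obtain ⟨h1, h2⟩ := hsmall ξ hξ.1.le hξ.2
      exact (h.hasSum hM.le h1 h2).div_const ξ
  simp only [integral_term p _ _ E ha hb0] at hsum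
  obtain ⟨ha1, ha2⟩ := hsmall a le_rfl hab
  obtain ⟨hb1, hb2⟩ := hsmall b hab le_rfl
  exact hsum.unique (((h.prim.hasSum hM.le hb1 hb2).sub
    (h.prim.hasSum hM.le ha1 ha2)).add
      (((h.diag hM.le).hasSum hM.le hb1 hb2).mul_left _))

/-! ### Parity of the coefficients -/

theorem abs_antidiagSum_le {w : ℤ → ℝ} (hw : ∀ m, |w m| ≤ 1) {C M : ℝ} {p : ℕ → ℕ → ℝ}
    (h : GeomBound C M p) (hM : 0 ≤ M) (n : ℕ) : |antidiagSum w n p| ≤ C * (2 * M) ^ n := by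
  have hC := h.nonneg
  calc |antidiagSum w n p| ≤ ∑ ij ∈ antidiagonal n, C * M ^ n := by
        rw [antidiagSum, ← Real.norm_eq_abs]
        refine norm_sum_le_of_le _ fun ij hij => ?_
        rw [Finset.HasAntidiagonal.mem_antidiagonal] at hij
        rw [norm_mul, ← hij, Real.norm_eq_abs, Real.norm_eq_abs]
        calc _ ≤ 1 * (C * M ^ (ij.1 + ij.2)) := by gcongr; exacts [hw _, h _ _]
          _ = _ := one_mul _
    _ = (n + 1 : ℕ) * (C * M ^ n) := by simp
    _ ≤ (2 ^ n : ℕ) * (C * M ^ n) := by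
        gcongr
        exact Nat.lt_two_pow_self
    _ = _ := by push_cast; rw [mul_pow]; ring

theorem abs_one_div_intCast_le (m : ℤ) : |1 / (m : ℝ)| ≤ 1 := by
  rw [abs_div, abs_one]
  by_cases hm : m = 0
  · simp [hm]
  · refine div_le_one_of_le₀ ?_ (abs_nonneg _)
    exact_mod_cast Int.one_le_abs hm

/-- Coefficients after the substitution `η ↦ -η`. -/
def twist (p : ℕ → ℕ → ℝ) (i j : ℕ) : ℝ := (-1) ^ j * p i j

theorem GeomBound.twist {C M : ℝ} {p : ℕ → ℕ → ℝ} (h : GeomBound C M p) :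
    GeomBound C M (twist p) := by
  intro i j
  simpa [DensityOfStates.twist, abs_mul] using h i j

/-- For E < 0 the inner end of the hyperbola is the point η = -ξ. -/
theorem doubleSum_primCoeff_neg (p : ℕ → ℕ → ℝ) (x : ℝ) :
    doubleSum (primCoeff p) x (-x) = doubleSum (primCoeff (twist p)) x x := by
  refine tsum_congr fun ij => ?_
  rw [primCoeff, primCoeff, twist, neg_pow x]
  ring

/-- Replacing η by -η exchanges s = (ξ - η)/2 and t = (ξ + η)/2: passing from E to -E exchanges the
negative and the positive directions. -/
theorem twist_mulS (p : ℕ → ℕ → ℝ) : twist (mulS p) = mulT (twist p) := by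
  funext i j
  rw [twist, mulS, mulT]
  cases i <;> cases j <;> simp [mulX, mulY, twist, pow_succ] <;> ring

theorem twist_mulT (p : ℕ → ℕ → ℝ) : twist (mulT p) = mulS (twist p) := by
  funext i j
  rw [twist, mulS, mulT]
  cases i <;> cases j <;> simp [mulX, mulY, twist, pow_succ] <;> ring

theorem twist_unitCoeff : twist unitCoeff = unitCoeff := by
  funext i j
  rw [twist, unitCoeff]
  by_cases h : j = 0 <;> simp [h]

theorem twist_mulST_unitCoeff (a b : ℕ) :
    twist (mulST a b unitCoeff) = mulST b a unitCoeff := by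
  have h1 : Function.Semiconj twist mulS mulT := twist_mulS
  have h2 : Function.Semiconj twist mulT mulS := twist_mulT
  rw [mulST, (h1.iterate_right a).eq, (h2.iterate_right b).eq, twist_unitCoeff, mulST,
    (mulS_mulT_comm.iterate_iterate b a).eq]

/-- The weight 1/(i - j) is odd under exchange of i and j. -/
theorem antidiagSum_inv_eq_zero {p : ℕ → ℕ → ℝ} {n : ℕ} (h : ∀ i j, i + j = n → p j i = p i j) :
    antidiagSum (fun m => 1 / (m : ℝ)) n p = 0 := by
  have h1 : antidiagSum (fun m => 1 / (m : ℝ)) n p = -antidiagSum (fun m => 1 / (m : ℝ)) n p := by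
    conv_lhs => rw [antidiagSum, ← Finset.Nat.sum_antidiagonal_swap]
    rw [antidiagSum, ← Finset.sum_neg_distrib]
    refine Finset.sum_congr rfl fun ij hij => ?_
    rw [Finset.HasAntidiagonal.mem_antidiagonal] at hij
    simp only [Prod.fst_swap, Prod.snd_swap]
    rw [h _ _ hij, ← neg_mul]
    congr 1
    rw [← neg_sub, Int.cast_neg, div_neg]
  linarith

theorem twist_swap {ε : ℝ} {p : ℕ → ℕ → ℝ} (h : ∀ i j, p j i = ε * p i j) (i j : ℕ) :
    twist p j i = ε * (-1) ^ (i + j) * twist p i j := by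
  have : ((-1 : ℝ) ^ j) * (-1) ^ j = 1 := by rw [← mul_pow]; norm_num
  rw [twist, twist, h, pow_add]
  linear_combination (-(ε * (-1) ^ i * p i j)) * this

/-- Collecting the terms of equal degree. -/
theorem doubleSum_primCoeff_diag {C M : ℝ} {p : ℕ → ℕ → ℝ} (h : GeomBound C M p) (hM : 0 ≤ M)
    {n₀ : ℕ} (h0 : ∀ n, n < n₀ ∨ Odd (n + n₀) → antidiagSum (fun m => 1 / (m : ℝ)) n p = 0)
    {x : ℝ} (hx : M * |x| < 1) :
    doubleSum (primCoeff p) x x =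
      x ^ n₀ * powSum (fun m => antidiagSum (fun m => 1 / (m : ℝ)) (n₀ + 2 * m) p) (x ^ 2) := by
  have h1 := h.prim.hasSum_antidiagonal hM hx hx
  have h2 : HasSum (fun n => antidiagSum (fun m => 1 / (m : ℝ)) n p * x ^ n)
      (doubleSum (primCoeff p) x x) := by
    refine h1.congr_fun fun n => ?_
    rw [antidiagSum, Finset.sum_mul]
    refine Finset.sum_congr rfl fun ij hij => ?_
    rw [Finset.HasAntidiagonal.mem_antidiagonal] at hij
    rw [primCoeff, ← hij, pow_add]
    push_cast
    ring
  have hinj : Function.Injective fun m : ℕ => n₀ + 2 * m := fun i j h => by simpa using h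
  rw [← h2.tsum_eq, powSum, ← tsum_mul_left, ← hinj.tsum_eq]
  · refine tsum_congr fun m => ?_
    rw [pow_add, pow_mul]; ring
  · intro n hn
    rw [Function.mem_support] at hn
    have : ¬ (n < n₀ ∨ Odd (n + n₀)) := fun h => hn (by rw [h0 n h, zero_mul])
    rw [not_or, Nat.not_odd_iff, not_lt] at this
    exact ⟨(n - n₀) / 2, by simp only; omega⟩

/-- On the hyperbola ξ η = E a diagonal monomial is a power of E, independent of the point. -/
theorem doubleSum_diagCoeff (p : ℕ → ℕ → ℝ) {b : ℝ} (hb : b ≠ 0) (E : ℝ) :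
    doubleSum (diagCoeff p) b (E / b) = powSum (fun j => p j j) E := by
  have hinj : Function.Injective fun i : ℕ => (i, i) := fun i j h => by simpa using h
  rw [powSum, doubleSum, ← hinj.tsum_eq]
  · refine tsum_congr fun j => ?_
    rw [diagCoeff, if_pos rfl, mul_assoc, ← mul_pow, mul_div_cancel₀ _ hb]
  · rintro ⟨i, j⟩ hij
    by_cases h : i = j
    · exact ⟨i, by rw [h]⟩
    · simp [diagCoeff, h] at hij

/-- The analytic part of the integral along a hyperbola. -/
noncomputable def regularPart (p : ℕ → ℕ → ℝ) (R E : ℝ) : ℝ :=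
  (doubleSum (primCoeff p) (outerEnd R E) (E / outerEnd R E) +
    Real.log (outerEnd R E) * powSum (fun j => p j j) E) / 2

theorem GeomBound.abs_diag_le {C M : ℝ} {p : ℕ → ℕ → ℝ} (h : GeomBound C M p) (j : ℕ) :
    |p j j| ≤ C * (M ^ 2) ^ j := by
  have := h j j
  rwa [← two_mul, pow_mul] at this

/-- Since `outerEnd` squared is at most 2R, the smallness condition on R puts the outer end inside
the radius 1/(2M) on which the double sum is analytic. -/
theorem analyticAt_regularPart {C M : ℝ} {p : ℕ → ℕ → ℝ} (h : GeomBound C M p) (hM : 0 < M)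
    {R : ℝ} (hR : 0 < R) (hRM : (2 * M) ^ 2 * (2 * R) < 1) :
    AnalyticAt ℝ (regularPart p R) 0 := by
  have hX := analyticAt_outerEnd hR
  have hX0 := outerEnd_pos hR 0
  have h1 : AnalyticAt ℝ (fun E : ℝ => E / outerEnd R E) 0 := analyticAt_id.div hX hX0.ne'
  have h2 : 2 * M * ‖(outerEnd R 0, (0 : ℝ) / outerEnd R 0)‖ < 1 := by
    have : ‖(outerEnd R 0, (0 : ℝ) / outerEnd R 0)‖ = outerEnd R 0 := by
      rw [zero_div, Prod.norm_mk, norm_zero, Real.norm_of_nonneg hX0.le, max_eq_left hX0.le]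
    rw [this]
    have := outerEnd_sq_le hR 0
    rw [← abs_of_pos (show 0 < 2 * M * outerEnd R 0 by positivity), ← sq_lt_one_iff_abs_lt_one,
      mul_pow]
    calc _ ≤ (2 * M) ^ 2 * (2 * R) := by gcongr
      _ < 1 := hRM
  have h3 := AnalyticAt.comp₂ (h.prim.analyticAt_doubleSum hM h2) hX h1
  have h4 : AnalyticAt ℝ (powSum fun j => p j j) 0 := analyticAt_powSum h.abs_diag_le (by positivity)
  exact (h3.add ((hX.log hX0).mul h4)).div_const

/-- Separates the analytic outer end from the inner end. The coefficient 1/4 of the logarithm is the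
prefactor 1/2 times that in log √|E| = log|E| / 2. -/
theorem hyperbola_integral_eq {C M : ℝ} {p : ℕ → ℕ → ℝ} (h : GeomBound C M p) (hM : 0 < M)
    {R : ℝ} (hR : 0 < R) (hRM : (2 * M) ^ 2 * (2 * R) < 1) {E : ℝ} (hE0 : E ≠ 0) (hE : |E| ≤ R) :
    (∫ ξ in √|E|..outerEnd R E, doubleSum p ξ (E / ξ) / ξ) / 2 =
      regularPart p R E - doubleSum (primCoeff p) (√|E|) (E / √|E|) / 2 -
        Real.log |E| * powSum (fun j => p j j) E / 4 := by
  have hX0 := outerEnd_pos hR E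
  have hMX : M * outerEnd R E < 1 := by
    have := outerEnd_sq_le hR E
    rw [← abs_of_pos (show 0 < M * outerEnd R E by positivity), ← sq_lt_one_iff_abs_lt_one, mul_pow]
    calc _ ≤ (2 * M) ^ 2 * (2 * R) := by gcongr; linarith
      _ < 1 := hRM
  rw [h.integral_hyperbola hM (Real.sqrt_pos.2 (abs_pos.2 hE0)) (sqrt_abs_le_outerEnd hE)
    (Real.sq_sqrt (abs_nonneg _)).symm hMX, doubleSum_diagCoeff p hX0.ne', regularPart,
    Real.log_sqrt (abs_nonneg _)]
  ring

/-! ### Branches and signs of the universal function, and the singular expansion. -/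

theorem universalSingularity_even {N κ : ℕ} (hκ : Even κ) (v : ℝ) :
    universalSingularity N κ v =
      (-1) ^ (κ / 2) * v ^ (((N : ℝ) - 2) / 2) * heaviside v := by
  rw [universalSingularity, if_pos hκ]

theorem universalSingularity_log {N κ : ℕ} (hκ : ¬ Even κ) (hN : Even N) (v : ℝ) :
    universalSingularity N κ v =
      (-1) ^ ((κ + 1) / 2) * v ^ ((N - 2) / 2) * (Real.pi⁻¹ * Real.log |v|) := by
  rw [universalSingularity, if_neg hκ, if_pos hN]

theorem universalSingularity_odd {N κ : ℕ} (hκ : ¬ Even κ) (hN : ¬ Even N) (v : ℝ) :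
    universalSingularity N κ v =
      (-1) ^ (((N : ℤ) - κ) / 2) * (-v) ^ (((N : ℝ) - 2) / 2) * heaviside (-v) := by
  rw [universalSingularity, if_neg hκ, if_neg hN]

theorem sqrt_pow_eq_rpow {v : ℝ} (hv : 0 ≤ v) (n : ℕ) :
    √v ^ n = v ^ ((((n + 2 : ℕ) : ℝ) - 2) / 2) := by
  rw [Real.sqrt_eq_rpow, ← Real.rpow_natCast, ← Real.rpow_mul hv]
  congr 1
  push_cast
  ring

theorem neg_one_pow_mod_four (c : ℕ) : (-1 : ℝ) ^ ((2 * c) % 4 / 2) = (-1) ^ c := by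
  have : (2 * c) % 4 / 2 = c % 2 := by omega
  rw [this, ← neg_one_pow_eq_pow_mod_two]

theorem neg_one_pow_mul_self (n : ℕ) : (-1 : ℝ) ^ n * (-1) ^ n = 1 := by
  rw [← mul_pow]; norm_num

/-- The singular behaviour of the integral of a double power series along a hyperbola. -/
theorem singular_expansion {C M : ℝ} {d : ℕ → ℕ → ℝ} (hd : GeomBound C M d) (hM : 1 ≤ M)
    (hsym : ∀ i j, d j i = d i j) (hodd : ∀ i j, Odd (i + j) → d i j = 0) (a b : ℕ)
    {R : ℝ} (hR : 0 < R) (hRM : (2 * M) ^ 2 * (2 * R) < 1) :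
    ∃ A B : ℝ → ℝ, AnalyticAt ℝ A 0 ∧ AnalyticAt ℝ B 0 ∧
      B 0 = d 0 0 * eulerBeta (((a : ℝ) + 1) / 2) (((b : ℝ) + 1) / 2) / 4 ∧
      ∀ᶠ E in 𝓝[≠] (0 : ℝ),
        (∫ ξ in √|E|..outerEnd R E, doubleSum (mulST a b d) ξ (E / ξ) / ξ) / 2 =
          A E + B E * universalSingularity (a + b + 2) ((a + 1) % 4) E := by
  have hM0 : 0 < M := by linarith
  set p := mulST a b d with hp
  have hpb : GeomBound C M p := hd.mulST hM a b
  have hC := hpb.nonneg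
  have hreg := analyticAt_regularPart hpb hM0 hR hRM
  have hswap : ∀ i j, p j i = (-1) ^ a * p i j := mulST_swap hsym a b
  have hpar : ∀ i j, Odd (i + j + (a + b)) → p i j = 0 := mulST_eq_zero_of_odd hodd a b
  have hlow : ∀ i j, i + j < a + b → p i j = 0 := mulST_eq_zero_of_lt d a b
  -- L collects the inner end ξ = η = √E for E > 0, and L' the inner end ξ = -η = √(-E) for E < 0.
  -- Only degrees a + b + 2m occur, which is why both are power series in |E| after √|E|^(a+b) is
  -- split off.
  set L : ℕ → ℝ := fun m => antidiagSum (fun m => 1 / (m : ℝ)) (a + b + 2 * m) p with hL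
  set L' : ℕ → ℝ := fun m => antidiagSum (fun m => 1 / (m : ℝ)) (a + b + 2 * m) (twist p) with hL'
  have hbound : ∀ q, GeomBound C M q → ∀ m, |antidiagSum (fun m => 1 / (m : ℝ)) (a + b + 2 * m) q| ≤
      C * (2 * M) ^ (a + b) * ((2 * M) ^ 2) ^ m := by
    intro q hq m
    refine (abs_antidiagSum_le abs_one_div_intCast_le hq hM0.le _).trans (le_of_eq ?_)
    rw [pow_add, pow_mul, mul_assoc]
  have hLan : AnalyticAt ℝ (powSum L) 0 := analyticAt_powSum (hbound p hpb) (by positivity)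
  have hL'an : AnalyticAt ℝ (powSum L') 0 :=
    analyticAt_powSum (hbound _ hpb.twist) (by positivity)
  have hL'an' : AnalyticAt ℝ (fun E => powSum L' (-E)) 0 :=
    AnalyticAt.fun_comp (by simpa using hL'an) analyticAt_id.neg
  have hzero : ∀ q : ℕ → ℕ → ℝ, (∀ i j, p i j = 0 → q i j = 0) →
      ∀ n, n < a + b ∨ Odd (n + (a + b)) → antidiagSum (fun m => 1 / (m : ℝ)) n q = 0 := by
    intro q hq n hn
    refine Finset.sum_eq_zero fun ij hij => ?_
    rw [Finset.HasAntidiagonal.mem_antidiagonal] at hij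
    rw [hq, mul_zero]
    rcases hn with hn | hn
    · exact hlow _ _ (by omega)
    · exact hpar _ _ (by rwa [hij])
  have hMx : ∀ E : ℝ, |E| ≤ R → M * |√(|E|)| < 1 := by
    intro E hE
    rw [abs_of_nonneg (Real.sqrt_nonneg _), ← abs_of_nonneg (show 0 ≤ M * √|E| by positivity),
      ← sq_lt_one_iff_abs_lt_one, mul_pow, Real.sq_sqrt (abs_nonneg _)]
    calc M ^ 2 * |E| ≤ (2 * M) ^ 2 * (2 * R) := by
          gcongr
          · linarith
          · linarith
      _ < 1 := hRM
  have hpos : ∀ E : ℝ, 0 < E → E ≤ R → doubleSum (primCoeff p) (√|E|) (E / √|E|) =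
      √E ^ (a + b) * powSum L E := by
    intro E hE hER
    have hx := hMx E (by rwa [abs_of_pos hE])
    rw [abs_of_pos hE] at hx ⊢
    rw [Real.div_sqrt, doubleSum_primCoeff_diag hpb hM0.le (hzero p fun _ _ h => h) hx,
      Real.sq_sqrt hE.le]
  have hneg : ∀ E : ℝ, E < 0 → -E ≤ R → doubleSum (primCoeff p) (√|E|) (E / √|E|) =
      √(-E) ^ (a + b) * powSum L' (-E) := by
    intro E hE hER
    have hx := hMx E (by rwa [abs_of_neg hE])
    rw [abs_of_neg hE] at hx ⊢
    have h1 : E / √(-E) = -√(-E) := by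
      rw [← neg_neg (E / √(-E)), ← neg_div, Real.div_sqrt]
    rw [h1, doubleSum_primCoeff_neg, doubleSum_primCoeff_diag hpb.twist hM0.le
      (hzero (twist p) fun i j h => by rw [twist, h, mul_zero]) hx, Real.sq_sqrt (by linarith)]
  have hnear : ∀ᶠ E in 𝓝[≠] (0 : ℝ), E ≠ 0 ∧ |E| ≤ R := by
    refine eventually_mem_nhdsWithin.and (eventually_nhdsWithin_of_eventually_nhds ?_)
    filter_upwards [Metric.ball_mem_nhds (0 : ℝ) hR] with E hE
    simpa using (mem_ball_zero_iff.1 hE).le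
  have hlead : ∀ i j, i + j = a + b → p i j = d 0 0 * mulST a b unitCoeff i j :=
    mulST_leading d a b
  -- There is no logarithm when p is antisymmetric (a odd) or contains only odd degrees (a + b odd).
  have hdiag0 : Odd a ∨ Odd (a + b) → ∀ E, powSum (fun j => p j j) E = 0 := by
    intro h E
    have : ∀ j, p j j = 0 := by
      intro j
      rcases h with h | h
      · have := hswap j j
        rw [h.neg_one_pow] at this
        linarith
      · exact hpar _ _ (by rw [Nat.odd_iff] at h ⊢; omega)
    simp [powSum, this]
  have hB0 : powSum L 0 = antidiagSum (fun m => 1 / (m : ℝ)) (a + b) p := by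
    rw [powSum_zero]; rfl
  have hB0' : powSum L' 0 = antidiagSum (fun m => 1 / (m : ℝ)) (a + b) (twist p) := by
    rw [powSum_zero]; rfl
  -- Four cases by the parities of a and b, which are one less than the numbers of negative and
  -- positive squares. L vanishes for a even, where p is symmetric; L' vanishes for b even, where
  -- the twisted coefficients are symmetric.
  rcases Nat.even_or_odd' a with ⟨c, hc | hc⟩
  · have ha : (-1 : ℝ) ^ a = 1 := Even.neg_one_pow ⟨c, by omega⟩
    have hκ : ¬ Even ((a + 1) % 4) := by rw [Nat.even_iff]; omega
    have hL0 : ∀ E, powSum L E = 0 := by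
      intro E
      have : ∀ m, L m = 0 := fun m =>
        antidiagSum_inv_eq_zero fun i j _ => by rw [hswap i j, ha, one_mul]
      simp [powSum, this]
    rcases Nat.even_or_odd' b with ⟨e, he | he⟩
    · -- the logarithmic case
      have hN : Even (a + b + 2) := ⟨c + e + 1, by omega⟩
      have hL'0 : ∀ E, powSum L' E = 0 := by
        intro E
        have : ∀ m, L' m = 0 := fun m =>
          antidiagSum_inv_eq_zero fun i j hij => by
            rw [twist_swap hswap i j, ha, hij, Even.neg_one_pow ⟨c + e + m, by omega⟩]
            ring
        simp [powSum, this]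
      -- Diagonal coefficients below degree a + b = 2(c + e) vanish; shifting by c + e produces the
      -- power of E in front of the logarithm.
      set D : ℕ → ℝ := fun m => p (c + e + m) (c + e + m) with hD
      have hDan : AnalyticAt ℝ (powSum D) 0 := by
        refine analyticAt_powSum (C := C * (M ^ 2) ^ (c + e)) (M := M ^ 2) (fun m => ?_)
          (by positivity)
        refine (hpb.abs_diag_le _).trans (le_of_eq ?_)
        rw [pow_add]; ring
      have hdiag : ∀ E, powSum (fun j => p j j) E = E ^ (c + e) * powSum D E := by
        intro E
        have hinj : Function.Injective fun m : ℕ => c + e + m := fun i j h => by simpa using h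
        rw [powSum, powSum, ← tsum_mul_left, ← hinj.tsum_eq]
        · refine tsum_congr fun m => ?_
          rw [pow_add]; ring
        · intro n hn
          rw [Function.mem_support] at hn
          refine ⟨n - (c + e), ?_⟩
          by_contra hlt
          simp only at hlt
          exact hn (by rw [hlow n n (by omega), zero_mul])
      refine ⟨regularPart p R, fun E => (-1) ^ c * Real.pi * powSum D E / 4, hreg,
        ((analyticAt_const.mul hDan).div_const), ?_, ?_⟩
      · have h1 := antidiagSum_diagonal c e
        have h2 : antidiagSum (fun m => if m = 0 then 1 else 0) (2 * c + 2 * e)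
            (mulST (2 * c) (2 * e) unitCoeff) = mulST (2 * c) (2 * e) unitCoeff (c + e) (c + e) := by
          rw [antidiagSum, Finset.sum_eq_single (c + e, c + e)]
          · simp
          · rintro ⟨i, j⟩ hij hne
            rw [if_neg, zero_mul]
            rw [Finset.HasAntidiagonal.mem_antidiagonal] at hij
            intro h
            apply hne
            simp only at h hij
            ext <;> simp <;> omega
          · intro h
            exact (h (by rw [Finset.HasAntidiagonal.mem_antidiagonal]; simp; omega)).elim
        beta_reduce
        rw [powSum_zero, hD]
        simp only [add_zero]
        rw [hlead _ _ (by omega), hc, he, ← h2, h1]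
        push_cast
        rw [show ((2 : ℝ) * c + 1) / 2 = c + 1 / 2 by ring,
          show ((2 : ℝ) * e + 1) / 2 = e + 1 / 2 by ring]
        have := neg_one_pow_mul_self c
        have hpi := mul_inv_cancel₀ Real.pi_ne_zero
        linear_combination (d 0 0 * eulerBeta (c + 1 / 2) (e + 1 / 2) / 4) *
          ((-1) ^ c * (-1) ^ c * hpi + this)
      · filter_upwards [hnear] with E hE
        have hsing : doubleSum (primCoeff p) (√|E|) (E / √|E|) = 0 := by
          rcases lt_or_gt_of_ne hE.1 with h | h
          · rw [hneg E h (by rw [← abs_of_neg h]; exact hE.2), hL'0, mul_zero]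
          · rw [hpos E h (by rw [← abs_of_pos h]; exact hE.2), hL0, mul_zero]
        rw [hyperbola_integral_eq hpb hM0 hR hRM hE.1 hE.2, hsing, hdiag,
          universalSingularity_log hκ hN, show (a + b + 2 - 2) / 2 = c + e by omega]
        have h1 : (-1 : ℝ) ^ (((a + 1) % 4 + 1) / 2) = -(-1) ^ c := by
          have : ((a + 1) % 4 + 1) / 2 = (c % 2) + 1 := by omega
          rw [this, pow_succ, ← neg_one_pow_eq_pow_mod_two]
          ring
        rw [h1]
        have := neg_one_pow_mul_self c
        have hpi := mul_inv_cancel₀ Real.pi_ne_zero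
        linear_combination (Real.log |E| * E ^ (c + e) * powSum D E / 4) *
          ((-1) ^ c * (-1) ^ c * hpi + this)
    · -- odd dimension, odd index
      have hN : ¬ Even (a + b + 2) := by rw [Nat.even_iff]; omega
      -- Only the inner end for E < 0 survives. Twisting exchanges the exponents a and b, so the
      -- leading constant comes from the odd exponent b.
      refine ⟨regularPart p R, fun E => (-1) ^ e * powSum L' (-E) / 2, hreg,
        (analyticAt_const.mul hL'an').div_const, ?_, ?_⟩
      · have h1 : powSum L' 0 = d 0 0 * antidiagSum (fun m => 1 / (m : ℝ)) (2 * e + 1 + a)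
            (mulST (2 * e + 1) a unitCoeff) := by
          rw [hB0', ← he, ← twist_mulST_unitCoeff, antidiagSum, antidiagSum, Finset.mul_sum,
            add_comm b a]
          refine Finset.sum_congr rfl fun ij hij => ?_
          rw [Finset.HasAntidiagonal.mem_antidiagonal] at hij
          rw [twist, twist, hlead _ _ hij]
          ring
        beta_reduce
        rw [neg_zero, h1, antidiagSum_inv e a ⟨c, by omega⟩, eulerBeta, eulerBeta, he]
        push_cast
        rw [show ((2 : ℝ) * e + 1 + 1) / 2 = e + 1 by ring, add_comm ((e : ℝ) + 1)]
        have := neg_one_pow_mul_self e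
        linear_combination (d 0 0 * (Real.Gamma ((e : ℝ) + 1) * Real.Gamma (((a : ℝ) + 1) / 2) /
          Real.Gamma (((a : ℝ) + 1) / 2 + (e + 1))) / 4) * this
      · filter_upwards [hnear] with E hE
        rw [hyperbola_integral_eq hpb hM0 hR hRM hE.1 hE.2,
          hdiag0 (Or.inr (by rw [Nat.odd_iff]; omega)), universalSingularity_odd hκ hN]
        rcases lt_or_gt_of_ne hE.1 with h | h
        · have h1 : (-1 : ℝ) ^ ((((a + b + 2 : ℕ) : ℤ) - ((a + 1) % 4 : ℕ)) / 2) = -(-1) ^ e := by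
            have : (((a + b + 2 : ℕ) : ℤ) - ((a + 1) % 4 : ℕ)) / 2 =
                2 * (((a : ℤ) + 1) / 4) + ((e + 1 : ℕ) : ℤ) := by omega
            rw [this, zpow_add₀ (by norm_num), zpow_mul, zpow_natCast, pow_succ]
            norm_num
          rw [h1, hneg E h (by rw [← abs_of_neg h]; exact hE.2), heaviside,
            if_pos (by linarith), sqrt_pow_eq_rpow (by linarith)]
          have := neg_one_pow_mul_self e
          linear_combination ((-E) ^ ((((a + b + 2 : ℕ) : ℝ) - 2) / 2) * powSum L' (-E) / 2) * this
        · rw [hpos E h (by rw [← abs_of_pos h]; exact hE.2), hL0, heaviside,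
            if_neg (by linarith)]
          ring
  · have ha : (-1 : ℝ) ^ a = -1 := Odd.neg_one_pow ⟨c, by omega⟩
    have hκ : Even ((a + 1) % 4) := by rw [Nat.even_iff]; omega
    have hsign : (-1 : ℝ) ^ ((a + 1) % 4 / 2) = -(-1) ^ c := by
      rw [show a + 1 = 2 * (c + 1) by omega, neg_one_pow_mod_four, pow_succ]
      ring
    have haOdd : Odd a := ⟨c, by omega⟩
    have hcast : ((a : ℝ) + 1) / 2 = c + 1 := by rw [hc]; push_cast; ring
    rcases Nat.even_or_odd' b with ⟨e, he | he⟩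
    · have hL'0 : ∀ E, powSum L' E = 0 := by
        intro E
        have : ∀ m, L' m = 0 := fun m =>
          antidiagSum_inv_eq_zero fun i j hij => by
            rw [twist_swap hswap i j, ha, hij, Odd.neg_one_pow ⟨c + e + m, by omega⟩]
            ring
        simp [powSum, this]
      refine ⟨regularPart p R, fun E => (-1) ^ c * powSum L E / 2, hreg,
        (analyticAt_const.mul hLan).div_const, ?_, ?_⟩
      · have h1 : powSum L 0 = d 0 0 * antidiagSum (fun m => 1 / (m : ℝ)) (2 * c + 1 + b)
            (mulST (2 * c + 1) b unitCoeff) := by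
          rw [hB0, ← hc, antidiagSum, antidiagSum, Finset.mul_sum]
          refine Finset.sum_congr rfl fun ij hij => ?_
          rw [Finset.HasAntidiagonal.mem_antidiagonal] at hij
          rw [hlead _ _ hij]
          ring
        beta_reduce
        rw [h1, antidiagSum_inv c b ⟨e, by omega⟩, hcast]
        have := neg_one_pow_mul_self c
        linear_combination (d 0 0 * eulerBeta (c + 1) (((b : ℝ) + 1) / 2) / 4) * this
      · filter_upwards [hnear] with E hE
        rw [hyperbola_integral_eq hpb hM0 hR hRM hE.1 hE.2, hdiag0 (Or.inl haOdd),
          universalSingularity_even hκ, hsign]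
        rcases lt_or_gt_of_ne hE.1 with h | h
        · rw [hneg E h (by rw [← abs_of_neg h]; exact hE.2), hL'0, heaviside,
            if_neg (by linarith)]
          ring
        · rw [hpos E h (by rw [← abs_of_pos h]; exact hE.2), heaviside, if_pos h.le,
            sqrt_pow_eq_rpow h.le]
          have := neg_one_pow_mul_self c
          linear_combination (E ^ ((((a + b + 2 : ℕ) : ℝ) - 2) / 2) * powSum L E / 2) * this
    · set h := c + e + 1 with hh
      have hab : a + b = 2 * h := by omega
      -- With N and the index both even, both inner ends contribute, each an analytic function on
      -- its own half-line. The one for E < 0 is continued analytically to E > 0 and put into A; the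
      -- difference that remains for E > 0 is the step singularity.
      refine ⟨fun E => regularPart p R E - (-E) ^ h * powSum L' (-E) / 2,
        fun E => (-1) ^ c * (powSum L E - (-1) ^ h * powSum L' (-E)) / 2,
        hreg.sub ((((analyticAt_id.neg).pow h).mul hL'an').div_const),
        (analyticAt_const.mul (hLan.sub (analyticAt_const.mul hL'an'))).div_const, ?_, ?_⟩
      · have h1 : powSum L 0 - (-1) ^ h * powSum L' 0 = d 0 0 *
            antidiagSum (fun m => (1 - (-1) ^ (m / 2)) / (m : ℝ)) (2 * c + 1 + b)
            (mulST (2 * c + 1) b unitCoeff) := by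
          rw [hB0, hB0', ← hc, antidiagSum, antidiagSum, antidiagSum, Finset.mul_sum,
            Finset.mul_sum, ← Finset.sum_sub_distrib]
          refine Finset.sum_congr rfl fun ij hij => ?_
          rw [Finset.HasAntidiagonal.mem_antidiagonal] at hij
          have h2 : ((ij.1 : ℤ) - ij.2) / 2 = (h : ℤ) - ij.2 := by omega
          have h3 : ((-1 : ℝ) ^ (((ij.1 : ℤ) - ij.2) / 2)) = (-1) ^ h * (-1) ^ ij.2 := by
            rw [h2, zpow_sub₀ (by norm_num), zpow_natCast, zpow_natCast, div_eq_mul_inv, ← inv_pow,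
              inv_neg_one]
          rw [twist, hlead _ _ hij, h3]
          ring
        beta_reduce
        rw [neg_zero, h1, antidiagSum_alternating c b ⟨e, by omega⟩, hcast]
        have := neg_one_pow_mul_self c
        linear_combination (d 0 0 * eulerBeta (c + 1) (((b : ℝ) + 1) / 2) / 4) * this
      · filter_upwards [hnear] with E hE
        rw [hyperbola_integral_eq hpb hM0 hR hRM hE.1 hE.2, hdiag0 (Or.inl haOdd),
          universalSingularity_even hκ, hsign]
        rcases lt_or_gt_of_ne hE.1 with hlt | hgt
        · rw [hneg E hlt (by rw [← abs_of_neg hlt]; exact hE.2), heaviside,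
            if_neg (by linarith), hab, pow_mul, Real.sq_sqrt (by linarith)]
          ring
        · rw [hpos E hgt (by rw [← abs_of_pos hgt]; exact hE.2), heaviside, if_pos hgt.le,
            ← sqrt_pow_eq_rpow hgt.le, hab, pow_mul, Real.sq_sqrt hgt.le, neg_pow E]
          have := neg_one_pow_mul_self c
          linear_combination (E ^ h * (powSum L E - (-1) ^ h * powSum L' (-E)) / 2) * this

/-! ### Polar and hyperbolic coordinates -/

section Polar

open scoped Pointwise

variable {E : Type*} [NormedAddCommGroup E] [NormedSpace ℝ E] [MeasurableSpace E] [BorelSpace E]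
  [FiniteDimensional ℝ E] (μ : Measure E) [μ.IsAddHaarMeasure]

/-- The measure of a subset of the sphere is a multiple of the volume of the cone over it, and
negation carries cones to cones of the same volume. -/
theorem measurePreserving_neg_toSphere :
    MeasurePreserving (fun ω : Metric.sphere (0 : E) 1 => -ω) μ.toSphere μ.toSphere := by
  refine ⟨continuous_neg.measurable, ?_⟩
  ext s hs
  have hs' : MeasurableSet ((fun ω : Metric.sphere (0 : E) 1 => -ω) ⁻¹' s) :=
    continuous_neg.measurable hs
  rw [Measure.map_apply continuous_neg.measurable hs, μ.toSphere_apply' hs', μ.toSphere_apply' hs]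
  congr 1
  have : (Ioo (0 : ℝ) 1 • ((↑) '' ((fun ω : Metric.sphere (0 : E) 1 => -ω) ⁻¹' s) : Set E)) =
      -(Ioo (0 : ℝ) 1 • ((↑) '' s : Set E)) := by
    ext x
    simp only [Set.mem_neg, Set.mem_smul, mem_image, mem_preimage]
    constructor
    · rintro ⟨t, ht, y, ⟨ω, hω, rfl⟩, rfl⟩
      exact ⟨t, ht, _, ⟨-ω, hω, rfl⟩, by simp⟩
    · rintro ⟨t, ht, y, ⟨ω, hω, rfl⟩, hx⟩
      refine ⟨t, ht, _, ⟨-ω, by simpa using hω, rfl⟩, ?_⟩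
      rw [← neg_neg x, ← hx]
      simp
  rw [this, Measure.measure_neg]

theorem lintegral_eq_polar [Nontrivial E] {f : E → ENNReal} (hf : Measurable f) :
    ∫⁻ x, f x ∂μ = ∫⁻ t in Ioi (0 : ℝ), ENNReal.ofReal (t ^ (Module.finrank ℝ E - 1)) *
      ∫⁻ ω : Metric.sphere (0 : E) 1, f (t • (ω : E)) ∂μ.toSphere := by
  have hmeas : Measurable fun z : Metric.sphere (0 : E) 1 × Ioi (0 : ℝ) =>
      f ((z.2 : ℝ) • (z.1 : E)) := by fun_prop
  have h1 : ∫⁻ x, f x ∂μ = ∫⁻ x : ({0}ᶜ : Set E), f x ∂(μ.comap (↑)) := by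
    rw [lintegral_subtype_comap (measurableSet_singleton _).compl, restrict_compl_singleton]
  have h2 : ∫⁻ x : ({0}ᶜ : Set E), f x ∂(μ.comap (↑)) =
      ∫⁻ z : Metric.sphere (0 : E) 1 × Ioi (0 : ℝ), f ((z.2 : ℝ) • (z.1 : E))
        ∂(μ.toSphere.prod (Measure.volumeIoiPow (Module.finrank ℝ E - 1))) := by
    rw [← μ.measurePreserving_homeomorphUnitSphereProd.lintegral_comp hmeas]
    refine lintegral_congr fun x => ?_
    have := (homeomorphUnitSphereProd E).symm_apply_apply x
    conv_lhs => rw [← this]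
    rfl
  rw [h1, h2, lintegral_prod_symm _ hmeas.aemeasurable, Measure.volumeIoiPow,
    lintegral_withDensity_eq_lintegral_mul _ (by fun_prop)
      (Measurable.lintegral_prod_left' hmeas)]
  exact lintegral_subtype_comap measurableSet_Ioi fun t : ℝ =>
    ENNReal.ofReal (t ^ (Module.finrank ℝ E - 1)) *
      ∫⁻ ω : Metric.sphere (0 : E) 1, f (t • (ω : E)) ∂μ.toSphere

end Polar

/-- Change of variable, at fixed ξ = s + t, from t to E = t² - s² = ξ (2t - ξ). -/
theorem lintegral_comp_affine {ξ : ℝ} (hξ : 0 < ξ) (g : ℝ → ENNReal) :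
    ∫⁻ t, g t = ∫⁻ E : ℝ, ENNReal.ofReal (1 / (2 * ξ)) * g ((ξ + E / ξ) / 2) := by
  have himg : (fun E : ℝ => (ξ + E / ξ) / 2) '' univ = univ := by
    rw [image_univ, range_eq_univ]
    intro t
    exact ⟨(2 * t - ξ) * ξ, by field_simp; ring⟩
  have h := lintegral_image_eq_lintegral_abs_deriv_mul (s := univ)
    (f := fun E : ℝ => (ξ + E / ξ) / 2) (f' := fun _ => 1 / (2 * ξ)) MeasurableSet.univ
    (fun x _ => ?_) (fun x _ y _ hxy => ?_) g
  · rw [himg] at h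
    simp only [Measure.restrict_univ] at h
    rw [h, abs_of_pos (by positivity)]
  · have := ((hasDerivAt_id x).div_const ξ |>.const_add ξ |>.div_const 2).hasDerivWithinAt (s := univ)
    rw [show 1 / (2 * ξ) = 1 / ξ / 2 by rw [div_div, mul_comm]]
    exact this
  · field_simp at hxy
    linarith

/-- Integration over a quadrant in the coordinates `ξ = s + t` and `E = t ^ 2 - s ^ 2`. -/
theorem lintegral_quadrant_eq_hyperbolic {H : ℝ × ℝ → ENNReal} (hH : Measurable H) :
    ∫⁻ s in Ioi (0 : ℝ), ∫⁻ t in Ioi (0 : ℝ), H (s, t) =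
      ∫⁻ E : ℝ, ∫⁻ ξ in Ioi (√|E|),
        ENNReal.ofReal (1 / (2 * ξ)) * H ((ξ - E / ξ) / 2, (ξ + E / ξ) / 2) := by
  set K : ℝ × ℝ → ENNReal := (Ioi (0 : ℝ) ×ˢ Ioi (0 : ℝ)).indicator H with hK
  have hKm : Measurable K := hH.indicator (measurableSet_Ioi.prod measurableSet_Ioi)
  have hKapp : ∀ s t, K (s, t) = (Ioi (0 : ℝ)).indicator
      (fun s => (Ioi (0 : ℝ)).indicator (fun t => H (s, t)) t) s := by
    intro s t
    by_cases hs : 0 < s <;> by_cases ht : 0 < t <;> simp [hK, indicator, hs, ht]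
  have h1 : ∫⁻ s in Ioi (0 : ℝ), ∫⁻ t in Ioi (0 : ℝ), H (s, t) = ∫⁻ s, ∫⁻ t, K (s, t) := by
    rw [← lintegral_indicator measurableSet_Ioi]
    refine lintegral_congr fun s => ?_
    by_cases hs : s ∈ Ioi (0 : ℝ)
    · rw [indicator_of_mem hs, ← lintegral_indicator measurableSet_Ioi]
      refine lintegral_congr fun t => ?_
      rw [hKapp, indicator_of_mem hs]
    · rw [indicator_of_notMem hs]
      simp [hKapp, indicator_of_notMem hs]
  -- At fixed t, passing from s to ξ = s + t is a translation.
  have h2 : ∫⁻ s, ∫⁻ t, K (s, t) = ∫⁻ ξ, ∫⁻ t, K (ξ - t, t) := by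
    rw [lintegral_lintegral_swap (by exact hKm.aemeasurable),
      lintegral_lintegral_swap (f := fun ξ t => K (ξ - t, t))
        (by exact (hKm.comp (by fun_prop : Measurable fun z : ℝ × ℝ => (z.1 - z.2, z.2))).aemeasurable)]
    exact lintegral_congr fun t => (lintegral_sub_right_eq_self (fun s => K (s, t)) t).symm
  have h3 : ∫⁻ ξ, ∫⁻ t, K (ξ - t, t) = ∫⁻ ξ in Ioi (0 : ℝ), ∫⁻ E : ℝ,
      ENNReal.ofReal (1 / (2 * ξ)) * K ((ξ - E / ξ) / 2, (ξ + E / ξ) / 2) := by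
    rw [← lintegral_indicator measurableSet_Ioi]
    refine lintegral_congr fun ξ => ?_
    by_cases hξ : ξ ∈ Ioi (0 : ℝ)
    · rw [indicator_of_mem hξ, lintegral_comp_affine hξ]
      refine lintegral_congr fun E => ?_
      congr 3
      ring
    · rw [indicator_of_notMem hξ]
      rw [lintegral_eq_zero_iff' (by fun_prop)]
      refine ae_of_all _ fun t => ?_
      rw [mem_Ioi, not_lt] at hξ
      simp only [hK, Pi.zero_apply]
      refine indicator_of_notMem (fun h => ?_) _
      have h1 : 0 < ξ - t := h.1
      have h2 : 0 < t := h.2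
      linarith
  have hm : Measurable fun z : ℝ × ℝ =>
      ENNReal.ofReal (1 / (2 * z.1)) * K ((z.1 - z.2 / z.1) / 2, (z.1 + z.2 / z.1) / 2) := by
    refine Measurable.mul (by fun_prop) (hKm.comp (by fun_prop))
  rw [h1, h2, h3, lintegral_lintegral_swap (by exact hm.aemeasurable)]
  refine lintegral_congr fun E => ?_
  rw [← lintegral_indicator measurableSet_Ioi, ← lintegral_indicator measurableSet_Ioi]
  refine lintegral_congr fun ξ => ?_
  -- Both radii (ξ ∓ E/ξ)/2 are positive exactly when |E| < ξ².
  by_cases hξ : √|E| < ξ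
  · have hξ0 : 0 < ξ := (Real.sqrt_nonneg _).trans_lt hξ
    have hsq : |E| < ξ ^ 2 := (Real.sqrt_lt' hξ0).1 hξ
    rw [indicator_of_mem (show ξ ∈ Ioi (0 : ℝ) from hξ0),
      indicator_of_mem (show ξ ∈ Ioi (√|E|) from hξ), hK, indicator_of_mem]
    have h1 : |E / ξ| < ξ := by rwa [abs_div, abs_of_pos hξ0, div_lt_iff₀ hξ0, ← sq]
    rw [abs_lt] at h1
    constructor
    · simp only [mem_Ioi]; linarith
    · simp only [mem_Ioi]; linarith
  · rw [indicator_of_notMem (show ξ ∉ Ioi (√|E|) from hξ)]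
    by_cases hξ0 : 0 < ξ
    · rw [indicator_of_mem (show ξ ∈ Ioi (0 : ℝ) from hξ0), hK, indicator_of_notMem, mul_zero]
      rintro ⟨h1, h2⟩
      simp only [mem_Ioi] at h1 h2
      have h3 : |E / ξ| < ξ := abs_lt.2 ⟨by linarith, by linarith⟩
      rw [abs_div, abs_of_pos hξ0, div_lt_iff₀ hξ0, ← sq] at h3
      exact hξ ((Real.sqrt_lt' hξ0).2 h3)
    · rw [indicator_of_notMem (show ξ ∉ Ioi (0 : ℝ) from hξ0)]

/-! ### The density of a quadratic form of mixed signature -/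

/-- The push-forward by `Q` of the measure with density `f` on `D` has near `0` a density that is
nonnegative and, up to an analytic summand, equal to `B * universalSingularity N (k % 4)` with
`B` analytic and `B 0 = c`. -/
def HasSingularPush {X : Type*} [MeasurableSpace X] (μ : Measure X) (D : Set X) (Q f : X → ℝ)
    (N k : ℕ) (c : ℝ) : Prop :=
  ∃ (I A B : ℝ → ℝ) (δ : ℝ), 0 < δ ∧ AnalyticAt ℝ A 0 ∧ AnalyticAt ℝ B 0 ∧ B 0 = c ∧
    (∀ E, E ≠ 0 → |E| < δ → 0 ≤ I E ∧ I E = A E + B E * universalSingularity N (k % 4) E) ∧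
    ∀ S, MeasurableSet S → S ⊆ Ioo (-δ) δ →
      ∫⁻ x in D ∩ Q ⁻¹' S, ENNReal.ofReal (f x) ∂μ = ∫⁻ E in S, ENNReal.ofReal (I E)

/-- Since s² + t² = (ξ⁴ + E²)/(2ξ²), the condition says that ξ² lies between the roots R ± √(R² -
E²) of a quadratic. The smaller root is at most |E| < ξ², so only the larger one matters. -/
theorem mem_region_iff_lt_outerEnd {R E ξ : ℝ} (hR : 0 < R) (hE : |E| < R) (hξ : √|E| < ξ) :
    ((ξ - E / ξ) / 2) ^ 2 + ((ξ + E / ξ) / 2) ^ 2 < R ↔ ξ < outerEnd R E := by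
  have hξ0 : 0 < ξ := (Real.sqrt_nonneg _).trans_lt hξ
  have hsq : |E| < ξ ^ 2 := (Real.sqrt_lt' hξ0).1 hξ
  have hE2 : E ^ 2 = |E| ^ 2 := (sq_abs E).symm
  have hnn : 0 ≤ R ^ 2 - E ^ 2 := by nlinarith [abs_nonneg E]
  set q := √(R ^ 2 - E ^ 2) with hq
  have hq2 : q ^ 2 = R ^ 2 - E ^ 2 := Real.sq_sqrt hnn
  have hq0 : 0 ≤ q := Real.sqrt_nonneg _
  have h1 : ((ξ - E / ξ) / 2) ^ 2 + ((ξ + E / ξ) / 2) ^ 2 = ((ξ ^ 2) ^ 2 + E ^ 2) / (2 * ξ ^ 2) := by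
    field_simp
    ring
  have h2 : ξ < outerEnd R E ↔ ξ ^ 2 < R + q := by
    rw [← outerEnd_sq hR, sq_lt_sq₀ hξ0.le (outerEnd_pos hR E).le]
  rw [h1, h2, div_lt_iff₀ (by positivity)]
  have h3 : R - |E| ≤ q := Real.le_sqrt_of_sq_le (by nlinarith [abs_nonneg E])
  constructor
  · intro h
    by_contra hc
    push Not at hc
    nlinarith
  · intro h
    nlinarith

section Product

variable {E₁ E₂ : Type*} [NormedAddCommGroup E₁] [NormedSpace ℝ E₁]
  [NormedAddCommGroup E₂] [NormedSpace ℝ E₂]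

/-- The direction of `ξ` in the coordinates `ξ = s + t`, `η = t - s` at given angles. -/
noncomputable def dirX (ω : Metric.sphere (0 : E₁) 1 × Metric.sphere (0 : E₂) 1) : E₁ × E₂ :=
  ((1 / 2 : ℝ) • (ω.1 : E₁), (1 / 2 : ℝ) • (ω.2 : E₂))

/-- The direction of `η` in the coordinates `ξ = s + t`, `η = t - s` at given angles. -/
noncomputable def dirY (ω : Metric.sphere (0 : E₁) 1 × Metric.sphere (0 : E₂) 1) : E₁ × E₂ :=
  (-((1 / 2 : ℝ) • (ω.1 : E₁)), (1 / 2 : ℝ) • (ω.2 : E₂))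

theorem norm_dirX_le (ω : Metric.sphere (0 : E₁) 1 × Metric.sphere (0 : E₂) 1) :
    ‖dirX ω‖ ≤ 1 / 2 := by
  simp [dirX, norm_smul, Prod.norm_mk]

theorem norm_dirY_le (ω : Metric.sphere (0 : E₁) 1 × Metric.sphere (0 : E₂) 1) :
    ‖dirY ω‖ ≤ 1 / 2 := by
  simp [dirY, norm_smul, Prod.norm_mk]

theorem continuous_dirX :
    Continuous (dirX : Metric.sphere (0 : E₁) 1 × Metric.sphere (0 : E₂) 1 → E₁ × E₂) := by
  unfold dirX; fun_prop

theorem continuous_dirY :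
    Continuous (dirY : Metric.sphere (0 : E₁) 1 × Metric.sphere (0 : E₂) 1 → E₁ × E₂) := by
  unfold dirY; fun_prop

theorem smul_dirX_add_smul_dirY (ξ η : ℝ)
    (ω : Metric.sphere (0 : E₁) 1 × Metric.sphere (0 : E₂) 1) :
    ξ • dirX ω + η • dirY ω = (((ξ - η) / 2) • (ω.1 : E₁), ((ξ + η) / 2) • (ω.2 : E₂)) := by
  ext
  · simp only [dirX, dirY, Prod.smul_mk, Prod.mk_add_mk]
    module
  · simp only [dirX, dirY, Prod.smul_mk, Prod.mk_add_mk]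
    module

theorem continuous_planeCoeff_dir (p : FormalMultilinearSeries ℝ (E₁ × E₂) ℝ) (n i : ℕ) :
    Continuous fun ω : Metric.sphere (0 : E₁) 1 × Metric.sphere (0 : E₂) 1 =>
      planeCoeff p n i (dirX ω) (dirY ω) :=
  (continuous_planeCoeff p n i).comp (continuous_dirX.prodMk continuous_dirY)

variable [MeasurableSpace E₁] [BorelSpace E₁] [FiniteDimensional ℝ E₁] [MeasurableSpace E₂]
  [BorelSpace E₂] [FiniteDimensional ℝ E₂]

variable (μ₁ : Measure E₁) [μ₁.IsAddHaarMeasure] (μ₂ : Measure E₂) [μ₂.IsAddHaarMeasure]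

/-- The coefficients of the spherical integral of a power series. -/
noncomputable def sphereCoeff (p : FormalMultilinearSeries ℝ (E₁ × E₂) ℝ) (i j : ℕ) : ℝ :=
  ∫ ω, planeCoeff p (i + j) i (dirX ω) (dirY ω) ∂(μ₁.toSphere.prod μ₂.toSphere)

theorem integrable_of_continuous_sphere
    {g : Metric.sphere (0 : E₁) 1 × Metric.sphere (0 : E₂) 1 → ℝ} (hg : Continuous g) :
    Integrable g (μ₁.toSphere.prod μ₂.toSphere) := by
  have := FiniteDimensional.proper_real E₁
  have := FiniteDimensional.proper_real E₂
  exact integrableOn_univ.1 (hg.continuousOn.integrableOn_compact isCompact_univ)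

theorem geomBound_sphereCoeff {p : FormalMultilinearSeries ℝ (E₁ × E₂) ℝ} {C M : ℝ}
    (hp : ∀ n, ‖p n‖ ≤ C * M ^ n) :
    GeomBound (C * (μ₁.toSphere.prod μ₂.toSphere).real univ) M (sphereCoeff μ₁ μ₂ p) := by
  intro i j
  have h := norm_integral_le_of_norm_le_const (μ := μ₁.toSphere.prod μ₂.toSphere)
    (f := fun ω => planeCoeff p (i + j) i (dirX ω) (dirY ω)) (C := C * M ^ (i + j))
    (ae_of_all _ fun ω => ?_)
  · rw [mul_right_comm]
    exact h
  exact (abs_planeCoeff_le p _ _ (norm_dirX_le ω) (norm_dirY_le ω)).trans (hp _)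

/-- The antipodal map on the first sphere exchanges the directions of ξ and η; equivalently, the
spherical integral is even in s. -/
theorem sphereCoeff_swap (p : FormalMultilinearSeries ℝ (E₁ × E₂) ℝ) (i j : ℕ) :
    sphereCoeff μ₁ μ₂ p j i = sphereCoeff μ₁ μ₂ p i j := by
  let T : Metric.sphere (0 : E₁) 1 × Metric.sphere (0 : E₂) 1 ≃ₜ
    Metric.sphere (0 : E₁) 1 × Metric.sphere (0 : E₂) 1 :=
    (Homeomorph.neg _).prodCongr (Homeomorph.refl _)
  have hT : MeasurePreserving T (μ₁.toSphere.prod μ₂.toSphere) (μ₁.toSphere.prod μ₂.toSphere) :=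
    (measurePreserving_neg_toSphere μ₁).prod (MeasurePreserving.id _)
  rw [sphereCoeff, sphereCoeff, ← hT.integral_comp T.measurableEmbedding]
  refine integral_congr_ae (ae_of_all _ fun ω => ?_)
  have h1 : dirX (T ω) = dirY ω := by simp [T, dirX, dirY]
  have h2 : dirY (T ω) = dirX ω := by simp [T, dirX, dirY]
  simp only
  rw [h1, h2, planeCoeff_swap, add_comm]

/-- The antipodal map on both spheres negates both directions. -/
theorem sphereCoeff_eq_zero (p : FormalMultilinearSeries ℝ (E₁ × E₂) ℝ) (i j : ℕ)
    (hij : Odd (i + j)) : sphereCoeff μ₁ μ₂ p i j = 0 := by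
  let T : Metric.sphere (0 : E₁) 1 × Metric.sphere (0 : E₂) 1 ≃ₜ
    Metric.sphere (0 : E₁) 1 × Metric.sphere (0 : E₂) 1 :=
    (Homeomorph.neg _).prodCongr (Homeomorph.neg _)
  have hT : MeasurePreserving T (μ₁.toSphere.prod μ₂.toSphere) (μ₁.toSphere.prod μ₂.toSphere) :=
    (measurePreserving_neg_toSphere μ₁).prod (measurePreserving_neg_toSphere μ₂)
  have h : sphereCoeff μ₁ μ₂ p i j = -sphereCoeff μ₁ μ₂ p i j := by
    conv_lhs => rw [sphereCoeff, ← hT.integral_comp T.measurableEmbedding]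
    rw [sphereCoeff, ← integral_neg]
    refine integral_congr_ae (ae_of_all _ fun ω => ?_)
    have h1 : dirX (T ω) = -dirX ω := by simp [T, dirX]
    have h2 : dirY (T ω) = -dirY ω := by simp [T, dirY]
    simp only
    rw [h1, h2, planeCoeff_neg, hij.neg_one_pow, neg_one_mul]
  linarith

theorem sphereCoeff_zero {f : E₁ × E₂ → ℝ} {p : FormalMultilinearSeries ℝ (E₁ × E₂) ℝ}
    {ρ : ENNReal} (hf : HasFPowerSeriesOnBall f p 0 ρ) :
    sphereCoeff μ₁ μ₂ p 0 0 = f 0 * (μ₁.toSphere.real univ * μ₂.toSphere.real univ) := by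
  have : ∀ ω : Metric.sphere (0 : E₁) 1 × Metric.sphere (0 : E₂) 1,
      planeCoeff p (0 + 0) 0 (dirX ω) (dirY ω) = f 0 := by
    intro ω
    simp only [planeCoeff, Finset.powersetCard_zero, Finset.sum_singleton]
    exact hf.coeff_zero _
  rw [sphereCoeff, integral_congr_ae (ae_of_all _ this), integral_const, smul_eq_mul, mul_comm]
  congr 1
  rw [← univ_prod_univ, measureReal_prod_prod]

theorem integral_sphere_eq_doubleSum {f : E₁ × E₂ → ℝ}
    {p : FormalMultilinearSeries ℝ (E₁ × E₂) ℝ}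
    {ρ : ENNReal} (hf : HasFPowerSeriesOnBall f p 0 ρ) {C M : ℝ} (hM : 0 ≤ M)
    (hp : ∀ n, ‖p n‖ ≤ C * M ^ n) {ξ η : ℝ} (hξ : M * |ξ| < 1) (hη : M * |η| < 1)
    (hmem : ∀ ω : Metric.sphere (0 : E₁) 1 × Metric.sphere (0 : E₂) 1,
      ξ • dirX ω + η • dirY ω ∈ Metric.eball (0 : E₁ × E₂) ρ) :
    ∫ ω, f (ξ • dirX ω + η • dirY ω) ∂(μ₁.toSphere.prod μ₂.toSphere) =
      doubleSum (sphereCoeff μ₁ μ₂ p) ξ η := by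
  set σ := μ₁.toSphere.prod μ₂.toSphere with hσ
  have hint : ∀ ij : ℕ × ℕ, Integrable (fun ω =>
      planeCoeff p (ij.1 + ij.2) ij.1 (dirX ω) (dirY ω) * ξ ^ ij.1 * η ^ ij.2) σ := fun ij =>
    ((integrable_of_continuous_sphere μ₁ μ₂ (continuous_planeCoeff_dir p _ _)).mul_const _).mul_const _
  have hgb : ∀ ω : Metric.sphere (0 : E₁) 1 × Metric.sphere (0 : E₂) 1,
      GeomBound C M fun i j => planeCoeff p (i + j) i (dirX ω) (dirY ω) := fun ω i j =>
    (abs_planeCoeff_le p _ _ (norm_dirX_le ω) (norm_dirY_le ω)).trans (hp _)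
  have hsum : Summable fun ij : ℕ × ℕ => ∫ ω, ‖planeCoeff p (ij.1 + ij.2) ij.1 (dirX ω) (dirY ω) *
      ξ ^ ij.1 * η ^ ij.2‖ ∂σ := by
    refine Summable.of_nonneg_of_le (fun _ => integral_nonneg fun _ => norm_nonneg _) (fun ij => ?_)
      (((summable_geometric_prod (a := M * |ξ|) (b := M * |η|) (by positivity) hξ (by positivity)
        hη).mul_left C).mul_left (σ.real univ))
    calc _ ≤ ∫ _, C * ((M * |ξ|) ^ ij.1 * (M * |η|) ^ ij.2) ∂σ :=
          integral_mono (hint ij).norm (integrable_const _) fun ω => (hgb ω).norm_term_le ξ η ij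
      _ = _ := by rw [integral_const, smul_eq_mul]
  have h := hasSum_integral_of_summable_integral_norm hint hsum
  have h1 : ∀ ω, ∑' ij : ℕ × ℕ, planeCoeff p (ij.1 + ij.2) ij.1 (dirX ω) (dirY ω) *
      ξ ^ ij.1 * η ^ ij.2 = f (ξ • dirX ω + η • dirY ω) := fun ω =>
    (hasSum_planeCoeff hf hM hp (norm_dirX_le ω) (norm_dirY_le ω) hξ hη (hmem ω)).tsum_eq
  simp only [h1, integral_mul_const] at h
  exact h.tsum_eq.symm

end Product

section Product

variable {E₁ E₂ : Type*} [NormedAddCommGroup E₁] [NormedSpace ℝ E₁] [NormedAddCommGroup E₂]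
  [NormedSpace ℝ E₂] [MeasurableSpace E₁] [BorelSpace E₁] [FiniteDimensional ℝ E₁]
  [MeasurableSpace E₂] [BorelSpace E₂] [FiniteDimensional ℝ E₂]
  (μ₁ : Measure E₁) [μ₁.IsAddHaarMeasure] (μ₂ : Measure E₂) [μ₂.IsAddHaarMeasure]

theorem lintegral_prod_eq_hyperbolic [Nontrivial E₁] [Nontrivial E₂] {F : E₁ × E₂ → ENNReal}
    (hF : Measurable F) :
    ∫⁻ z, F z ∂(μ₁.prod μ₂) = ∫⁻ E : ℝ, ∫⁻ ξ in Ioi (√|E|), ENNReal.ofReal (1 / (2 * ξ)) *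
      (ENNReal.ofReal (((ξ - E / ξ) / 2) ^ (Module.finrank ℝ E₁ - 1)) *
        (ENNReal.ofReal (((ξ + E / ξ) / 2) ^ (Module.finrank ℝ E₂ - 1)) *
          ∫⁻ ω, F (ξ • dirX ω + (E / ξ) • dirY ω) ∂(μ₁.toSphere.prod μ₂.toSphere))) := by
  have hFm : Measurable fun z : (ℝ × ℝ) × (Metric.sphere (0 : E₁) 1 × Metric.sphere (0 : E₂) 1) =>
      F (z.1.1 • (z.2.1 : E₁), z.1.2 • (z.2.2 : E₂)) := hF.comp (by fun_prop)
  have hH : Measurable fun z : ℝ × ℝ => ENNReal.ofReal (z.1 ^ (Module.finrank ℝ E₁ - 1)) *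
      (ENNReal.ofReal (z.2 ^ (Module.finrank ℝ E₂ - 1)) *
        ∫⁻ ω : Metric.sphere (0 : E₁) 1 × Metric.sphere (0 : E₂) 1,
          F (z.1 • (ω.1 : E₁), z.2 • (ω.2 : E₂)) ∂(μ₁.toSphere.prod μ₂.toSphere)) := by
    refine Measurable.mul (by fun_prop) (Measurable.mul (by fun_prop) ?_)
    exact hFm.lintegral_prod_right'
  have h1 : ∫⁻ z, F z ∂(μ₁.prod μ₂) = ∫⁻ s in Ioi (0 : ℝ), ∫⁻ t in Ioi (0 : ℝ),
      ENNReal.ofReal (s ^ (Module.finrank ℝ E₁ - 1)) *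
      (ENNReal.ofReal (t ^ (Module.finrank ℝ E₂ - 1)) *
        ∫⁻ ω : Metric.sphere (0 : E₁) 1 × Metric.sphere (0 : E₂) 1,
          F (s • (ω.1 : E₁), t • (ω.2 : E₂)) ∂(μ₁.toSphere.prod μ₂.toSphere)) := by
    rw [lintegral_prod _ hF.aemeasurable,
      lintegral_eq_polar μ₁ (Measurable.lintegral_prod_right' hF)]
    refine lintegral_congr fun s => ?_
    have hm : Measurable fun z : Metric.sphere (0 : E₁) 1 × (ℝ × Metric.sphere (0 : E₂) 1) =>
        F (s • (z.1 : E₁), z.2.1 • (z.2.2 : E₂)) := hF.comp (by fun_prop)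
    have h2 : ∀ ω₁ : Metric.sphere (0 : E₁) 1, ∫⁻ y, F (s • (ω₁ : E₁), y) ∂μ₂ =
        ∫⁻ t in Ioi (0 : ℝ), ENNReal.ofReal (t ^ (Module.finrank ℝ E₂ - 1)) *
          ∫⁻ ω₂ : Metric.sphere (0 : E₂) 1, F (s • (ω₁ : E₁), t • (ω₂ : E₂)) ∂μ₂.toSphere :=
      fun ω₁ => lintegral_eq_polar μ₂ (hF.comp measurable_prodMk_left)
    simp only [h2]
    have hm2 : Measurable fun z : Metric.sphere (0 : E₁) 1 × ℝ =>
        ∫⁻ ω₂ : Metric.sphere (0 : E₂) 1, F (s • (z.1 : E₁), z.2 • (ω₂ : E₂)) ∂μ₂.toSphere := by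
      refine Measurable.lintegral_prod_right'
        (f := fun z : (Metric.sphere (0 : E₁) 1 × ℝ) × Metric.sphere (0 : E₂) 1 =>
          F (s • (z.1.1 : E₁), z.1.2 • (z.2 : E₂))) ?_
      exact hF.comp (by fun_prop)
    rw [lintegral_lintegral_swap]
    · rw [← lintegral_const_mul]
      · refine lintegral_congr fun t => ?_
        congr 1
        have hm3 : Measurable fun ω₁ : Metric.sphere (0 : E₁) 1 =>
            ∫⁻ ω₂ : Metric.sphere (0 : E₂) 1, F (s • (ω₁ : E₁), t • (ω₂ : E₂)) ∂μ₂.toSphere :=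
          hm2.comp measurable_prodMk_right
        rw [lintegral_const_mul _ hm3]
        congr 1
        rw [lintegral_prod]
        exact (hF.comp (by fun_prop)).aemeasurable
      · refine Measurable.lintegral_prod_left'
          (f := fun z : Metric.sphere (0 : E₁) 1 × ℝ =>
            ENNReal.ofReal (z.2 ^ (Module.finrank ℝ E₂ - 1)) *
            ∫⁻ ω₂ : Metric.sphere (0 : E₂) 1, F (s • (z.1 : E₁), z.2 • (ω₂ : E₂)) ∂μ₂.toSphere) ?_
        exact Measurable.mul (by fun_prop) hm2
    · exact (Measurable.mul (by fun_prop) hm2).aemeasurable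
  rw [h1, lintegral_quadrant_eq_hyperbolic hH]
  simp only [smul_dirX_add_smul_dirY]

/-- The indefinite case. In hyperbolic coordinates the weight s^(k-1) t^(l-1) times the spherical
integral of f is the double series `mulST` of `sphereCoeff`, so the density is the integral treated
in `singular_expansion`. -/
theorem hasSingularPush_prod [Nontrivial E₁] [Nontrivial E₂] {f : E₁ × E₂ → ℝ}
    (hfm : Measurable f) (hfa : AnalyticAt ℝ f 0) (hf0 : 0 < f 0) :
    ∃ r₀ > 0, ∀ r, 0 < r → r < r₀ →
      HasSingularPush (μ₁.prod μ₂) {z : E₁ × E₂ | ‖z.1‖ ^ 2 + ‖z.2‖ ^ 2 < r ^ 2}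
        (fun z => ‖z.2‖ ^ 2 - ‖z.1‖ ^ 2) f (Module.finrank ℝ E₁ + Module.finrank ℝ E₂)
        (Module.finrank ℝ E₁)
        (f 0 * (μ₁.toSphere.real univ * μ₂.toSphere.real univ) *
          eulerBeta ((Module.finrank ℝ E₁ : ℝ) / 2) ((Module.finrank ℝ E₂ : ℝ) / 2) / 4) := by
  obtain ⟨p, ρ, hp⟩ := hfa
  obtain ⟨C, M₀, hC, hM₀, hpb₀⟩ := p.le_mul_pow_of_radius_pos hp.radius_pos
  obtain ⟨M, hM1, hMM⟩ : ∃ M : ℝ, 1 ≤ M ∧ M₀ ≤ M := ⟨max M₀ 1, le_max_right _ _, le_max_left _ _⟩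
  have hM0 : 0 < M := by linarith
  have hpb : ∀ n, ‖p n‖ ≤ C * M ^ n := fun n => (hpb₀ n).trans (by gcongr)
  obtain ⟨ε, hε, hεball⟩ : ∃ ε > 0, ∀ z ∈ Metric.ball (0 : E₁ × E₂) ε,
      z ∈ Metric.eball (0 : E₁ × E₂) ρ ∧ 0 < f z := by
    have h1 : ∀ᶠ z in 𝓝 (0 : E₁ × E₂), z ∈ Metric.eball (0 : E₁ × E₂) ρ ∧ 0 < f z :=
      Filter.Eventually.and (Metric.eball_mem_nhds _ hp.r_pos)
        (hp.analyticAt.continuousAt.eventually (lt_mem_nhds hf0))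
    exact Metric.eventually_nhds_iff_ball.1 h1
  -- The bound 1/(3M) gives (2M)² · 2r² = 8 M² r² < (3 M r)² < 1, the condition for convergence up
  -- to the outer end.
  refine ⟨min ε (1 / (3 * M)), by positivity, fun r hr hr0 => ?_⟩
  have hrε : r < ε := hr0.trans_le (min_le_left _ _)
  have hrM : 3 * M * r < 1 := by
    have := hr0.trans_le (min_le_right _ _)
    rwa [lt_div_iff₀ (by positivity), mul_comm] at this
  set R := r ^ 2 with hRdef
  have hR : 0 < R := by positivity
  have hRM : (2 * M) ^ 2 * (2 * R) < 1 := by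
    have : (3 * M * r) ^ 2 < 1 := by
      rw [sq_lt_one_iff_abs_lt_one, abs_of_pos (by positivity)]
      exact hrM
    have h2 : 0 < (M * r) ^ 2 := by positivity
    rw [hRdef]
    nlinarith
  have hk : 0 < Module.finrank ℝ E₁ := Module.finrank_pos
  have hl : 0 < Module.finrank ℝ E₂ := Module.finrank_pos
  set a := Module.finrank ℝ E₁ - 1 with ha
  set b := Module.finrank ℝ E₂ - 1 with hb
  set d := sphereCoeff μ₁ μ₂ p with hd
  have hgb := geomBound_sphereCoeff μ₁ μ₂ hpb
  obtain ⟨A, B, hA, hB, hB0, hAB⟩ := singular_expansion hgb hM1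
    (fun i j => sphereCoeff_swap μ₁ μ₂ p i j) (sphereCoeff_eq_zero μ₁ μ₂ p) a b hR hRM
  rw [eventually_nhdsWithin_iff, Metric.eventually_nhds_iff] at hAB
  obtain ⟨δ₀, hδ₀, hAB⟩ := hAB
  set P := mulST a b d with hP
  have hPb := hgb.mulST hM1 a b
  set I : ℝ → ℝ := fun E => (∫ ξ in √|E|..outerEnd R E, doubleSum P ξ (E / ξ) / ξ) / 2 with hI
  -- the integrand along the hyperbola
  have hgeom : ∀ E ξ, |E| < R → √|E| < ξ → ξ < outerEnd R E →
      (∀ ω : Metric.sphere (0 : E₁) 1 × Metric.sphere (0 : E₂) 1,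
        ξ • dirX ω + (E / ξ) • dirY ω ∈ Metric.ball (0 : E₁ × E₂) ε) ∧
      0 < (ξ - E / ξ) / 2 ∧ 0 < (ξ + E / ξ) / 2 := by
    intro E ξ hE h1 h2
    have hξ0 : 0 < ξ := (Real.sqrt_nonneg _).trans_lt h1
    have h3 : |E / ξ| < ξ := by
      rw [abs_div, abs_of_pos hξ0, div_lt_iff₀ hξ0, ← sq]
      exact (Real.sqrt_lt' hξ0).1 h1
    rw [abs_lt] at h3
    have h4 := (mem_region_iff_lt_outerEnd hR hE h1).2 h2
    have hs : 0 < (ξ - E / ξ) / 2 := by linarith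
    have ht : 0 < (ξ + E / ξ) / 2 := by linarith
    refine ⟨fun ω => ?_, hs, ht⟩
    rw [smul_dirX_add_smul_dirY, mem_ball_zero_iff, Prod.norm_mk, norm_smul, norm_smul,
      norm_eq_of_mem_sphere, norm_eq_of_mem_sphere, mul_one, mul_one, Real.norm_of_nonneg hs.le,
      Real.norm_of_nonneg ht.le]
    refine max_lt ((lt_of_pow_lt_pow_left₀ 2 hr.le ?_).trans hrε)
      ((lt_of_pow_lt_pow_left₀ 2 hr.le ?_).trans hrε)
    · rw [← hRdef]; nlinarith
    · rw [← hRdef]; nlinarith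
  have hsmall : ∀ E ξ, √|E| ≤ ξ → 0 < ξ → ξ ≤ outerEnd R E →
      2 * M * |ξ| < 1 ∧ 2 * M * |E / ξ| < 1 := by
    intro E ξ h1 hξ0 h2
    have h3 : |E / ξ| ≤ ξ := by
      rw [abs_div, abs_of_pos hξ0, div_le_iff₀ hξ0, ← sq]
      exact (Real.sqrt_le_left hξ0.le).1 h1
    have h4 : 2 * M * ξ < 1 := by
      have h5 : ξ ^ 2 ≤ 2 * R := (pow_le_pow_left₀ hξ0.le h2 2).trans (outerEnd_sq_le hR E)
      rw [← abs_of_pos (show 0 < 2 * M * ξ by positivity), ← sq_lt_one_iff_abs_lt_one, mul_pow]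
      calc _ ≤ (2 * M) ^ 2 * (2 * R) := by gcongr
        _ < 1 := hRM
    exact ⟨by rwa [abs_of_pos hξ0], lt_of_le_of_lt (by gcongr) h4⟩
  have hval : ∀ E ξ, |E| < R → √|E| < ξ → ξ < outerEnd R E →
      doubleSum P ξ (E / ξ) = ((ξ - E / ξ) / 2) ^ a * ((ξ + E / ξ) / 2) ^ b *
        ∫ ω, f (ξ • dirX ω + (E / ξ) • dirY ω) ∂(μ₁.toSphere.prod μ₂.toSphere) := by
    intro E ξ hE h1 h2
    have hξ0 : 0 < ξ := (Real.sqrt_nonneg _).trans_lt h1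
    obtain ⟨h3, h4⟩ := hsmall E ξ h1.le hξ0 h2.le
    have h3' : M * |ξ| < 1 := by nlinarith [abs_nonneg ξ]
    have h4' : M * |E / ξ| < 1 := by nlinarith [abs_nonneg (E / ξ)]
    rw [integral_sphere_eq_doubleSum μ₁ μ₂ hp hM0.le hpb h3' h4'
      fun ω => (hεball _ ((hgeom E ξ hE h1 h2).1 ω)).1]
    exact (hasSum_mulST (hgb.hasSum hM0.le h3' h4') a b).tsum_eq
  have hpos : ∀ E ξ, |E| < R → √|E| < ξ → ξ < outerEnd R E → 0 ≤ doubleSum P ξ (E / ξ) / ξ := by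
    intro E ξ hE h1 h2
    have hξ0 : 0 < ξ := (Real.sqrt_nonneg _).trans_lt h1
    obtain ⟨h3, h4, h5⟩ := hgeom E ξ hE h1 h2
    rw [hval E ξ hE h1 h2]
    have : 0 ≤ ∫ ω, f (ξ • dirX ω + (E / ξ) • dirY ω) ∂(μ₁.toSphere.prod μ₂.toSphere) :=
      integral_nonneg fun ω => (hεball _ (h3 ω)).2.le
    positivity
  have hlint : ∀ E ξ, |E| < R → √|E| < ξ → ξ < outerEnd R E →
      ENNReal.ofReal (1 / (2 * ξ)) * (ENNReal.ofReal (((ξ - E / ξ) / 2) ^ a) *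
        (ENNReal.ofReal (((ξ + E / ξ) / 2) ^ b) *
          ∫⁻ ω, ENNReal.ofReal (f (ξ • dirX ω + (E / ξ) • dirY ω))
            ∂(μ₁.toSphere.prod μ₂.toSphere))) =
        ENNReal.ofReal (doubleSum P ξ (E / ξ) / ξ / 2) := by
    intro E ξ hE h1 h2
    have hξ0 : 0 < ξ := (Real.sqrt_nonneg _).trans_lt h1
    obtain ⟨h3, h4, h5⟩ := hgeom E ξ hE h1 h2
    have hcont : Continuous fun ω : Metric.sphere (0 : E₁) 1 × Metric.sphere (0 : E₂) 1 =>
        f (ξ • dirX ω + (E / ξ) • dirY ω) := by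
      have hc : Continuous fun ω : Metric.sphere (0 : E₁) 1 × Metric.sphere (0 : E₂) 1 =>
          ξ • dirX ω + (E / ξ) • dirY ω :=
        (continuous_dirX.const_smul ξ).add (continuous_dirY.const_smul (E / ξ))
      exact hp.continuousOn.comp_continuous hc fun ω => (hεball _ (h3 ω)).1
    rw [← ofReal_integral_eq_lintegral_ofReal (integrable_of_continuous_sphere μ₁ μ₂ hcont)
      (ae_of_all _ fun ω => (hεball _ (h3 ω)).2.le), ← ENNReal.ofReal_mul (by positivity),
      ← ENNReal.ofReal_mul (by positivity), ← ENNReal.ofReal_mul (by positivity),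
      hval E ξ hE h1 h2]
    congr 1
    field_simp
  have hIval : ∀ E, E ≠ 0 → |E| < R → 0 ≤ I E ∧ ∫⁻ ξ in Ioo (√|E|) (outerEnd R E),
      ENNReal.ofReal (doubleSum P ξ (E / ξ) / ξ / 2) = ENNReal.ofReal (I E) := by
    intro E hE0 hE
    have hE0' : 0 < √|E| := Real.sqrt_pos.2 (abs_pos.2 hE0)
    have hcont : ContinuousOn (fun ξ => doubleSum P ξ (E / ξ) / ξ / 2)
        (Icc (√|E|) (outerEnd R E)) := by
      intro ξ hξ
      have hξ0 : 0 < ξ := hE0'.trans_le hξ.1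
      obtain ⟨h3, h4⟩ := hsmall E ξ hξ.1 hξ0 hξ.2
      have h5 : 2 * M * ‖(ξ, E / ξ)‖ < 1 := by
        rw [Prod.norm_mk]
        rcases max_choice ‖ξ‖ ‖E / ξ‖ with h | h <;> rw [h]
        · exact h3
        · exact h4
      have h6 : ContinuousAt (fun ξ => doubleSum P ξ (E / ξ)) ξ :=
        ContinuousAt.comp (f := fun ξ => (ξ, E / ξ)) (g := fun z : ℝ × ℝ => doubleSum P z.1 z.2)
          (hPb.analyticAt_doubleSum hM0 h5).continuousAt
          (continuousAt_id.prodMk (continuousAt_const.div continuousAt_id hξ0.ne'))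
      exact ((h6.div continuousAt_id hξ0.ne').div_const 2).continuousWithinAt
    have hIE : I E = ∫ ξ in Ioo (√|E|) (outerEnd R E), doubleSum P ξ (E / ξ) / ξ / 2 := by
      rw [hI]
      simp only
      rw [intervalIntegral.integral_of_le (sqrt_abs_le_outerEnd hE.le), integral_Ioc_eq_integral_Ioo,
        integral_div]
    have hnn : ∀ ξ ∈ Ioo (√|E|) (outerEnd R E), 0 ≤ doubleSum P ξ (E / ξ) / ξ / 2 := fun ξ hξ =>
      div_nonneg (hpos E ξ hE hξ.1 hξ.2) zero_le_two
    rw [hIE]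
    refine ⟨setIntegral_nonneg measurableSet_Ioo hnn, ?_⟩
    rw [ofReal_integral_eq_lintegral_ofReal]
    · exact (hcont.integrableOn_Icc).mono_set Ioo_subset_Icc_self
    · exact (ae_restrict_iff' measurableSet_Ioo).2 (ae_of_all _ hnn)
  refine ⟨I, A, B, min δ₀ R, by positivity, hA, hB, ?_, ?_, ?_⟩
  · rw [hB0, sphereCoeff_zero μ₁ μ₂ hp, ha, hb, Nat.cast_pred hk, Nat.cast_pred hl,
      sub_add_cancel, sub_add_cancel]
  · intro E hE0 hE
    have hER : |E| < R := hE.trans_le (min_le_right _ _)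
    constructor
    · exact (hIval E hE0 hER).1
    · have := hAB (y := E) (by simpa using hE.trans_le (min_le_left _ _)) hE0
      rw [show Module.finrank ℝ E₁ + Module.finrank ℝ E₂ = a + b + 2 by omega,
        show Module.finrank ℝ E₁ = a + 1 by omega]
      exact this
  · intro S hS hSδ
    have hDm : MeasurableSet ({z : E₁ × E₂ | ‖z.1‖ ^ 2 + ‖z.2‖ ^ 2 < R} ∩
        (fun z : E₁ × E₂ => ‖z.2‖ ^ 2 - ‖z.1‖ ^ 2) ⁻¹' S) := by
      refine (measurableSet_lt (by fun_prop) measurable_const).inter ?_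
      exact (by fun_prop : Measurable fun z : E₁ × E₂ => ‖z.2‖ ^ 2 - ‖z.1‖ ^ 2) hS
    rw [← lintegral_indicator hDm, lintegral_prod_eq_hyperbolic μ₁ μ₂
      (hfm.ennreal_ofReal.indicator hDm), ← lintegral_indicator hS]
    have hae : ∀ᵐ E : ℝ, E ≠ 0 := by
      simp [ae_iff]
    refine lintegral_congr_ae (hae.mono fun E hE0 => ?_)
    simp only
    have hE0' : 0 < √|E| := Real.sqrt_pos.2 (abs_pos.2 hE0)
    have hcoord : ∀ ξ, √|E| < ξ → ∀ ω : Metric.sphere (0 : E₁) 1 × Metric.sphere (0 : E₂) 1,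
        ‖(ξ • dirX ω + (E / ξ) • dirY ω).1‖ ^ 2 = ((ξ - E / ξ) / 2) ^ 2 ∧
        ‖(ξ • dirX ω + (E / ξ) • dirY ω).2‖ ^ 2 = ((ξ + E / ξ) / 2) ^ 2 := by
      intro ξ _ ω
      rw [smul_dirX_add_smul_dirY]
      simp [norm_smul, div_pow]
    have hQ : ∀ ξ, √|E| < ξ → ((ξ + E / ξ) / 2) ^ 2 - ((ξ - E / ξ) / 2) ^ 2 = E := by
      intro ξ hξ
      have : ξ ≠ 0 := (hE0'.trans hξ).ne'
      field_simp
      ring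
    by_cases hES : E ∈ S
    · rw [indicator_of_mem hES]
      have hER : |E| < R := by
        have := hSδ hES
        exact (abs_lt.2 this).trans_le (min_le_right _ _)
      have h1 : ∀ ξ ∈ Ioi (√|E|), ENNReal.ofReal (1 / (2 * ξ)) *
          (ENNReal.ofReal (((ξ - E / ξ) / 2) ^ a) * (ENNReal.ofReal (((ξ + E / ξ) / 2) ^ b) *
          ∫⁻ ω, ({z : E₁ × E₂ | ‖z.1‖ ^ 2 + ‖z.2‖ ^ 2 < R} ∩
            (fun z : E₁ × E₂ => ‖z.2‖ ^ 2 - ‖z.1‖ ^ 2) ⁻¹' S).indicator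
            (fun z => ENNReal.ofReal (f z)) (ξ • dirX ω + (E / ξ) • dirY ω)
            ∂(μ₁.toSphere.prod μ₂.toSphere))) =
          (Iio (outerEnd R E)).indicator
            (fun ξ => ENNReal.ofReal (doubleSum P ξ (E / ξ) / ξ / 2)) ξ := by
        intro ξ hξ
        by_cases hX : ξ < outerEnd R E
        · rw [indicator_of_mem (show ξ ∈ Iio (outerEnd R E) from hX), ← hlint E ξ hER hξ hX]
          congr 3
          refine lintegral_congr fun ω => ?_
          rw [indicator_of_mem]
          constructor
          · rw [mem_ofPred_eq, (hcoord ξ hξ ω).1, (hcoord ξ hξ ω).2]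
            exact (mem_region_iff_lt_outerEnd hR hER hξ).2 hX
          · rw [mem_preimage, (hcoord ξ hξ ω).1, (hcoord ξ hξ ω).2, hQ ξ hξ]
            exact hES
        · rw [indicator_of_notMem (show ξ ∉ Iio (outerEnd R E) from hX)]
          have : ∀ ω, ({z : E₁ × E₂ | ‖z.1‖ ^ 2 + ‖z.2‖ ^ 2 < R} ∩
            (fun z : E₁ × E₂ => ‖z.2‖ ^ 2 - ‖z.1‖ ^ 2) ⁻¹' S).indicator
            (fun z => ENNReal.ofReal (f z)) (ξ • dirX ω + (E / ξ) • dirY ω) = 0 := by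
            intro ω
            refine indicator_of_notMem (fun h => hX ?_) _
            have h2 := h.1
            rw [mem_ofPred_eq, (hcoord ξ hξ ω).1, (hcoord ξ hξ ω).2] at h2
            exact (mem_region_iff_lt_outerEnd hR hER hξ).1 h2
          simp [this]
      rw [setLIntegral_congr_fun measurableSet_Ioi h1, setLIntegral_indicator measurableSet_Iio,
        Set.inter_comm, Ioi_inter_Iio]
      exact (hIval E hE0 hER).2
    · rw [indicator_of_notMem hES]
      rw [setLIntegral_congr_fun (g := fun _ => 0) measurableSet_Ioi, lintegral_zero]
      intro ξ hξ
      have : ∀ ω, ({z : E₁ × E₂ | ‖z.1‖ ^ 2 + ‖z.2‖ ^ 2 < R} ∩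
        (fun z : E₁ × E₂ => ‖z.2‖ ^ 2 - ‖z.1‖ ^ 2) ⁻¹' S).indicator
        (fun z => ENNReal.ofReal (f z)) (ξ • dirX ω + (E / ξ) • dirY ω) = 0 := by
        intro ω
        refine indicator_of_notMem (fun h => hES ?_) _
        have h2 := h.2
        rwa [mem_preimage, (hcoord ξ hξ ω).1, (hcoord ξ hξ ω).2, hQ ξ hξ] at h2
      simp [this]

end Product

/-! ### The density of a definite quadratic form -/

section Definite

theorem norm_apply_sphere_le {E : Type*} [NormedAddCommGroup E] [NormedSpace ℝ E]
    (p : FormalMultilinearSeries ℝ E ℝ) (n : ℕ) (ω : Metric.sphere (0 : E) 1) :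
    ‖p n (fun _ => (ω : E))‖ ≤ ‖p n‖ := by
  refine ((p n).le_opNorm _).trans (le_of_eq ?_)
  simp

variable {E : Type*} [NormedAddCommGroup E] [NormedSpace ℝ E] [MeasurableSpace E] [BorelSpace E]
  [FiniteDimensional ℝ E] (μ : Measure E) [μ.IsAddHaarMeasure]

/-- The coefficients of the integral of a power series over spheres about the centre. -/
noncomputable def radialCoeff (p : FormalMultilinearSeries ℝ E ℝ) (n : ℕ) : ℝ :=
  ∫ ω : Metric.sphere (0 : E) 1, p n (fun _ => (ω : E)) ∂μ.toSphere

theorem integrable_radial (p : FormalMultilinearSeries ℝ E ℝ) (n : ℕ) :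
    Integrable (fun ω : Metric.sphere (0 : E) 1 => p n (fun _ => (ω : E))) μ.toSphere := by
  have := FiniteDimensional.proper_real E
  have hc : Continuous fun ω : Metric.sphere (0 : E) 1 => p n (fun _ => (ω : E)) :=
    (p n).cont.comp (continuous_pi fun _ => continuous_subtype_val)
  exact integrableOn_univ.1 (hc.continuousOn.integrableOn_compact isCompact_univ)

theorem abs_radialCoeff_le {p : FormalMultilinearSeries ℝ E ℝ} {C M : ℝ}
    (hp : ∀ n, ‖p n‖ ≤ C * M ^ n) (n : ℕ) :
    |radialCoeff μ p n| ≤ C * μ.toSphere.real univ * M ^ n := by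
  have h := norm_integral_le_of_norm_le_const (μ := μ.toSphere)
    (f := fun ω : Metric.sphere (0 : E) 1 => p n (fun _ => (ω : E))) (C := C * M ^ n)
    (ae_of_all _ fun ω => (norm_apply_sphere_le p n ω).trans (hp n))
  rw [mul_right_comm]
  exact h

/-- By antipodal symmetry the spherical integrals of odd degree cancel, so the integral over the
sphere of radius t is a power series in t². -/
theorem radialCoeff_eq_zero (p : FormalMultilinearSeries ℝ E ℝ) {n : ℕ} (hn : Odd n) :
    radialCoeff μ p n = 0 := by
  have h : radialCoeff μ p n = -radialCoeff μ p n := by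
    conv_lhs => rw [radialCoeff, ← (measurePreserving_neg_toSphere μ).integral_comp
      (Homeomorph.neg (Metric.sphere (0 : E) 1)).measurableEmbedding]
    rw [radialCoeff, ← integral_neg]
    refine integral_congr_ae (ae_of_all _ fun ω => ?_)
    have h1 := (p n).map_smul_univ (fun _ => (-1 : ℝ)) (fun _ => (ω : E))
    simpa [hn.neg_one_pow] using h1
  linarith

theorem integral_radial_eq_powSum {f : E → ℝ} {p : FormalMultilinearSeries ℝ E ℝ}
    {ρ : ENNReal} (hf : HasFPowerSeriesOnBall f p 0 ρ) {C M : ℝ} (hM : 0 ≤ M)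
    (hp : ∀ n, ‖p n‖ ≤ C * M ^ n) {t : ℝ} (ht : M * |t| < 1)
    (hmem : ∀ ω : Metric.sphere (0 : E) 1, t • (ω : E) ∈ Metric.eball (0 : E) ρ) :
    ∫ ω : Metric.sphere (0 : E) 1, f (t • (ω : E)) ∂μ.toSphere =
      powSum (fun m => radialCoeff μ p (2 * m)) (t ^ 2) := by
  have hint : ∀ n : ℕ, Integrable (fun ω : Metric.sphere (0 : E) 1 =>
      p n (fun _ => (ω : E)) * t ^ n) μ.toSphere := fun n => (integrable_radial μ p n).mul_const _
  have hsum : Summable fun n : ℕ => ∫ ω : Metric.sphere (0 : E) 1,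
      ‖p n (fun _ => (ω : E)) * t ^ n‖ ∂μ.toSphere := by
    refine Summable.of_nonneg_of_le (fun _ => integral_nonneg fun _ => norm_nonneg _) (fun n => ?_)
      (((summable_geometric_of_lt_one (r := M * |t|) (by positivity) ht).mul_left C).mul_left
        (μ.toSphere.real univ))
    calc _ ≤ ∫ _ : Metric.sphere (0 : E) 1, C * (M * |t|) ^ n ∂μ.toSphere := by
          refine integral_mono (hint n).norm (integrable_const _) fun ω => ?_
          simp only
          rw [norm_mul, norm_pow, Real.norm_eq_abs t, mul_pow, ← mul_assoc]
          gcongr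
          exact (norm_apply_sphere_le p n ω).trans (hp n)
      _ = _ := by rw [integral_const, smul_eq_mul]
  have h := hasSum_integral_of_summable_integral_norm hint hsum
  have h1 : ∀ ω : Metric.sphere (0 : E) 1, ∑' n : ℕ, p n (fun _ => (ω : E)) * t ^ n =
      f (t • (ω : E)) := by
    intro ω
    have h2 := hf.hasSum (hmem ω)
    rw [zero_add] at h2
    rw [← h2.tsum_eq]
    refine tsum_congr fun n => ?_
    have h3 := (p n).map_smul_univ (fun _ => t) (fun _ => (ω : E))
    simp only [Finset.prod_const, Finset.card_univ, Fintype.card_fin, smul_eq_mul] at h3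
    rw [h3, mul_comm]
  simp only [h1, integral_mul_const] at h
  rw [← h.tsum_eq, powSum]
  have hinj : Function.Injective fun m : ℕ => 2 * m := fun i j h => by simpa using h
  rw [← hinj.tsum_eq]
  · refine tsum_congr fun m => ?_
    rw [pow_mul]
    rfl
  · intro n hn
    rw [Function.mem_support] at hn
    rcases Nat.even_or_odd' n with ⟨m, hm | hm⟩
    · exact ⟨m, hm.symm⟩
    · exact (hn (by
        rw [show ∫ ω : Metric.sphere (0 : E) 1, p n (fun _ => (ω : E)) ∂μ.toSphere =
          radialCoeff μ p n from rfl, radialCoeff_eq_zero μ p ⟨m, hm⟩, zero_mul])).elim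

/-- The density at `E` of the square of the norm, in terms of its regular factor. -/
noncomputable def radialDensity (N : ℕ) (g : ℝ → ℝ) (E : ℝ) : ℝ :=
  if 0 < E then E ^ (((N : ℝ) - 2) / 2) * g E else 0

theorem lintegral_Ioi_eq_lintegral_sq (g : ℝ → ENNReal) :
    ∫⁻ E in Ioi (0 : ℝ), g E = ∫⁻ t in Ioi (0 : ℝ), ENNReal.ofReal (2 * t) * g (t ^ 2) := by
  have himg : (fun t : ℝ => t ^ 2) '' Ioi 0 = Ioi 0 := by
    ext E
    constructor
    · rintro ⟨t, ht, rfl⟩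
      exact pow_pos (mem_Ioi.1 ht) 2
    · intro hE
      exact ⟨√E, Real.sqrt_pos.2 hE, Real.sq_sqrt (le_of_lt hE)⟩
  have h := lintegral_image_eq_lintegral_abs_deriv_mul (s := Ioi (0 : ℝ))
    (f := fun t : ℝ => t ^ 2) (f' := fun t => 2 * t) measurableSet_Ioi
    (fun t _ => by simpa using (hasDerivAt_pow 2 t).hasDerivWithinAt)
    (fun x hx y hy hxy => (pow_left_inj₀ (le_of_lt hx) (le_of_lt hy) two_ne_zero).1 hxy) g
  rw [himg] at h
  rw [h]
  refine setLIntegral_congr_fun measurableSet_Ioi fun t ht => ?_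
  rw [abs_of_pos (by have := mem_Ioi.1 ht; positivity)]

/-- With E = t², t^(N-1) dt = E^((N-2)/2) dE/2, and the spherical integral of f is an analytic
function of E; g is half of it. -/
theorem exists_radialDensity [Nontrivial E] {f : E → ℝ}
    (hfm : Measurable f) (hfa : AnalyticAt ℝ f 0) (hf0 : 0 < f 0) :
    ∃ r₀ > 0, ∀ r, 0 < r → r < r₀ → ∃ (g : ℝ → ℝ) (δ : ℝ), 0 < δ ∧ AnalyticAt ℝ g 0 ∧
      g 0 = f 0 * μ.toSphere.real univ / 2 ∧ (∀ x, 0 < x → x < δ → 0 ≤ g x) ∧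
      ∀ S, MeasurableSet S → S ⊆ Ioo (-δ) δ →
        ∫⁻ x in {x : E | ‖x‖ ^ 2 < r ^ 2} ∩ (fun x => ‖x‖ ^ 2) ⁻¹' S, ENNReal.ofReal (f x) ∂μ =
          ∫⁻ x in S, ENNReal.ofReal (radialDensity (Module.finrank ℝ E) g x) := by
  obtain ⟨p, ρ, hp⟩ := hfa
  obtain ⟨C, M, hC, hM, hpb⟩ := p.le_mul_pow_of_radius_pos hp.radius_pos
  obtain ⟨ε, hε, hεball⟩ : ∃ ε > 0, ∀ z ∈ Metric.ball (0 : E) ε,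
      z ∈ Metric.eball (0 : E) ρ ∧ 0 < f z := by
    have h1 : ∀ᶠ z in 𝓝 (0 : E), z ∈ Metric.eball (0 : E) ρ ∧ 0 < f z :=
      Filter.Eventually.and (Metric.eball_mem_nhds _ hp.r_pos)
        (hp.analyticAt.continuousAt.eventually (lt_mem_nhds hf0))
    exact Metric.eventually_nhds_iff_ball.1 h1
  refine ⟨min ε (1 / M), by positivity, fun r hr hr0 => ?_⟩
  have hrε : r < ε := hr0.trans_le (min_le_left _ _)
  have hrM : M * r < 1 := by
    have := hr0.trans_le (min_le_right _ _)
    rwa [lt_div_iff₀ (by positivity), mul_comm] at this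
  set c : ℕ → ℝ := fun m => radialCoeff μ p (2 * m) with hc
  have hcb : ∀ m, |c m| ≤ C * μ.toSphere.real univ * (M ^ 2) ^ m := by
    intro m
    rw [← pow_mul]
    exact abs_radialCoeff_le μ hpb (2 * m)
  have hmem : ∀ t, 0 < t → t < r → ∀ ω : Metric.sphere (0 : E) 1,
      t • (ω : E) ∈ Metric.ball (0 : E) ε := by
    intro t ht htr ω
    rw [mem_ball_zero_iff, norm_smul, norm_eq_of_mem_sphere, mul_one, Real.norm_of_nonneg ht.le]
    exact htr.trans hrε
  have hval : ∀ t, 0 < t → t < r →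
      ∫ ω : Metric.sphere (0 : E) 1, f (t • (ω : E)) ∂μ.toSphere = powSum c (t ^ 2) := by
    intro t ht htr
    refine integral_radial_eq_powSum μ hp hM.le hpb ?_ fun ω => (hεball _ (hmem t ht htr ω)).1
    rw [abs_of_pos ht]
    exact lt_of_le_of_lt (by gcongr) hrM
  have hnn : ∀ t, 0 < t → t < r → 0 ≤ powSum c (t ^ 2) := by
    intro t ht htr
    rw [← hval t ht htr]
    exact integral_nonneg fun ω => (hεball _ (hmem t ht htr ω)).2.le
  have hlint : ∀ t, 0 < t → t < r → ∫⁻ ω : Metric.sphere (0 : E) 1,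
      ENNReal.ofReal (f (t • (ω : E))) ∂μ.toSphere = ENNReal.ofReal (powSum c (t ^ 2)) := by
    intro t ht htr
    have := FiniteDimensional.proper_real E
    have hcont : Continuous fun ω : Metric.sphere (0 : E) 1 => f (t • (ω : E)) := by
      have h1 : Continuous fun ω : Metric.sphere (0 : E) 1 => t • (ω : E) :=
        continuous_subtype_val.const_smul t
      exact hp.continuousOn.comp_continuous h1 fun ω => (hεball _ (hmem t ht htr ω)).1
    rw [← hval t ht htr, ofReal_integral_eq_lintegral_ofReal
      (integrableOn_univ.1 (hcont.continuousOn.integrableOn_compact isCompact_univ))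
      (ae_of_all _ fun ω => (hεball _ (hmem t ht htr ω)).2.le)]
  refine ⟨fun x => powSum c x / 2, r ^ 2, by positivity,
    (analyticAt_powSum hcb (by positivity)).div_const, ?_, ?_, ?_⟩
  · simp only
    rw [powSum_zero, hc]
    have : ∀ ω : Metric.sphere (0 : E) 1, p 0 (fun _ => (ω : E)) = f 0 := fun ω => hp.coeff_zero _
    simp only [radialCoeff, this, integral_const, smul_eq_mul]
    ring
  · intro x hx hxr
    have h1 : √x < r := (Real.sqrt_lt' hr).2 hxr
    have := hnn _ (Real.sqrt_pos.2 hx) h1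
    rw [Real.sq_sqrt hx.le] at this
    positivity
  · intro S hS hSδ
    have hDm : MeasurableSet ({x : E | ‖x‖ ^ 2 < r ^ 2} ∩ (fun x : E => ‖x‖ ^ 2) ⁻¹' S) := by
      refine (measurableSet_lt (by fun_prop) measurable_const).inter ?_
      exact (by fun_prop : Measurable fun x : E => ‖x‖ ^ 2) hS
    have hrhs : ∫⁻ x in S, ENNReal.ofReal (radialDensity (Module.finrank ℝ E)
        (fun x => powSum c x / 2) x) = ∫⁻ x in Ioi (0 : ℝ), S.indicator (fun x =>
          ENNReal.ofReal (x ^ (((Module.finrank ℝ E : ℝ) - 2) / 2) * (powSum c x / 2))) x := by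
      rw [← lintegral_indicator hS, ← lintegral_indicator measurableSet_Ioi]
      refine lintegral_congr fun x => ?_
      by_cases hx : 0 < x <;> by_cases hxS : x ∈ S <;> simp [radialDensity, indicator, hx, hxS]
    rw [hrhs, lintegral_Ioi_eq_lintegral_sq, ← lintegral_indicator hDm,
      lintegral_eq_polar μ (hfm.ennreal_ofReal.indicator hDm)]
    refine setLIntegral_congr_fun measurableSet_Ioi fun t ht => ?_
    have ht0 : 0 < t := ht
    have hnorm : ∀ ω : Metric.sphere (0 : E) 1, ‖t • (ω : E)‖ ^ 2 = t ^ 2 := by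
      intro ω
      simp [norm_smul]
    by_cases htS : t ^ 2 ∈ S
    · have htr2 : t ^ 2 < r ^ 2 := (hSδ htS).2
      have htr : t < r := lt_of_pow_lt_pow_left₀ 2 hr.le htr2
      rw [indicator_of_mem htS]
      have h1 : ∀ ω : Metric.sphere (0 : E) 1,
          ({x : E | ‖x‖ ^ 2 < r ^ 2} ∩ (fun x : E => ‖x‖ ^ 2) ⁻¹' S).indicator
            (fun x => ENNReal.ofReal (f x)) (t • (ω : E)) = ENNReal.ofReal (f (t • (ω : E))) := by
        intro ω
        refine indicator_of_mem ?_ _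
        exact ⟨by rw [mem_ofPred_eq, hnorm]; exact htr2, by rw [mem_preimage, hnorm]; exact htS⟩
      simp only [h1]
      have hpow : t ^ (Module.finrank ℝ E - 1) =
          t * (t ^ 2) ^ (((Module.finrank ℝ E : ℝ) - 2) / 2) := by
        have hN : 0 < Module.finrank ℝ E := Module.finrank_pos
        rw [← Real.rpow_natCast t 2, ← Real.rpow_mul ht0.le, ← Real.rpow_natCast t
          (Module.finrank ℝ E - 1), Nat.cast_pred hN]
        conv_rhs => rw [← Real.rpow_one t, ← Real.rpow_mul ht0.le, ← Real.rpow_add ht0]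
        congr 1
        push_cast
        ring
      rw [hlint t ht0 htr, ← ENNReal.ofReal_mul (by positivity),
        ← ENNReal.ofReal_mul (by positivity), hpow]
      congr 1
      ring
    · rw [indicator_of_notMem htS]
      have h1 : ∀ ω : Metric.sphere (0 : E) 1,
          ({x : E | ‖x‖ ^ 2 < r ^ 2} ∩ (fun x : E => ‖x‖ ^ 2) ⁻¹' S).indicator
            (fun x => ENNReal.ofReal (f x)) (t • (ω : E)) = 0 := by
        intro ω
        refine indicator_of_notMem (fun h => htS ?_) _
        have h2 := h.2
        rwa [mem_preimage, hnorm] at h2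
      simp [h1]

theorem hasSingularPush_norm_sq [Nontrivial E] {f : E → ℝ}
    (hfm : Measurable f) (hfa : AnalyticAt ℝ f 0) (hf0 : 0 < f 0) :
    ∃ r₀ > 0, ∀ r, 0 < r → r < r₀ →
      HasSingularPush μ {x : E | ‖x‖ ^ 2 < r ^ 2} (fun x => ‖x‖ ^ 2) f (Module.finrank ℝ E) 0
        (f 0 * μ.toSphere.real univ / 2) := by
  obtain ⟨r₀, hr₀, h⟩ := exists_radialDensity μ hfm hfa hf0
  refine ⟨r₀, hr₀, fun r hr hr' => ?_⟩
  obtain ⟨g, δ, hδ, hg, hg0, hgnn, hS⟩ := h r hr hr'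
  refine ⟨radialDensity (Module.finrank ℝ E) g, fun _ => 0, g, δ, hδ, analyticAt_const, hg, hg0,
    fun x hx0 hx => ?_, hS⟩
  rw [universalSingularity_even (by simp), radialDensity]
  rcases lt_or_gt_of_ne hx0 with h | h
  · rw [if_neg h.not_gt, heaviside, if_neg h.not_ge]
    simp
  · rw [if_pos h, heaviside, if_pos h.le]
    rw [abs_of_pos h] at hx
    refine ⟨mul_nonneg (Real.rpow_nonneg h.le _) (hgnn x h hx), ?_⟩
    simp
    ring

/-- Reflection E ↦ -E of the positive definite case. What remains is to match the reflected density
with the branch of the universal function that belongs to k = N. -/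
theorem hasSingularPush_neg_norm_sq [Nontrivial E] {f : E → ℝ}
    (hfm : Measurable f) (hfa : AnalyticAt ℝ f 0) (hf0 : 0 < f 0) :
    ∃ r₀ > 0, ∀ r, 0 < r → r < r₀ →
      HasSingularPush μ {x : E | ‖x‖ ^ 2 < r ^ 2} (fun x => -‖x‖ ^ 2) f (Module.finrank ℝ E)
        (Module.finrank ℝ E) (f 0 * μ.toSphere.real univ / 2) := by
  obtain ⟨r₀, hr₀, h⟩ := exists_radialDensity μ hfm hfa hf0
  refine ⟨r₀, hr₀, fun r hr hr' => ?_⟩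
  obtain ⟨g, δ, hδ, hg, hg0, hgnn, hS⟩ := h r hr hr'
  set N := Module.finrank ℝ E with hN
  have hN0 : 0 < N := Module.finrank_pos
  have hgneg : AnalyticAt ℝ (fun x => g (-x)) 0 :=
    AnalyticAt.fun_comp (by simpa using hg) analyticAt_id.neg
  have hpush : ∀ S, MeasurableSet S → S ⊆ Ioo (-δ) δ →
      ∫⁻ x in {x : E | ‖x‖ ^ 2 < r ^ 2} ∩ (fun x => -‖x‖ ^ 2) ⁻¹' S, ENNReal.ofReal (f x) ∂μ =
        ∫⁻ x in S, ENNReal.ofReal (radialDensity N g (-x)) := by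
    intro S hSm hSδ
    have h1 := hS (Neg.neg ⁻¹' S) (measurable_neg hSm) (by
      intro x hx
      have := hSδ hx
      exact ⟨by linarith [this.2], by linarith [this.1]⟩)
    have h2 : (fun x : E => -‖x‖ ^ 2) ⁻¹' S = (fun x : E => ‖x‖ ^ 2) ⁻¹' (Neg.neg ⁻¹' S) := rfl
    rw [h2, h1, ← lintegral_indicator (measurable_neg hSm), ← lintegral_indicator hSm,
      ← lintegral_neg_eq_self]
    refine lintegral_congr fun x => ?_
    by_cases hx : x ∈ S <;> simp [indicator, hx]
  have hnn : ∀ x, x ≠ 0 → |x| < δ → 0 ≤ radialDensity N g (-x) := by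
    intro x hx0 hx
    rw [radialDensity]
    split_ifs with h
    · rw [abs_of_neg (by linarith)] at hx
      exact mul_nonneg (Real.rpow_nonneg h.le _) (hgnn _ h hx)
    · exact le_rfl
  rcases Nat.even_or_odd' N with ⟨m, hm | hm⟩
  · obtain ⟨h, rfl⟩ : ∃ h, m = h + 1 := ⟨m - 1, by omega⟩
    -- For even N the density is the analytic function (-x)^h g(-x) cut off to x < 0. Taking the
    -- whole function as A leaves its negative on x > 0, which is where the even branch lives.
    refine ⟨fun x => radialDensity N g (-x), fun x => (-x) ^ h * g (-x), fun x => g (-x), δ, hδ,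
      (analyticAt_id.neg.pow h).mul hgneg, hgneg, by simpa using hg0,
      fun x hx0 hx => ⟨hnn x hx0 hx, ?_⟩, hpush⟩
    have hpow : ∀ y : ℝ, y ^ (((N : ℝ) - 2) / 2) = y ^ h := by
      intro y
      rw [← Real.rpow_natCast]
      congr 1
      rw [hm]
      push_cast
      ring
    beta_reduce
    rw [universalSingularity_even (by rw [Nat.even_iff]; omega), radialDensity, hpow, hpow, hm,
      neg_one_pow_mod_four, pow_succ, neg_pow x]
    rcases lt_or_gt_of_ne hx0 with hlt | hgt
    · rw [if_pos (by linarith), heaviside, if_neg hlt.not_ge]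
      ring
    · rw [if_neg (by linarith), heaviside, if_pos hgt.le]
      ring
  · refine ⟨fun x => radialDensity N g (-x), fun _ => 0, fun x => g (-x), δ, hδ,
      analyticAt_const, hgneg, by simpa using hg0, fun x hx0 hx => ⟨hnn x hx0 hx, ?_⟩, hpush⟩
    beta_reduce
    rw [universalSingularity_odd (by rw [Nat.even_iff]; omega) (by rw [Nat.even_iff]; omega),
      radialDensity]
    have h1 : (-1 : ℝ) ^ (((N : ℤ) - (N % 4 : ℕ)) / 2) = 1 := by
      have : ((N : ℤ) - (N % 4 : ℕ)) / 2 = 2 * ((N : ℤ) / 4) := by omega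
      rw [this, zpow_mul]
      norm_num
    rw [h1]
    rcases lt_or_gt_of_ne hx0 with hlt | hgt
    · rw [if_pos (by linarith), heaviside, if_pos (by linarith)]
      ring
    · rw [if_neg (by linarith), heaviside, if_neg (by linarith)]
      ring

end Definite

/-! ### The density of a diagonal quadratic form on Euclidean space -/

/-- The quadratic form `-x₁² - ⋯ - x_k² + x_{k+1}² + ⋯ + x_N²`. -/
noncomputable def diagForm (N k : ℕ) (x : EuclideanSpace ℝ (Fin N)) : ℝ :=
  ∑ i : Fin N, if (i : ℕ) < k then -(x i) ^ 2 else (x i) ^ 2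

theorem HasSingularPush.comp {X Y : Type*} [MeasurableSpace X] [MeasurableSpace Y]
    {μ : Measure X} {ν : Measure Y} {e : X ≃ᵐ Y} (he : MeasurePreserving e μ ν) {D : Set Y}
    {Q f : Y → ℝ} {N k : ℕ} {c : ℝ} (h : HasSingularPush ν D Q f N k c) :
    HasSingularPush μ (e ⁻¹' D) (Q ∘ e) (f ∘ e) N k c := by
  obtain ⟨I, A, B, δ, hδ, hA, hB, hB0, hI, hS⟩ := h
  refine ⟨I, A, B, δ, hδ, hA, hB, hB0, hI, fun S hSm hSδ => ?_⟩
  rw [← hS S hSm hSδ]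
  exact he.setLIntegral_comp_preimage_emb e.measurableEmbedding (fun y => ENNReal.ofReal (f y))
    (D ∩ Q ⁻¹' S)

theorem toSphere_euclidean {n : ℕ} (hn : 0 < n) :
    (volume : Measure (EuclideanSpace ℝ (Fin n))).toSphere.real univ =
      2 * Real.pi ^ ((n : ℝ) / 2) / Real.Gamma ((n : ℝ) / 2) := by
  have : Nonempty (Fin n) := ⟨⟨0, hn⟩⟩
  have hn' : (0 : ℝ) < (n : ℝ) / 2 := by positivity
  rw [Measure.toSphere_real_apply_univ, measureReal_def, EuclideanSpace.volume_ball,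
    finrank_euclideanSpace_fin, Fintype.card_fin, ENNReal.ofReal_one, one_pow, one_mul,
    ENNReal.toReal_ofReal (by have := Real.Gamma_pos_of_pos hn'; positivity),
    Real.Gamma_add_one hn'.ne', Real.sqrt_eq_rpow, ← Real.rpow_natCast, ← Real.rpow_mul
      Real.pi_pos.le]
  have := (Real.Gamma_pos_of_pos hn').ne'
  have : (n : ℝ) ≠ 0 := by positivity
  rw [show (1 / 2 : ℝ) * n = n / 2 by ring]
  field_simp

/-- Splitting the first `k` coordinates from the last `l`. -/
noncomputable def splitEquiv (k l : ℕ) : EuclideanSpace ℝ (Fin (k + l)) ≃ₗᵢ[ℝ]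
    WithLp 2 (EuclideanSpace ℝ (Fin k) × EuclideanSpace ℝ (Fin l)) :=
  (LinearIsometryEquiv.piLpCongrLeft 2 ℝ ℝ finSumFinEquiv.symm).trans
    (PiLp.sumPiLpEquivProdLpPiLp 2 _)

theorem splitEquiv_fst_apply {k l : ℕ} (x : EuclideanSpace ℝ (Fin (k + l))) (i : Fin k) :
    (splitEquiv k l x).fst i = x (Fin.castAdd l i) := rfl

theorem splitEquiv_snd_apply {k l : ℕ} (x : EuclideanSpace ℝ (Fin (k + l))) (i : Fin l) :
    (splitEquiv k l x).snd i = x (Fin.natAdd k i) := rfl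

theorem diagForm_add {k l : ℕ} (x : EuclideanSpace ℝ (Fin (k + l))) :
    diagForm (k + l) k x = ‖(splitEquiv k l x).snd‖ ^ 2 - ‖(splitEquiv k l x).fst‖ ^ 2 := by
  rw [diagForm, Fin.sum_univ_add, EuclideanSpace.norm_sq_eq, EuclideanSpace.norm_sq_eq]
  simp [splitEquiv_fst_apply, splitEquiv_snd_apply, neg_add_eq_sub]

theorem ball_eq_norm_sq_lt {E : Type*} [NormedAddCommGroup E] {r : ℝ} (hr : 0 < r) :
    Metric.ball (0 : E) r = {x | ‖x‖ ^ 2 < r ^ 2} := by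
  ext x
  rw [mem_ball_zero_iff, mem_ofPred_eq, sq_lt_sq₀ (norm_nonneg _) hr.le]

/-- The constant does not depend on k: Γ(k/2) and Γ(l/2) from the two sphere areas cancel against
the Beta function. The definite cases k = 0 and k = N are separate because one factor of the product
would be trivial. -/
theorem hasSingularPush_diagForm {N k : ℕ} (hN : 0 < N) (hk : k ≤ N)
    {f : EuclideanSpace ℝ (Fin N) → ℝ} (hfm : Measurable f) (hfa : AnalyticAt ℝ f 0)
    (hf0 : 0 < f 0) :
    ∃ r₀ > 0, ∀ r, 0 < r → r < r₀ → HasSingularPush volume (Metric.ball 0 r) (diagForm N k) f N k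
      (f 0 * (Real.pi ^ ((N : ℝ) / 2) / Real.Gamma ((N : ℝ) / 2))) := by
  have : Nonempty (Fin N) := ⟨⟨0, hN⟩⟩
  rcases Nat.eq_zero_or_pos k with rfl | hk0
  · obtain ⟨r₀, hr₀, h⟩ := hasSingularPush_norm_sq volume hfm hfa hf0
    refine ⟨r₀, hr₀, fun r hr hr' => ?_⟩
    convert h r hr hr' using 1
    · exact ball_eq_norm_sq_lt hr
    · funext x
      rw [diagForm, EuclideanSpace.norm_sq_eq]
      simp
    · simp
    · rw [toSphere_euclidean hN]
      ring
  rcases hk.eq_or_lt with rfl | hkN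
  · obtain ⟨r₀, hr₀, h⟩ := hasSingularPush_neg_norm_sq volume hfm hfa hf0
    refine ⟨r₀, hr₀, fun r hr hr' => ?_⟩
    convert h r hr hr' using 1
    · exact ball_eq_norm_sq_lt hr
    · funext x
      rw [diagForm, EuclideanSpace.norm_sq_eq]
      simp
    · simp
    · simp
    · rw [toSphere_euclidean hN]
      ring
  obtain ⟨l, rfl⟩ := Nat.exists_eq_add_of_le hk
  have hl : 0 < l := by omega
  have : Nonempty (Fin k) := ⟨⟨0, hk0⟩⟩
  have : Nonempty (Fin l) := ⟨⟨0, hl⟩⟩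
  let L : EuclideanSpace ℝ (Fin (k + l)) ≃L[ℝ]
      EuclideanSpace ℝ (Fin k) × EuclideanSpace ℝ (Fin l) :=
    (splitEquiv k l).toContinuousLinearEquiv.trans (WithLp.prodContinuousLinearEquiv 2 ℝ _ _)
  have hL1 : ∀ x, (L x).1 = (splitEquiv k l x).fst := fun x => rfl
  have hL2 : ∀ x, (L x).2 = (splitEquiv k l x).snd := fun x => rfl
  have hLm : MeasurePreserving L.toHomeomorph.toMeasurableEquiv volume (volume.prod volume) :=
    (WithLp.volume_preserving_ofLp _ _).comp (splitEquiv k l).measurePreserving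
  have hLsymm0 : L.symm 0 = 0 := map_zero _
  obtain ⟨r₀, hr₀, h⟩ := hasSingularPush_prod (volume : Measure (EuclideanSpace ℝ (Fin k)))
    (volume : Measure (EuclideanSpace ℝ (Fin l))) (f := f ∘ L.symm)
    (hfm.comp L.symm.continuous.measurable)
    (hfa.comp_of_eq (L.symm.toContinuousLinearMap.analyticAt 0) hLsymm0)
    (by simpa using hf0)
  refine ⟨r₀, hr₀, fun r hr hr' => ?_⟩
  convert (h r hr hr').comp hLm using 1
  · ext x
    rw [mem_ball_zero_iff, mem_preimage, mem_ofPred_eq]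
    change _ ↔ ‖(L x).1‖ ^ 2 + ‖(L x).2‖ ^ 2 < r ^ 2
    rw [hL1, hL2, ← WithLp.prod_norm_sq_eq_of_L2, LinearIsometryEquiv.norm_map,
      sq_lt_sq₀ (norm_nonneg _) hr.le]
  · funext x
    exact diagForm_add x
  · funext x
    exact congrArg f (L.symm_apply_apply x).symm
  · simp
  · simp
  · have h1 : (0 : ℝ) < (k : ℝ) / 2 := by positivity
    have h2 : (0 : ℝ) < (l : ℝ) / 2 := by positivity
    have g1 := (Real.Gamma_pos_of_pos h1).ne'
    have g2 := (Real.Gamma_pos_of_pos h2).ne'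
    have g3 := (Real.Gamma_pos_of_pos (add_pos h1 h2)).ne'
    rw [toSphere_euclidean hk0, toSphere_euclidean hl, eulerBeta, finrank_euclideanSpace_fin,
      finrank_euclideanSpace_fin, Function.comp_apply, hLsymm0, Nat.cast_add, add_div,
      Real.rpow_add Real.pi_pos]
    field_simp
    norm_num

/-! ### Densities as limits of averages -/

theorem tendsto_average_Ioo {g : ℝ → ENNReal} {a : ℝ} (hg : ContinuousAt g a) :
    Tendsto (fun ε : ℝ => (∫⁻ x in Ioo (a - ε) (a + ε), g x) / ENNReal.ofReal (2 * ε))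
      (𝓝[>] 0) (𝓝 (g a)) := by
  have key : ∀ p : ℝ → Prop, (∀ᶠ x in 𝓝 a, p x) →
      ∀ᶠ ε in 𝓝[>] (0 : ℝ), 0 < ε ∧ ∀ x ∈ Ioo (a - ε) (a + ε), p x := by
    intro p hp
    obtain ⟨ρ, hρ, h⟩ := Metric.eventually_nhds_iff_ball.1 hp
    filter_upwards [Ioo_mem_nhdsGT hρ] with ε hε
    refine ⟨hε.1, fun x hx => h x ?_⟩
    rw [Real.ball_eq_Ioo]
    exact ⟨by linarith [hx.1, hε.2], by linarith [hx.2, hε.2]⟩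
  have hvol : ∀ ε : ℝ, volume (Ioo (a - ε) (a + ε)) = ENNReal.ofReal (2 * ε) := by
    intro ε
    rw [Real.volume_Ioo]
    congr 1
    ring
  refine tendsto_order.2 ⟨fun b hb => ?_, fun b hb => ?_⟩
  · obtain ⟨b', hb, hb'⟩ := exists_between hb
    filter_upwards [key _ (hg.eventually (lt_mem_nhds hb'))] with ε ⟨hε, h⟩
    refine hb.trans_le ?_
    rw [ENNReal.le_div_iff_mul_le (Or.inl (by simpa using hε)) (Or.inl ENNReal.ofReal_ne_top),
      ← hvol, ← setLIntegral_const]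
    exact setLIntegral_mono' measurableSet_Ioo fun x hx => (h x hx).le
  · obtain ⟨b', hb', hb⟩ := exists_between hb
    filter_upwards [key _ (hg.eventually (gt_mem_nhds hb'))] with ε ⟨hε, h⟩
    refine lt_of_le_of_lt ?_ hb
    rw [ENNReal.div_le_iff (by simpa using hε) ENNReal.ofReal_ne_top, ← hvol,
      ← setLIntegral_const]
    exact setLIntegral_mono' measurableSet_Ioo fun x hx => (h x hx).le

theorem continuousAt_heaviside {v : ℝ} (hv : v ≠ 0) : ContinuousAt heaviside v := by
  rcases lt_or_gt_of_ne hv with h | h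
  · refine continuousAt_const.congr (f := fun _ => (0 : ℝ)) ?_
    filter_upwards [gt_mem_nhds h] with x hx
    rw [heaviside, if_neg hx.not_ge]
  · refine continuousAt_const.congr (f := fun _ => (1 : ℝ)) ?_
    filter_upwards [lt_mem_nhds h] with x hx
    rw [heaviside, if_pos hx.le]

theorem continuousAt_universalSingularity (N κ : ℕ) {v : ℝ} (hv : v ≠ 0) :
    ContinuousAt (universalSingularity N κ) v := by
  unfold universalSingularity
  split_ifs
  · exact (continuousAt_const.mul (continuousAt_id.rpow_const (Or.inl hv))).mul
      (continuousAt_heaviside hv)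
  · refine (continuousAt_const.mul (continuousAt_id.pow _)).mul (continuousAt_const.mul ?_)
    exact (Real.continuousAt_log (abs_ne_zero.2 hv)).comp continuous_abs.continuousAt
  · refine (continuousAt_const.mul (continuousAt_neg.rpow_const (Or.inl (neg_ne_zero.2 hv)))).mul ?_
    exact ContinuousAt.comp (g := heaviside) (continuousAt_heaviside (neg_ne_zero.2 hv))
      continuousAt_neg

/-- Off E = 0 the density is continuous, being A + B h with h continuous there, so its averages over
shrinking intervals converge to its value. -/
theorem HasSingularPush.exists_density {X : Type*} [MeasurableSpace X] {μ : Measure X} {D : Set X}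
    {Q f : X → ℝ} {N k : ℕ} {c : ℝ} (h : HasSingularPush μ D Q f N k c) :
    ∃ I A B : ℝ → ℝ, AnalyticAt ℝ A 0 ∧ AnalyticAt ℝ B 0 ∧ B 0 = c ∧ ∀ᶠ E in 𝓝[≠] (0 : ℝ),
      0 ≤ I E ∧ I E = A E + B E * universalSingularity N (k % 4) E ∧
      Tendsto (fun ε : ℝ => (∫⁻ x in D ∩ Q ⁻¹' Ioo (E - ε) (E + ε), ENNReal.ofReal (f x) ∂μ) /
        ENNReal.ofReal (2 * ε)) (𝓝[>] 0) (𝓝 (ENNReal.ofReal (I E))) := by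
  obtain ⟨I, A, B, δ, hδ, hA, hB, hB0, hI, hS⟩ := h
  refine ⟨I, A, B, hA, hB, hB0, ?_⟩
  have hsmall : ∀ᶠ E in 𝓝 (0 : ℝ), |E| < δ := by
    filter_upwards [Metric.ball_mem_nhds (0 : ℝ) hδ] with E hE
    simpa using hE
  filter_upwards [self_mem_nhdsWithin, nhdsWithin_le_nhds hA.eventually_analyticAt,
    nhdsWithin_le_nhds hB.eventually_analyticAt, nhdsWithin_le_nhds hsmall]
    with E hE0 hAE hBE hEδ
  have hE0 : E ≠ 0 := hE0
  refine ⟨(hI E hE0 hEδ).1, (hI E hE0 hEδ).2, ?_⟩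
  have hnear : ∀ᶠ x in 𝓝 E, x ≠ 0 ∧ |x| < δ :=
    (eventually_ne_nhds hE0).and
      (continuous_abs.continuousAt.eventually (gt_mem_nhds hEδ))
  have hIc : ContinuousAt I E := by
    refine ((hAE.continuousAt.add (hBE.continuousAt.mul
      (continuousAt_universalSingularity N (k % 4) hE0)))).congr ?_
    filter_upwards [hnear] with x hx
    exact (hI x hx.1 hx.2).2.symm
  refine (tendsto_average_Ioo (ENNReal.continuous_ofReal.continuousAt.comp hIc)).congr' ?_
  have hpos : 0 < δ - |E| := by linarith
  filter_upwards [Ioo_mem_nhdsGT hpos] with ε hε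
  rw [hS _ measurableSet_Ioo]
  · rfl
  · intro x hx
    have h1 := neg_abs_le E
    have h2 := le_abs_self E
    exact ⟨by linarith [hx.1, hε.2], by linarith [hx.2, hε.2]⟩

/-! ### Nonanalyticity of the universal functions -/

/-- Otherwise H = v^n g with g(0) ≠ 0: if n ≥ h the logarithm would have a finite limit at 0, and if
n < h then g would tend to 0. The case H = 0 fails because log v < 0. -/
theorem not_eventually_nhdsGT_log_mul_pow {H : ℝ → ℝ} (hH : AnalyticAt ℝ H 0) (h : ℕ) :
    ¬ ∀ᶠ v in 𝓝[>] (0 : ℝ), Real.log v * v ^ h = H v := by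
  intro hev
  have hlog : ∀ᶠ v in 𝓝[>] (0 : ℝ), Real.log v < -1 :=
    Real.tendsto_log_nhdsGT_zero.eventually_lt_atBot _
  by_cases hzero : ∀ᶠ v in 𝓝 (0 : ℝ), H v = 0
  · obtain ⟨v, h1, h2, h3, h4⟩ := (hev.and (hlog.and (eventually_mem_nhdsWithin.and
      (nhdsWithin_le_nhds hzero)))).exists
    have h3 : 0 < v := h3
    rw [h4] at h1
    have : Real.log v * v ^ h < 0 := mul_neg_of_neg_of_pos (by linarith) (by positivity)
    linarith
  obtain ⟨n, g, hg, hg0, hHg⟩ := hH.exists_eventuallyEq_pow_smul_nonzero_iff.2 hzero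
  have hHg' := nhdsWithin_le_nhds (s := Ioi 0) hHg
  have hgt : Tendsto g (𝓝[>] 0) (𝓝 (g 0)) := hg.continuousAt.tendsto.mono_left nhdsWithin_le_nhds
  rcases le_or_gt h n with hn | hn
  · obtain ⟨m, rfl⟩ := Nat.exists_eq_add_of_le hn
    have h1 : Tendsto Real.log (𝓝[>] 0) (𝓝 ((0 : ℝ) ^ m * g 0)) := by
      refine (((continuous_pow m).continuousAt.tendsto.mono_left nhdsWithin_le_nhds).mul
        hgt).congr' ?_
      filter_upwards [hev, hHg', self_mem_nhdsWithin] with v h1 h2 h3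
      have h3 : 0 < v := h3
      rw [h2, sub_zero, smul_eq_mul, pow_add] at h1
      have : v ^ h ≠ 0 := by positivity
      refine mul_left_cancel₀ this ?_
      linarith
    exact not_tendsto_nhds_of_tendsto_atBot Real.tendsto_log_nhdsGT_zero _ h1
  · obtain ⟨m, rfl⟩ := Nat.exists_eq_add_of_lt hn
    have h1 : Tendsto (fun v => Real.log v * v ^ (((m + 1 : ℕ) : ℝ))) (𝓝[>] 0) (𝓝 0) :=
      tendsto_log_mul_rpow_nhdsGT_zero (by positivity)
    refine hg0 (tendsto_nhds_unique hgt (h1.congr' ?_))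
    filter_upwards [hev, hHg', self_mem_nhdsWithin] with v h1 h2 h3
    have h3 : 0 < v := h3
    rw [h2, sub_zero, smul_eq_mul, add_assoc, pow_add] at h1
    rw [Real.rpow_natCast]
    have : v ^ n ≠ 0 := by positivity
    refine mul_left_cancel₀ this ?_
    linarith

/-- A step branch is zero on one side of 0, so an analytic extension would vanish identically near
0, while the function is nonzero on the other side. -/
theorem nonanalyticAtZero_universalSingularity (N κ : ℕ) :
    NonanalyticAtZero (universalSingularity N κ) := by
  intro F hF hev
  have hgt := hev.filter_mono (nhdsWithin_mono _ (fun x (hx : 0 < x) => hx.ne') :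
    𝓝[>] (0 : ℝ) ≤ 𝓝[≠] 0)
  have hlt := hev.filter_mono (nhdsWithin_mono _ (fun x (hx : x < 0) => hx.ne) :
    𝓝[<] (0 : ℝ) ≤ 𝓝[≠] 0)
  by_cases h1 : Even κ
  · have hF0 : ∀ᶠ v in 𝓝 (0 : ℝ), F v = 0 := by
      refine hF.frequently_zero_iff_eventually_zero.1 (Frequently.filter_mono (f := 𝓝[<] 0)
        (Eventually.frequently ?_) (nhdsWithin_mono _ fun x (hx : x < 0) => hx.ne))
      filter_upwards [hlt, self_mem_nhdsWithin] with v h2 h3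
      have h3 : v < 0 := h3
      rw [← h2, universalSingularity_even h1, heaviside, if_neg h3.not_ge, mul_zero]
    obtain ⟨v, h2, h3, h4⟩ := (hgt.and (eventually_mem_nhdsWithin.and
      (nhdsWithin_le_nhds hF0))).exists
    have h3 : 0 < v := h3
    rw [universalSingularity_even h1, heaviside, if_pos h3.le, h4] at h2
    simp [(Real.rpow_pos_of_pos h3 _).ne'] at h2
  by_cases h2 : Even N
  · refine not_eventually_nhdsGT_log_mul_pow
      (H := fun v => (-1) ^ ((κ + 1) / 2) * Real.pi * F v) (analyticAt_const.mul hF)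
      ((N - 2) / 2) ?_
    filter_upwards [hgt, self_mem_nhdsWithin] with v h3 h4
    have h4 : 0 < v := h4
    rw [← h3, universalSingularity_log h1 h2, abs_of_pos h4]
    have h5 := neg_one_pow_mul_self ((κ + 1) / 2)
    have h6 := Real.pi_ne_zero
    have h7 := mul_inv_cancel₀ h6
    linear_combination (-(v ^ ((N - 2) / 2) * Real.log v)) *
      (h5 + (-1) ^ ((κ + 1) / 2) * (-1) ^ ((κ + 1) / 2) * h7)
  · have hF0 : ∀ᶠ v in 𝓝 (0 : ℝ), F v = 0 := by
      refine hF.frequently_zero_iff_eventually_zero.1 (Frequently.filter_mono (f := 𝓝[>] 0)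
        (Eventually.frequently ?_) (nhdsWithin_mono _ fun x (hx : 0 < x) => hx.ne'))
      filter_upwards [hgt, self_mem_nhdsWithin] with v h3 h4
      have h4 : 0 < v := h4
      rw [← h3, universalSingularity_odd h1 h2, heaviside, if_neg (by linarith), mul_zero]
    obtain ⟨v, h3, h4, h5⟩ := (hlt.and (eventually_mem_nhdsWithin.and
      (nhdsWithin_le_nhds hF0))).exists
    have h4 : 0 < -v := neg_pos.2 h4
    rw [universalSingularity_odd h1 h2, heaviside, if_pos h4.le, h5] at h3
    have h6 : (-1 : ℝ) ^ (((N : ℤ) - κ) / 2) ≠ 0 := zpow_ne_zero _ (by norm_num)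
    simp [(Real.rpow_pos_of_pos h4 _).ne', h6] at h3

theorem NonanalyticAtZero.add_mul {f g A B : ℝ → ℝ} (hg : NonanalyticAtZero g)
    (hA : AnalyticAt ℝ A 0) (hB : AnalyticAt ℝ B 0) (hB0 : B 0 ≠ 0)
    (h : ∀ᶠ v in 𝓝[≠] (0 : ℝ), f v = A v + B v * g v) : NonanalyticAtZero f := by
  intro F hF hev
  refine hg (fun v => (F v - A v) / B v) ((hF.sub hA).div hB hB0) ?_
  filter_upwards [h, hev, nhdsWithin_le_nhds (hB.continuousAt.eventually_ne hB0)] with v h1 h2 h3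
  rw [← h2, h1]
  field_simp
  ring

/-! ### The Hessian at a critical point -/

section Hessian

variable {N : ℕ} {F : Type*} [NormedAddCommGroup F] [NormedSpace ℝ F]

theorem fderiv_clm_apply_apply {E : Type*} [NormedAddCommGroup E] [NormedSpace ℝ E]
    {b : E → F →L[ℝ] F →L[ℝ] ℝ} {g : E → F} {q : E} (hb : DifferentiableAt ℝ b q)
    (hg : DifferentiableAt ℝ g q) (e : E) :
    fderiv ℝ (fun y => b y (g y) (g y)) q e =
      fderiv ℝ b q e (g q) (g q) + b q (fderiv ℝ g q e) (g q) + b q (g q) (fderiv ℝ g q e) := by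
  have h := ((hb.hasFDerivAt.clm_apply hg.hasFDerivAt).clm_apply hg.hasFDerivAt).fderiv
  rw [h]
  simp
  ring

/-- Since g vanishes at q, a second derivative of b(g, g) survives at q only when each copy of g is
differentiated once. This serves both the Morse chart (b constant) and Hadamard's form (g y = y -
q). -/
theorem hessian_eq_of_eventuallyEq [CompleteSpace F] {V : EuclideanSpace ℝ (Fin N) → ℝ}
    {q : EuclideanSpace ℝ (Fin N)} {b : EuclideanSpace ℝ (Fin N) → F →L[ℝ] F →L[ℝ] ℝ}
    {g : EuclideanSpace ℝ (Fin N) → F} (hb : AnalyticAt ℝ b q) (hg : AnalyticAt ℝ g q)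
    (hg0 : g q = 0) (hV : V =ᶠ[𝓝 q] fun y => b y (g y) (g y)) (i j : Fin N) :
    hessian V q i j =
      b q (fderiv ℝ g q (EuclideanSpace.single j 1)) (fderiv ℝ g q (EuclideanSpace.single i 1)) +
      b q (fderiv ℝ g q (EuclideanSpace.single i 1)) (fderiv ℝ g q (EuclideanSpace.single j 1)) := by
  rw [hessian, Matrix.of_apply]
  set e : EuclideanSpace ℝ (Fin N) := EuclideanSpace.single j 1
  set e' : EuclideanSpace ℝ (Fin N) := EuclideanSpace.single i 1
  have h1 : (fun y => fderiv ℝ V y e) =ᶠ[𝓝 q] fun y => fderiv ℝ b y e (g y) (g y) +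
      b y (fderiv ℝ g y e) (g y) + b y (g y) (fderiv ℝ g y e) := by
    filter_upwards [hV.eventuallyEq_nhds, hb.eventually_analyticAt, hg.eventually_analyticAt]
      with y h1 h2 h3
    rw [h1.fderiv_eq, fderiv_clm_apply_apply h2.differentiableAt h3.differentiableAt]
  rw [h1.fderiv_eq]
  have hbd := hb.differentiableAt.hasFDerivAt
  have hgd := hg.differentiableAt.hasFDerivAt
  have hb'd := (hb.fderiv.differentiableAt.hasFDerivAt).clm_apply (hasFDerivAt_const e q)
  have hg'd := (hg.fderiv.differentiableAt.hasFDerivAt).clm_apply (hasFDerivAt_const e q)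
  have h2 := (((hb'd.clm_apply hgd).clm_apply hgd).fun_add
    ((hbd.clm_apply hg'd).clm_apply hgd)).fun_add ((hbd.clm_apply hgd).clm_apply hg'd)
  rw [h2.fderiv]
  simp [hg0]

end Hessian

/-! ### The form in Morse coordinates -/

/-- The sign of the `i`-th square in `diagForm`. -/
noncomputable def diagSign (k : ℕ) {N : ℕ} (i : Fin N) : ℝ := if (i : ℕ) < k then -1 else 1

/-- The bilinear form of `diagForm`. -/
noncomputable def diagBilin (N k : ℕ) :
    EuclideanSpace ℝ (Fin N) →L[ℝ] EuclideanSpace ℝ (Fin N) →L[ℝ] ℝ :=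
  ∑ i : Fin N, diagSign k i •
    (EuclideanSpace.proj i : EuclideanSpace ℝ (Fin N) →L[ℝ] ℝ).smulRight
      (EuclideanSpace.proj i : EuclideanSpace ℝ (Fin N) →L[ℝ] ℝ)

theorem diagBilin_apply {N k : ℕ} (u w : EuclideanSpace ℝ (Fin N)) :
    diagBilin N k u w = ∑ i, diagSign k i * (u i * w i) := by
  simp [diagBilin]

theorem diagBilin_self {N k : ℕ} (u : EuclideanSpace ℝ (Fin N)) :
    diagBilin N k u u = diagForm N k u := by
  rw [diagBilin_apply, diagForm]
  refine Finset.sum_congr rfl fun i _ => ?_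
  rw [diagSign]
  split_ifs <;> ring

/-- In matrices, H/2 = Dᵀ diag(±1) D with D the derivative of g at q. -/
theorem abs_det_half_hessian {N k : ℕ} {V : EuclideanSpace ℝ (Fin N) → ℝ}
    {q : EuclideanSpace ℝ (Fin N)} {g : EuclideanSpace ℝ (Fin N) → EuclideanSpace ℝ (Fin N)}
    (hg : AnalyticAt ℝ g q) (hg0 : g q = 0) (hV : V =ᶠ[𝓝 q] fun y => diagForm N k (g y)) :
    |((2 : ℝ)⁻¹ • hessian V q).det| = (fderiv ℝ g q).det ^ 2 := by
  set D := LinearMap.toMatrix (EuclideanSpace.basisFun (Fin N) ℝ).toBasis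
    (EuclideanSpace.basisFun (Fin N) ℝ).toBasis (fderiv ℝ g q : _ →ₗ[ℝ] _) with hD
  have hDapp : ∀ i j, D i j = fderiv ℝ g q (EuclideanSpace.single j 1) i := by
    intro i j
    simp [hD, LinearMap.toMatrix_apply]
  have hdet : D.det = (fderiv ℝ g q).det := by
    rw [hD, LinearMap.det_toMatrix]
  have hmat : (2 : ℝ)⁻¹ • hessian V q = D.transpose * Matrix.diagonal (diagSign k) * D := by
    ext i j
    have h := hessian_eq_of_eventuallyEq (V := V) (b := fun _ => diagBilin N k) analyticAt_const
      hg hg0 (hV.trans (Eventually.of_forall fun y => (diagBilin_self _).symm)) i j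
    rw [Matrix.smul_apply, h, diagBilin_apply, diagBilin_apply, Matrix.mul_apply, smul_eq_mul,
      ← Finset.sum_add_distrib, Finset.mul_sum]
    refine Finset.sum_congr rfl fun l _ => ?_
    rw [Matrix.mul_diagonal, Matrix.transpose_apply, hDapp, hDapp]
    ring
  have hsign : |∏ i : Fin N, diagSign k i| = 1 := by
    rw [Finset.abs_prod]
    refine Finset.prod_eq_one fun i _ => ?_
    rw [diagSign]
    split_ifs <;> simp
  rw [hmat, Matrix.det_mul, Matrix.det_mul, Matrix.det_transpose, Matrix.det_diagonal, hdet,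
    mul_right_comm, abs_mul, hsign, mul_one, ← sq, abs_sq]

/-! ### Rescaling of the universal functions -/

/-- The step branches are homogeneous. In the logarithmic branch log|c v| = log c + log|v| leaves a
polynomial remainder. -/
theorem exists_universalSingularity_mul {N : ℕ} (hN : 0 < N) (κ : ℕ) {c : ℝ} (hc : 0 < c) :
    ∃ L : ℝ → ℝ, AnalyticAt ℝ L 0 ∧ ∀ v, v ≠ 0 → universalSingularity N κ (c * v) =
      c ^ (((N : ℝ) - 2) / 2) * universalSingularity N κ v + L v := by
  have hstep : ∀ v : ℝ, heaviside (c * v) = heaviside v := fun v => by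
    simp [heaviside, mul_nonneg_iff_of_pos_left hc]
  have hpow : ∀ v p : ℝ, (c * v) ^ p * heaviside v = c ^ p * (v ^ p * heaviside v) := by
    intro v p
    by_cases hv : 0 ≤ v
    · rw [Real.mul_rpow hc.le hv]
      ring
    · simp [heaviside, hv]
  by_cases h1 : Even κ
  · refine ⟨fun _ => 0, analyticAt_const, fun v _ => ?_⟩
    rw [universalSingularity_even h1, universalSingularity_even h1, hstep, mul_assoc, hpow]
    ring
  by_cases h2 : Even N
  · refine ⟨fun v => (-1) ^ ((κ + 1) / 2) * (c * v) ^ ((N - 2) / 2) *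
      (Real.pi⁻¹ * Real.log c), by fun_prop, fun v hv => ?_⟩
    have h3 : c ^ (((N : ℝ) - 2) / 2) = c ^ ((N - 2) / 2) := by
      obtain ⟨m, rfl⟩ := h2
      obtain ⟨m, rfl⟩ : ∃ l, m = l + 1 := ⟨m - 1, by omega⟩
      rw [← Real.rpow_natCast, show (m + 1 + (m + 1) - 2) / 2 = m by omega]
      congr 1
      push_cast
      ring
    rw [universalSingularity_log h1 h2, universalSingularity_log h1 h2, h3, abs_mul,
      Real.log_mul (abs_ne_zero.2 hc.ne') (abs_ne_zero.2 hv), abs_of_pos hc, mul_pow]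
    ring
  · refine ⟨fun _ => 0, analyticAt_const, fun v _ => ?_⟩
    rw [universalSingularity_odd h1 h2, universalSingularity_odd h1 h2, ← mul_neg, hstep, mul_assoc,
      hpow]
    ring

/-! ### Regions and their densities -/

/-- Volumes add over the two pieces as soon as U is measurable; Γ may be arbitrary. -/
theorem HasDensityAt.of_sdiff {N : ℕ} {V : EuclideanSpace ℝ (Fin N) → ℝ}
    {U Γ : Set (EuclideanSpace ℝ (Fin N))} (hU : MeasurableSet U) (hUΓ : U ⊆ Γ) {v ω ω' : ℝ}
    (h : HasDensityAt V U v ω) (h' : HasDensityAt V (Γ \ U) v ω') :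
    HasDensityAt V Γ v (ω + ω') := by
  refine ⟨add_nonneg h.1 h'.1, ?_⟩
  rw [ENNReal.ofReal_add h.1 h'.1]
  refine (h.2.add h'.2).congr fun ε => ?_
  rw [← ENNReal.add_div, ← measure_inter_add_sdiff {q | q ∈ Γ ∧ |V q - N * v| < ε} hU]
  congr 3
  · ext q
    exact ⟨fun hq => ⟨⟨hUΓ hq.1, hq.2⟩, hq.1⟩, fun hq => ⟨hq.2, hq.1.2⟩⟩
  · ext q
    exact ⟨fun hq => ⟨⟨hq.1.1, hq.2⟩, hq.1.2⟩, fun hq => ⟨⟨hq.1.1, hq.2⟩, hq.1.2⟩⟩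

theorem IsLeadingNonanalyticity.nonanalyticAtZero {f g : ℝ → ℝ}
    (h : IsLeadingNonanalyticity f g) (hg : NonanalyticAtZero g) : NonanalyticAtZero f := by
  obtain ⟨A, B, hA, hB, hB0, h⟩ := h
  exact hg.add_mul hA hB (by simp [hB0]) h

theorem HasSingularDensity.of_sdiff {N : ℕ} {V : EuclideanSpace ℝ (Fin N) → ℝ}
    {U Γ : Set (EuclideanSpace ℝ (Fin N))} {g : ℝ → ℝ} (hU : MeasurableSet U) (hUΓ : U ⊆ Γ)
    (hg : NonanalyticAtZero g) (h : HasSingularDensity V U g)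
    (h' : HasAnalyticDensity V (Γ \ U)) : HasSingularDensity V Γ g := by
  obtain ⟨Ω, hΩ, -, A, B, hA, hB, hB0, hAB⟩ := h
  obtain ⟨R, hR, hRd⟩ := h'
  have hlead : IsLeadingNonanalyticity (fun v => Ω v + R v) g := by
    refine ⟨fun v => A v + R v, B, hA.add hR, hB, hB0, ?_⟩
    filter_upwards [hAB] with v hv
    rw [hv]
    ring
  refine ⟨fun v => Ω v + R v, ?_, hlead.nonanalyticAtZero hg, hlead⟩
  filter_upwards [hΩ, hRd] with v h1 h2
  exact h1.of_sdiff hU hUΓ h2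

theorem nonanalyticAtZero_const_mul {g : ℝ → ℝ} (hg : NonanalyticAtZero g) {c : ℝ} (hc : c ≠ 0) :
    NonanalyticAtZero fun v => c * g v :=
  hg.add_mul (A := fun _ => 0) (B := fun _ => c) analyticAt_const analyticAt_const hc
    (Eventually.of_forall fun v => by simp)

theorem morseIndex_le {N : ℕ} (V : EuclideanSpace ℝ (Fin N) → ℝ) (q : EuclideanSpace ℝ (Fin N)) :
    morseIndex V q ≤ N := by
  rw [morseIndex]
  refine (Multiset.card_le_card (Multiset.filter_le _ _)).trans ?_
  refine (Polynomial.card_roots' _).trans ?_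
  rw [Matrix.charpoly_natDegree_eq_dim, Fintype.card_fin]

/-! ### The Jacobian of Morse coordinates -/

/-- The Leibniz formula exhibits the determinant as a polynomial in the entries, hence as analytic.
-/
theorem det_eq_sum {N : ℕ} (A : EuclideanSpace ℝ (Fin N) →L[ℝ] EuclideanSpace ℝ (Fin N)) :
    A.det = ∑ σ : Equiv.Perm (Fin N), ((Equiv.Perm.sign σ : ℤ) : ℝ) *
      ∏ i, A (EuclideanSpace.single i 1) (σ i) := by
  have h : A.det = (LinearMap.toMatrix (EuclideanSpace.basisFun (Fin N) ℝ).toBasis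
    (EuclideanSpace.basisFun (Fin N) ℝ).toBasis (A : _ →ₗ[ℝ] _)).det := by
    rw [LinearMap.det_toMatrix]
  rw [h, Matrix.det_apply']
  simp [LinearMap.toMatrix_apply]

theorem analyticAt_det {N : ℕ} {X : Type*} [NormedAddCommGroup X] [NormedSpace ℝ X]
    {A : X → EuclideanSpace ℝ (Fin N) →L[ℝ] EuclideanSpace ℝ (Fin N)} {x : X}
    (hA : AnalyticAt ℝ A x) : AnalyticAt ℝ (fun y => (A y).det) x := by
  simp only [det_eq_sum]
  refine Finset.analyticAt_fun_sum _ fun σ _ => analyticAt_const.mul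
    (Finset.analyticAt_fun_prod _ fun i _ => ?_)
  exact (((EuclideanSpace.proj (σ i) : EuclideanSpace ℝ (Fin N) →L[ℝ] ℝ).comp
    (ContinuousLinearMap.apply ℝ _ (EuclideanSpace.single i 1))).analyticAt _).comp hA

theorem analyticAt_abs {X : Type*} [NormedAddCommGroup X] [NormedSpace ℝ X] {f : X → ℝ} {x : X}
    (hf : AnalyticAt ℝ f x) (h0 : f x ≠ 0) : AnalyticAt ℝ (fun y => |f y|) x := by
  rcases lt_or_gt_of_ne h0 with h | h
  · refine hf.neg.congr ?_
    filter_upwards [hf.continuousAt.eventually (gt_mem_nhds h)] with y hy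
    exact (abs_of_neg hy).symm
  · refine hf.congr ?_
    filter_upwards [hf.continuousAt.eventually (lt_mem_nhds h)] with y hy
    exact (abs_of_pos hy).symm

section Chart

variable {N k : ℕ} {V : EuclideanSpace ℝ (Fin N) → ℝ} {G : Set (EuclideanSpace ℝ (Fin N))}
  {q : EuclideanSpace ℝ (Fin N)}
  {φ : OpenPartialHomeomorph (EuclideanSpace ℝ (Fin N)) (EuclideanSpace ℝ (Fin N))}

theorem IsMorseChart.zero_mem_target (h : IsMorseChart V G q k φ) :
    (0 : EuclideanSpace ℝ (Fin N)) ∈ φ.target := by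
  rw [← h.map_center]
  exact φ.map_source h.mem_source

theorem IsMorseChart.symm_zero (h : IsMorseChart V G q k φ) : φ.symm 0 = q := by
  rw [← h.map_center]
  exact φ.left_inv h.mem_source

theorem IsMorseChart.det_mul_det (h : IsMorseChart V G q k φ) :
    (fderiv ℝ φ q).det * (fderiv ℝ φ.symm 0).det = 1 := by
  have h1 := (h.analytic q h.mem_source).differentiableAt.hasFDerivAt
  have h2 := (h.analytic_symm 0 h.zero_mem_target).differentiableAt.hasFDerivAt
  have h3 : HasFDerivAt (φ ∘ φ.symm) ((fderiv ℝ φ q).comp (fderiv ℝ φ.symm 0)) 0 := by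
    refine HasFDerivAt.comp (g := φ) 0 ?_ h2
    rwa [h.symm_zero]
  have h4 : φ ∘ φ.symm =ᶠ[𝓝 0] id := by
    filter_upwards [φ.open_target.mem_nhds h.zero_mem_target] with x hx
    exact φ.right_inv hx
  have h5 := h3.unique ((hasFDerivAt_id _).congr_of_eventuallyEq h4)
  have h6 := congrArg (fun A : EuclideanSpace ℝ (Fin N) →L[ℝ] EuclideanSpace ℝ (Fin N) =>
    LinearMap.det (A : EuclideanSpace ℝ (Fin N) →ₗ[ℝ] EuclideanSpace ℝ (Fin N))) h5
  simpa [ContinuousLinearMap.det, LinearMap.det_comp] using h6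

theorem IsMorseChart.abs_det_symm (h : IsMorseChart V G q k φ) :
    |(fderiv ℝ φ.symm 0).det| = (√|((2 : ℝ)⁻¹ • hessian V q).det|)⁻¹ := by
  have hV : V =ᶠ[𝓝 q] fun y => diagForm N k (φ y) := by
    filter_upwards [φ.open_source.mem_nhds h.mem_source] with y hy
    have := h.normal_form (φ y) (φ.map_source hy)
    rwa [φ.left_inv hy] at this
  rw [abs_det_half_hessian (h.analytic q h.mem_source) h.map_center hV, Real.sqrt_sq_eq_abs,
    ← abs_inv]
  congr 1
  exact eq_inv_of_mul_eq_one_right h.det_mul_det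

theorem IsMorseChart.volume_eq (h : IsMorseChart V G q k φ) {r : ℝ}
    (hr : Metric.ball 0 r ⊆ φ.target) (E ε : ℝ) :
    volume {y | y ∈ φ.symm '' Metric.ball 0 r ∧ |V y - E| < ε} =
      ∫⁻ x in Metric.ball 0 r ∩ diagForm N k ⁻¹' Ioo (E - ε) (E + ε),
        ENNReal.ofReal |(fderiv ℝ φ.symm x).det| := by
  have hset : {y | y ∈ φ.symm '' Metric.ball 0 r ∧ |V y - E| < ε} =
      φ.symm '' (Metric.ball 0 r ∩ diagForm N k ⁻¹' Ioo (E - ε) (E + ε)) := by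
    have hiff : ∀ x ∈ Metric.ball 0 r,
        |V (φ.symm x) - E| < ε ↔ diagForm N k x ∈ Ioo (E - ε) (E + ε) := by
      intro x hx
      rw [h.normal_form x (hr hx), abs_sub_lt_iff, mem_Ioo, diagForm]
      constructor <;> rintro ⟨h1, h2⟩ <;> constructor <;> linarith
    ext y
    constructor
    · rintro ⟨⟨x, hx, rfl⟩, hy⟩
      exact ⟨x, ⟨hx, (hiff x hx).1 hy⟩, rfl⟩
    · rintro ⟨x, ⟨hx, hx'⟩, rfl⟩
      exact ⟨⟨x, hx, rfl⟩, (hiff x hx).2 hx'⟩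
  have hcont : Continuous (diagForm N k) := by
    unfold diagForm
    refine continuous_finsetSum _ fun i _ => ?_
    split_ifs <;> fun_prop
  rw [hset, lintegral_abs_det_fderiv_eq_addHaar_image volume
    (Metric.isOpen_ball.measurableSet.inter (hcont.measurable measurableSet_Ioo))
    (fun x hx => (h.analytic_symm x (hr hx.1)).differentiableAt.hasFDerivAt.hasFDerivWithinAt)
    (φ.symm.injOn.mono (inter_subset_left.trans hr))]

theorem nonanalyticAtZero_leadingTerm (hN : 0 < N) (hdet : (hessian V q).det ≠ 0) (k : ℕ) :
    NonanalyticAtZero (leadingTerm V q k) := by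
  have hN' : (0 : ℝ) < N := by exact_mod_cast hN
  have h1 : 0 < |((2 : ℝ)⁻¹ • hessian V q).det| := by
    rw [abs_pos, Matrix.det_smul]
    exact mul_ne_zero (by positivity) hdet
  have h2 := Real.Gamma_pos_of_pos (half_pos hN')
  have h3 := Real.pi_pos
  exact nonanalyticAtZero_const_mul (nonanalyticAtZero_universalSingularity N (k % 4))
    (by positivity)

/-- Change of variables turns the volumes into integrals of the Jacobian of `φ.symm`, which is
analytic near 0 because its determinant does not vanish there. -/
theorem IsMorseChart.exists_hasSingularDensity (h : IsMorseChart V G q k φ) (hN : 0 < N)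
    (hk : k ≤ N) (hdet : (hessian V q).det ≠ 0) :
    ∃ r₀ > 0, Metric.closedBall 0 r₀ ⊆ φ.target ∧ ∀ r, 0 < r → r < r₀ →
      HasSingularDensity V (φ.symm '' Metric.ball 0 r) (leadingTerm V q k) := by
  have hN' : (0 : ℝ) < N := by exact_mod_cast hN
  have hJdet : (fderiv ℝ φ.symm 0).det ≠ 0 := right_ne_zero_of_mul_eq_one h.det_mul_det
  have hJa : AnalyticAt ℝ (fun x => |(fderiv ℝ φ.symm x).det|) 0 :=
    analyticAt_abs (analyticAt_det (h.analytic_symm 0 h.zero_mem_target).fderiv) hJdet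
  have hJm : Measurable fun x => |(fderiv ℝ φ.symm x).det| :=
    (ContinuousLinearMap.continuous_det.measurable.comp (measurable_fderiv ℝ φ.symm)).abs
  obtain ⟨r₁, hr₁, hpush⟩ := hasSingularPush_diagForm hN hk hJm hJa (abs_pos.2 hJdet)
  obtain ⟨ρ, hρ, hρt⟩ := Metric.nhds_basis_closedBall.mem_iff.1
    (φ.open_target.mem_nhds h.zero_mem_target)
  refine ⟨min r₁ ρ, lt_min hr₁ hρ, (Metric.closedBall_subset_closedBall (min_le_right _ _)).trans
    hρt, fun r hr hr' => ?_⟩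
  have hrt : Metric.ball 0 r ⊆ φ.target := (Metric.ball_subset_ball
    (hr'.le.trans (min_le_right _ _))).trans (Metric.ball_subset_closedBall.trans hρt)
  obtain ⟨I, A, B, hA, hB, hB0, hI⟩ := (hpush r hr (hr'.trans_le (min_le_left _ _))).exists_density
  obtain ⟨L, hL, hLmul⟩ := exists_universalSingularity_mul hN (k % 4) hN'
  have hscale : AnalyticAt ℝ (fun v : ℝ => (N : ℝ) * v) 0 := by fun_prop
  have hAs : AnalyticAt ℝ (fun v => A (N * v)) 0 := hA.fun_comp_of_eq hscale (mul_zero _)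
  have hBs : AnalyticAt ℝ (fun v => B (N * v)) 0 := hB.fun_comp_of_eq hscale (mul_zero _)
  have hev : ∀ᶠ v in 𝓝[≠] (0 : ℝ), (0 ≤ I (N * v) ∧
      I (N * v) = A (N * v) + B (N * v) * universalSingularity N (k % 4) (N * v) ∧
      Tendsto (fun ε : ℝ => (∫⁻ x in Metric.ball 0 r ∩
        diagForm N k ⁻¹' Ioo (N * v - ε) (N * v + ε), ENNReal.ofReal |(fderiv ℝ φ.symm x).det|) /
        ENNReal.ofReal (2 * ε)) (𝓝[>] 0) (𝓝 (ENNReal.ofReal (I (N * v))))) := by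
    have ht : Tendsto (fun v : ℝ => (N : ℝ) * v) (𝓝[≠] 0) (𝓝[≠] 0) := by
      refine tendsto_nhdsWithin_iff.2 ⟨?_, ?_⟩
      · have := hscale.continuousAt.tendsto.mono_left (nhdsWithin_le_nhds (s := {0}ᶜ))
        simpa using this
      · filter_upwards [self_mem_nhdsWithin] with v hv
        exact mul_ne_zero hN'.ne' hv
    exact ht.eventually hI
  set K := (N * Real.pi) ^ ((N : ℝ) / 2) /
      (N * Real.Gamma ((N : ℝ) / 2) * √|((2 : ℝ)⁻¹ • hessian V q).det|) with hK
  have hdet' : 0 < |((2 : ℝ)⁻¹ • hessian V q).det| := by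
    rw [abs_pos, Matrix.det_smul]
    exact mul_ne_zero (by positivity) hdet
  have hΓ := Real.Gamma_pos_of_pos (half_pos hN')
  have hπ := Real.pi_pos
  have hK0 : K ≠ 0 := by positivity
  -- The prefactor: N^((N-2)/2) from the rescaling equals N^(N/2)/N, and B 0 is the Jacobian at 0
  -- times π^(N/2)/Γ(N/2).
  have hBK : B 0 * (N : ℝ) ^ (((N : ℝ) - 2) / 2) = K := by
    rw [hB0, h.abs_det_symm, hK, Real.mul_rpow hN'.le hπ.le,
      show ((N : ℝ) - 2) / 2 = (N : ℝ) / 2 - 1 by ring, Real.rpow_sub_one hN'.ne']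
    field_simp
  have hlead : IsLeadingNonanalyticity (fun v => I (N * v)) (leadingTerm V q k) := by
    -- The remainder L of the rescaling is analytic and joins A; division by K normalises the factor
    -- to 1 at 0.
    refine ⟨fun v => A (N * v) + B (N * v) * L v,
      fun v => B (N * v) * (N : ℝ) ^ (((N : ℝ) - 2) / 2) / K, hAs.add (hBs.mul hL),
      (hBs.mul analyticAt_const).div_const, ?_, ?_⟩
    · simp only [mul_zero]
      rw [hBK, div_self hK0]
    · filter_upwards [hev, self_mem_nhdsWithin] with v hv hv0
      rw [hv.2.1, hLmul v hv0, leadingTerm, ← hK]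
      field_simp
      ring
  refine ⟨fun v => I (N * v), ?_,
    hlead.nonanalyticAtZero (nonanalyticAtZero_leadingTerm hN hdet k), hlead⟩
  filter_upwards [hev] with v hv
  refine ⟨hv.1, hv.2.2.congr fun ε => ?_⟩
  rw [h.volume_eq hrt]

end Chart

/-! ### The analytic Morse lemma -/

section Morse

variable {E F : Type*} [NormedAddCommGroup E] [NormedSpace ℝ E] [NormedAddCommGroup F]
  [NormedSpace ℝ F]

theorem analyticAt_clm_apply {X : Type*} [NormedAddCommGroup X] [NormedSpace ℝ X]
    {A : X → E →L[ℝ] F} {g : X → E} {x : X} (hA : AnalyticAt ℝ A x) (hg : AnalyticAt ℝ g x) :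
    AnalyticAt ℝ (fun y => A y (g y)) x :=
  ((ContinuousLinearMap.id ℝ (E →L[ℝ] F)).analyticAt_bilinear (A x, g x)).comp₂ hA hg

/-- The analytic version of Hadamard's lemma. -/
theorem exists_analyticAt_apply_sub [CompleteSpace F] {f : E → F} {q : E} (hf : AnalyticAt ℝ f q) :
    ∃ h : E → E →L[ℝ] F, AnalyticAt ℝ h q ∧ h q = fderiv ℝ f q ∧
      ∀ᶠ y in 𝓝 q, f y = f q + h y (y - q) := by
  -- The factor h is the sum of the shifted series: each term of degree n + 1 gives up one argument
  -- y - q.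
  obtain ⟨p, r, hp⟩ := id hf
  have hrad : r ≤ p.shift.radius := by
    rw [FormalMultilinearSeries.radius_shift]
    exact hp.r_le
  have hS : HasFPowerSeriesOnBall p.shift.sum p.shift 0 p.shift.radius :=
    p.shift.hasFPowerSeriesOnBall (hp.r_pos.trans_le hrad)
  have han : AnalyticAt ℝ (fun y => p.shift.sum (y - q)) q :=
    hS.analyticAt.fun_comp_of_eq (by fun_prop) (sub_self q)
  have hev : ∀ᶠ y in 𝓝 q, f y = f q + p.shift.sum (y - q) (y - q) := by
    filter_upwards [Metric.eball_mem_nhds q hp.r_pos] with y hy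
    have hy' : y - q ∈ Metric.eball (0 : E) r := by
      simpa [edist_eq_enorm_sub] using hy
    have h1 := hp.hasSum hy'
    have h2 := hS.hasSum (Metric.eball_subset_eball hrad hy')
    rw [zero_add] at h2
    have h3 := (ContinuousLinearMap.apply ℝ F (y - q)).hasSum h2
    have h4 : ∀ n, ContinuousLinearMap.apply ℝ F (y - q) (p.shift n fun _ => y - q) =
        p (n + 1) fun _ => y - q := by
      intro n
      rw [ContinuousLinearMap.apply_apply, FormalMultilinearSeries.shift,
        ContinuousMultilinearMap.curryRight_apply]
      congr 1
      funext i
      refine Fin.lastCases ?_ (fun i => ?_) i <;> simp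
    simp only [h4] at h3
    have h5 := (hasSum_nat_add_iff (f := fun n => p n fun _ => y - q) 1).1 h3
    have h6 := h1.unique h5
    rw [add_sub_cancel] at h6
    rw [h6, Finset.sum_range_one, hp.coeff_zero, add_comm]
    rfl
  refine ⟨_, han, ?_, hev⟩
  have hd := (han.differentiableAt.hasFDerivAt.clm_apply
    ((hasFDerivAt_id q).sub_const q)).const_add (f q)
  have := (hd.congr_of_eventuallyEq hev).fderiv
  rw [this]
  ext u
  simp

/-- Hadamard's lemma for f, then for the factor it yields, whose value at q is the derivative of f
and vanishes. Symmetrising does not change the quadratic form. -/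
theorem exists_symmetric_form {f : E → ℝ} {q : E} (hf : AnalyticAt ℝ f q) (hf0 : f q = 0)
    (hf' : fderiv ℝ f q = 0) :
    ∃ b : E → E →L[ℝ] E →L[ℝ] ℝ, AnalyticAt ℝ b q ∧ (∀ y u w, b y u w = b y w u) ∧
      ∀ᶠ y in 𝓝 q, f y = b y (y - q) (y - q) := by
  obtain ⟨h, hh, hhq, hev⟩ := exists_analyticAt_apply_sub hf
  obtain ⟨b, hb, -, hev'⟩ := exists_analyticAt_apply_sub hh
  let Φ : (E →L[ℝ] E →L[ℝ] ℝ) →L[ℝ] E →L[ℝ] E →L[ℝ] ℝ :=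
    (ContinuousLinearMap.flipₗᵢ ℝ E E ℝ).toContinuousLinearEquiv.toContinuousLinearMap
  have hΦ := ContinuousLinearMap.analyticAt (𝕜 := ℝ) (E := E →L[ℝ] E →L[ℝ] ℝ)
    (F := E →L[ℝ] E →L[ℝ] ℝ) Φ (b q)
  have hflip : AnalyticAt ℝ (fun y => (b y).flip) q := hΦ.comp hb
  refine ⟨fun y => (2 : ℝ)⁻¹ • (b y + (b y).flip), (hb.fun_add hflip).fun_const_smul,
    fun y u w => ?_, ?_⟩
  · simp [add_comm]
  · filter_upwards [hev, hev'] with y h1 h2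
    rw [h1, h2, hf0, hhq, hf']
    simp
    ring

/-- The adjoint of an operator with respect to a bilinear form. -/
noncomputable def formAdjoint (e : E ≃L[ℝ] (E →L[ℝ] ℝ)) (A : E →L[ℝ] E) : E →L[ℝ] E :=
  e.symm.toContinuousLinearMap.comp
    (((ContinuousLinearMap.compL ℝ E E ℝ).flip A).comp e.toContinuousLinearMap)

theorem apply_formAdjoint (e : E ≃L[ℝ] (E →L[ℝ] ℝ)) (A : E →L[ℝ] E) (u w : E) :
    e (formAdjoint e A u) w = e u (A w) := by
  simp [formAdjoint]

theorem continuous_formAdjoint (e : E ≃L[ℝ] (E →L[ℝ] ℝ)) : Continuous (formAdjoint e) := by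
  unfold formAdjoint
  exact continuous_const.clm_comp
    (((ContinuousLinearMap.compL ℝ E E ℝ).flip.continuous).clm_comp continuous_const)

theorem formAdjoint_eq (e : E ≃L[ℝ] (E →L[ℝ] ℝ)) {A B : E →L[ℝ] E}
    (h : ∀ u w, e (B u) w = e u (A w)) : formAdjoint e A = B := by
  ext u
  refine e.injective ?_
  ext w
  rw [apply_formAdjoint, h]

theorem formAdjoint_one (e : E ≃L[ℝ] (E →L[ℝ] ℝ)) : formAdjoint e 1 = 1 :=
  formAdjoint_eq e fun _ _ => rfl

theorem formAdjoint_mul (e : E ≃L[ℝ] (E →L[ℝ] ℝ)) (A B : E →L[ℝ] E) :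
    formAdjoint e (A * B) = formAdjoint e B * formAdjoint e A := by
  refine formAdjoint_eq e fun u w => ?_
  rw [mul_apply_eq_comp, apply_formAdjoint, apply_formAdjoint,
    mul_apply_eq_comp]

/-- An analytic square root near `1` in a Banach algebra, unique near `1`. -/
theorem exists_analyticAt_sqrt (R : Type*) [NormedRing R] [NormedAlgebra ℝ R] [CompleteSpace R] :
    ∃ s : R → R, AnalyticAt ℝ s 1 ∧ s 1 = 1 ∧ (∀ᶠ a in 𝓝 (1 : R), s a * s a = a) ∧
      ∀ᶠ a in 𝓝 (1 : R), s (a * a) = a := by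
  -- Squaring has derivative a ↦ 2a at 1, which is invertible, so the analytic inverse function
  -- theorem applies.
  let i : R ≃L[ℝ] R := ContinuousLinearEquiv.smulLeft (Units.mk0 (2 : ℝ) two_ne_zero)
  have hd : HasStrictFDerivAt (fun a : R => a * a) (i : R →L[ℝ] R) 1 := by
    have h := hasStrictFDerivAt_id (𝕜 := ℝ) (1 : R)
    refine (h.mul' h).congr_fderiv ?_
    ext a
    simp [i, two_smul, Units.smul_def]
  have han : AnalyticAt ℝ (fun a : R => a * a) 1 := analyticAt_id.mul analyticAt_id
  refine ⟨hd.localInverse, ?_, ?_, ?_, hd.eventually_left_inverse⟩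
  · have := (hd.toOpenPartialHomeomorph _).analyticAt_symm' (i := i)
      hd.mem_toOpenPartialHomeomorph_source han hd.hasFDerivAt.fderiv
    rwa [HasStrictFDerivAt.toOpenPartialHomeomorph_coe, one_mul] at this
  · simpa using hd.localInverse_apply_image
  · simpa using hd.eventually_right_inverse

/-- C(y) = b_q⁻¹ b_y is self-adjoint for b_q and equals 1 at q. If S is its square root near 1, then
S is self-adjoint too, whence b_y(u, u) = b_q(S S u, u) = b_q(S u, S u). -/
theorem exists_analyticAt_straightening [CompleteSpace E] {b : E → E →L[ℝ] E →L[ℝ] ℝ} {q : E}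
    (hb : AnalyticAt ℝ b q) (hsymm : ∀ y u w, b y u w = b y w u) (e : E ≃L[ℝ] (E →L[ℝ] ℝ))
    (he : ∀ u, e u = b q u) :
    ∃ g : E → E, AnalyticAt ℝ g q ∧ g q = 0 ∧ fderiv ℝ g q = ContinuousLinearMap.id ℝ E ∧
      ∀ᶠ y in 𝓝 q, b y (y - q) (y - q) = b q (g y) (g y) := by
  obtain ⟨s, hs, hs1, hsq, huniq⟩ := exists_analyticAt_sqrt (E →L[ℝ] E)
  set C : E → E →L[ℝ] E := fun y => e.symm.toContinuousLinearMap.comp (b y) with hC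
  let Φ : (E →L[ℝ] E →L[ℝ] ℝ) →L[ℝ] E →L[ℝ] E :=
    ContinuousLinearMap.compL ℝ E (E →L[ℝ] ℝ) E e.symm.toContinuousLinearMap
  have hΦ := ContinuousLinearMap.analyticAt (𝕜 := ℝ) (E := E →L[ℝ] E →L[ℝ] ℝ)
    (F := E →L[ℝ] E) Φ (b q)
  have hCan : AnalyticAt ℝ C q := hΦ.comp hb
  have hCq : C q = 1 := by
    ext u
    simp [hC, ← he]
  have heC : ∀ y u w, e (C y u) w = b y u w := by
    intro y u w
    simp [hC]
  have hadj : ∀ y, formAdjoint e (C y) = C y := by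
    refine fun y => formAdjoint_eq e fun u w => ?_
    rw [heC, he, hsymm q, ← he, heC, hsymm]
  have hsC : AnalyticAt ℝ (fun y => s (C y)) q := hs.fun_comp_of_eq hCan hCq
  have hsCq : s (C q) = 1 := by rw [hCq, hs1]
  have hCt : Tendsto C (𝓝 q) (𝓝 1) := hCq ▸ hCan.continuousAt.tendsto
  have hsCt : Tendsto (fun y => s (C y)) (𝓝 q) (𝓝 1) := by
    have := hsC.continuousAt.tendsto
    rwa [hsCq] at this
  have hadjt : Tendsto (fun y => formAdjoint e (s (C y))) (𝓝 q) (𝓝 1) := by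
    have := ((continuous_formAdjoint e).tendsto 1).comp hsCt
    rwa [formAdjoint_one] at this
  have hgan : AnalyticAt ℝ (fun y => s (C y) (y - q)) q :=
    analyticAt_clm_apply hsC (by fun_prop)
  refine ⟨fun y => s (C y) (y - q), hgan, by simp, ?_, ?_⟩
  · have hd := hsC.differentiableAt.hasFDerivAt.clm_apply ((hasFDerivAt_id q).sub_const q)
    refine hd.fderiv.trans ?_
    rw [hsCq]
    ext u
    simp
  · filter_upwards [hCt.eventually hsq, hadjt.eventually huniq] with y h1 h2
    -- The adjoint of S also squares to C and is close to 1, so it equals S by local uniqueness.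
    have h3 : formAdjoint e (s (C y)) = s (C y) := by
      rw [← formAdjoint_mul, h1, hadj] at h2
      exact h2.symm
    rw [← he, ← apply_formAdjoint, h3, ← mul_apply_eq_comp, h1, heC]

end Morse

/-! ### Existence of Morse coordinates -/

section Diagonal

variable {N : ℕ}

theorem bilin_apply_eq_sum (β : EuclideanSpace ℝ (Fin N) →L[ℝ] EuclideanSpace ℝ (Fin N) →L[ℝ] ℝ)
    (u w : EuclideanSpace ℝ (Fin N)) :
    β u w = ∑ i, u i * ∑ j, β (EuclideanSpace.single i 1) (EuclideanSpace.single j 1) * w j := by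
  conv_lhs => rw [← (EuclideanSpace.basisFun (Fin N) ℝ).sum_repr u,
    ← (EuclideanSpace.basisFun (Fin N) ℝ).sum_repr w]
  simp only [map_sum, map_smul, sum_apply, smul_apply, smul_eq_mul, Finset.mul_sum,
    EuclideanSpace.basisFun_repr, EuclideanSpace.basisFun_apply]
  rw [Finset.sum_comm]
  refine Finset.sum_congr rfl fun i _ => Finset.sum_congr rfl fun j _ => ?_
  ring

theorem card_filter_roots_charpoly {H : Matrix (Fin N) (Fin N) ℝ} (hH : H.IsHermitian) :
    Multiset.card (H.charpoly.roots.filter fun μ => μ < 0) =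
      Fintype.card {i // hH.eigenvalues i < 0} := by
  rw [hH.roots_charpoly_eq_eigenvalues, Multiset.filter_map, Multiset.card_map,
    Fintype.card_subtype]
  rfl

theorem exists_perm_lt_iff {p : Fin N → Prop} [DecidablePred p] {k : ℕ}
    (hk : Fintype.card {i // p i} = k) :
    ∃ σ : Equiv.Perm (Fin N), ∀ i : Fin N, (i : ℕ) < k ↔ p (σ i) := by
  have hkN : k ≤ N := by
    rw [← hk]
    simpa using Fintype.card_subtype_le p
  have hcard : Fintype.card {i : Fin N // (i : ℕ) < k} = Fintype.card {i // p i} := by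
    rw [hk, Fintype.card_subtype, Fin.card_filter_val_lt, min_eq_right hkN]
  let e := Fintype.equivOfCardEq hcard
  refine ⟨e.extendSubtype, fun i => ⟨fun hi => e.extendSubtype_mem i hi, fun hi => ?_⟩⟩
  by_contra h
  exact e.extendSubtype_not_mem i h hi

/-- Spectral theorem for the Hessian, which is twice the form: in an eigenbasis β is Σ (μ_a/2) u_a².
A permutation puts the negative eigenvalues first, as `diagForm` requires. As no eigenvalue is 0, β
also identifies the space with its dual. -/
theorem exists_diagonalizing_equiv
    {β : EuclideanSpace ℝ (Fin N) →L[ℝ] EuclideanSpace ℝ (Fin N) →L[ℝ] ℝ}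
    {H : Matrix (Fin N) (Fin N) ℝ} (hH : H.IsHermitian) (hdet : H.det ≠ 0)
    (hβ : ∀ i j, H i j = 2 * β (EuclideanSpace.single i 1) (EuclideanSpace.single j 1)) {k : ℕ}
    (hk : Multiset.card (H.charpoly.roots.filter fun μ => μ < 0) = k) :
    (∃ L : EuclideanSpace ℝ (Fin N) ≃L[ℝ] EuclideanSpace ℝ (Fin N),
      ∀ u, β u u = diagForm N k (L u)) ∧
    ∃ e : EuclideanSpace ℝ (Fin N) ≃L[ℝ] (EuclideanSpace ℝ (Fin N) →L[ℝ] ℝ),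
      ∀ u, e u = β u := by
  set v := hH.eigenvectorBasis with hv
  set μ := hH.eigenvalues with hμ
  have hμ0 : ∀ i, μ i ≠ 0 := by
    have := hH.det_eq_prod_eigenvalues
    rw [this] at hdet
    intro i
    have := Finset.prod_ne_zero_iff.1 hdet i (Finset.mem_univ i)
    simpa using this
  have hβv : ∀ u a, β u (v a) = μ a / 2 * v.repr u a := by
    intro u a
    have h1 : ∀ i, ∑ j, H i j * v a j = μ a * v a i := by
      intro i
      have := congrFun (hH.mulVec_eigenvectorBasis a) i
      simpa [Matrix.mulVec, dotProduct] using this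
    have h2 : v.repr u a = ∑ i, u i * v a i := by
      rw [v.repr_apply_apply, PiLp.inner_apply]
      simp
    rw [bilin_apply_eq_sum, h2, Finset.mul_sum]
    refine Finset.sum_congr rfl fun i _ => ?_
    have h3 := h1 i
    simp only [hβ, mul_assoc, ← Finset.mul_sum] at h3
    linear_combination (u i / 2) * h3
  have hββ : ∀ u, β u u = ∑ a, μ a / 2 * v.repr u a ^ 2 := by
    intro u
    conv_lhs => enter [2]; rw [← v.sum_repr u]
    rw [map_sum]
    refine Finset.sum_congr rfl fun a _ => ?_
    rw [map_smul, hβv, smul_eq_mul]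
    ring
  have hzero : ∀ u, (∀ a, v.repr u a = 0) → u = 0 := by
    intro u hu
    refine v.repr.injective ?_
    ext a
    rw [hu a]
    simp
  refine ⟨?_, ?_⟩
  · rw [card_filter_roots_charpoly hH] at hk
    obtain ⟨σ, hσ⟩ := exists_perm_lt_iff hk
    -- The factor √(|μ|/2) rescales the coefficient μ/2 to ±1.
    let l : EuclideanSpace ℝ (Fin N) →ₗ[ℝ] EuclideanSpace ℝ (Fin N) :=
      { toFun := fun u => WithLp.toLp 2 fun i => √(|μ (σ i)| / 2) * v.repr u (σ i)
        map_add' := fun u w => by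
          ext i
          simp [mul_add]
        map_smul' := fun c u => by
          ext i
          simp [mul_left_comm] }
    have hl : ∀ u i, l u i = √(|μ (σ i)| / 2) * v.repr u (σ i) := fun _ _ => rfl
    have hinj : Function.Injective l := by
      refine (injective_iff_map_eq_zero l).2 fun u hu => hzero u fun a => ?_
      have h1 := hl u (σ.symm a)
      rw [hu, σ.apply_symm_apply] at h1
      have h2 : 0 < √(|μ a| / 2) := Real.sqrt_pos.2 (half_pos (abs_pos.2 (hμ0 a)))
      have h3 : √(|μ a| / 2) * v.repr u a = 0 := by simpa using h1.symm
      exact (mul_eq_zero.1 h3).resolve_left h2.ne'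
    refine ⟨(LinearEquiv.ofInjectiveEndo l hinj).toContinuousLinearEquiv, fun u => ?_⟩
    have h1 : ∀ i, (LinearEquiv.ofInjectiveEndo l hinj).toContinuousLinearEquiv u i =
      √(|μ (σ i)| / 2) * v.repr u (σ i) := fun _ => rfl
    rw [hββ, diagForm, ← Equiv.sum_comp σ]
    refine Finset.sum_congr rfl fun i _ => ?_
    rw [h1, mul_pow, Real.sq_sqrt (by positivity)]
    split_ifs with hi
    · rw [abs_of_neg ((hσ i).1 hi)]
      ring
    · rw [abs_of_nonneg (not_lt.1 fun h => hi ((hσ i).2 h))]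
  · let l : EuclideanSpace ℝ (Fin N) →ₗ[ℝ] (EuclideanSpace ℝ (Fin N) →L[ℝ] ℝ) := β
    have hinj : Function.Injective l := by
      refine (injective_iff_map_eq_zero l).2 fun u hu => hzero u fun a => ?_
      have h1 := hβv u a
      rw [show β u = 0 from hu] at h1
      have h2 : μ a / 2 * v.repr u a = 0 := by simpa using h1.symm
      exact (mul_eq_zero.1 h2).resolve_left (div_ne_zero (hμ0 a) two_ne_zero)
    have hrank : Module.finrank ℝ (EuclideanSpace ℝ (Fin N)) =
        Module.finrank ℝ (EuclideanSpace ℝ (Fin N) →L[ℝ] ℝ) := by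
      rw [← LinearMap.toContinuousLinearMap.finrank_eq]
      exact Subspace.dual_finrank_eq.symm
    exact ⟨(LinearEquiv.ofInjectiveOfFinrankEq l hinj hrank).toContinuousLinearEquiv, fun u => rfl⟩

end Diagonal

theorem exists_isMorseChart {N : ℕ} {V : EuclideanSpace ℝ (Fin N) → ℝ}
    {G : Set (EuclideanSpace ℝ (Fin N))} {q : EuclideanSpace ℝ (Fin N)} (hG : G ∈ 𝓝 q)
    (hV : AnalyticAt ℝ V q) (hV0 : V q = 0) (hV' : fderiv ℝ V q = 0)
    (hdet : (hessian V q).det ≠ 0) : ∃ φ, IsMorseChart V G q (morseIndex V q) φ := by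
  obtain ⟨b, hb, hsymm, hVb⟩ := exists_symmetric_form hV hV0 hV'
  have hess : ∀ i j, hessian V q i j =
      2 * b q (EuclideanSpace.single i 1) (EuclideanSpace.single j 1) := by
    intro i j
    rw [hessian_eq_of_eventuallyEq (g := fun y => y - q) hb (by fun_prop) (sub_self q) hVb,
      fderiv_sub_const, fderiv_fun_id, ContinuousLinearMap.id_apply, ContinuousLinearMap.id_apply,
      hsymm q (EuclideanSpace.single j 1), two_mul]
  have hH : (hessian V q).IsHermitian := by
    refine Matrix.IsHermitian.ext fun i j => ?_
    rw [hess, hess, hsymm, star_trivial]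
  obtain ⟨⟨L, hL⟩, e, he⟩ := exists_diagonalizing_equiv (k := morseIndex V q) hH hdet hess rfl
  obtain ⟨g, hg, hg0, hg', hgb⟩ := exists_analyticAt_straightening hb hsymm e he
  set f : EuclideanSpace ℝ (Fin N) → EuclideanSpace ℝ (Fin N) := fun y => L (g y) with hf
  have hfan : AnalyticAt ℝ f q := (L.toContinuousLinearMap.analyticAt _).comp hg
  have hfq : f q = 0 := by simp [hf, hg0]
  have hfd : HasStrictFDerivAt f L.toContinuousLinearMap q := by
    have h1 := hfan.hasStrictFDerivAt
    have h2 : fderiv ℝ f q = L := by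
      have h3 := (L.toContinuousLinearMap.hasFDerivAt.comp q hg.differentiableAt.hasFDerivAt).fderiv
      rw [hg', ContinuousLinearMap.comp_id] at h3
      exact h3
    rwa [h2] at h1
  let ψ := hfd.toOpenPartialHomeomorph f
  have hqψ : q ∈ ψ.source := hfd.mem_toOpenPartialHomeomorph_source
  have hψsymm : AnalyticAt ℝ ψ.symm (f q) :=
    ψ.analyticAt_symm' (i := L) hqψ hfan hfd.hasFDerivAt.fderiv
  have hVf : ∀ᶠ y in 𝓝 q, V y = diagForm N (morseIndex V q) (f y) := by
    filter_upwards [hVb, hgb] with y h1 h2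
    rw [h1, h2, hL]
  -- A chart must be bianalytic and in normal form at all of its points. These conditions hold near
  -- q, so the local inverse is restricted to an open set on which they all hold.
  have hgood : ∀ᶠ y in 𝓝 q, y ∈ G ∧ AnalyticAt ℝ f y ∧ AnalyticAt ℝ ψ.symm (f y) ∧
      V y = diagForm N (morseIndex V q) (f y) := by
    filter_upwards [hG, hfan.eventually_analyticAt,
      hfan.continuousAt.eventually hψsymm.eventually_analyticAt, hVf] with y h1 h2 h3 h4
    exact ⟨h1, h2, h3, h4⟩
  obtain ⟨s, hs, hso, hqs⟩ := eventually_nhds_iff.1 hgood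
  let φ := ψ.restrOpen s hso
  have hφ : ∀ y ∈ φ.source, y ∈ s := by
    intro y hy
    rw [ψ.restrOpen_source] at hy
    exact hy.2
  have hφt : ∀ x ∈ φ.target, φ.symm x ∈ s ∧ f (φ.symm x) = x := fun x hx =>
    ⟨hφ _ (φ.map_target hx), φ.right_inv hx⟩
  refine ⟨φ, fun y hy => (hs y (hφ y hy)).1, ?_, hfq, fun y hy => (hs y (hφ y hy)).2.1,
    fun x hx => ?_, fun x hx => ?_⟩
  · rw [ψ.restrOpen_source]
    exact ⟨hqψ, hqs⟩
  · obtain ⟨h1, h2⟩ := hφt x hx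
    have h3 := (hs _ h1).2.2.1
    rw [h2] at h3
    exact h3
  · obtain ⟨h1, h2⟩ := hφt x hx
    rw [(hs _ h1).2.2.2, h2, diagForm]

end DensityOfStates

/-! ### The theorem. -/

theorem proposition1 {N : ℕ} (hN : 0 < N)
    (G : Set (EuclideanSpace ℝ (Fin N))) (hG : IsOpen G)
    (V : EuclideanSpace ℝ (Fin N) → ℝ) (hV : DensityOfStates.IsMorseOn V G)
    (qc : EuclideanSpace ℝ (Fin N)) (hqc : qc ∈ G)
    (hcrit : ∀ q ∈ G, fderiv ℝ V q = 0 ↔ q = qc) (hzero : V qc = 0)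
    (k : ℕ) (hk : DensityOfStates.morseIndex V qc = k) :
    -- Morse coordinates at the critical point exist
    (∃ φ, DensityOfStates.IsMorseChart V G qc k φ) ∧
    -- and in all of them, for all sufficiently small balls around the critical point,
    ∀ φ, DensityOfStates.IsMorseChart V G qc k φ →
      ∃ r₀ : ℝ, 0 < r₀ ∧ Metric.closedBall 0 r₀ ⊆ φ.target ∧
        ∀ r : ℝ, 0 < r → r < r₀ →
          -- the density of states of the ball has the stated singularity,
          DensityOfStates.HasSingularDensity V (φ.symm '' Metric.ball 0 r)
            (DensityOfStates.leadingTerm V qc k) ∧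
          -- and so has that of every larger region (such as `G`) to which the points away
          -- from the critical point contribute analytically
          ∀ Γ : Set (EuclideanSpace ℝ (Fin N)), φ.symm '' Metric.ball 0 r ⊆ Γ → Γ ⊆ G →
            DensityOfStates.HasAnalyticDensity V (Γ \ (φ.symm '' Metric.ball 0 r)) →
            DensityOfStates.HasSingularDensity V Γ (DensityOfStates.leadingTerm V qc k) := by
  have hcrit' : fderiv ℝ V qc = 0 := (hcrit qc hqc).2 rfl
  have hdet : (DensityOfStates.hessian V qc).det ≠ 0 := hV.nondegenerate qc hqc hcrit'
  subst hk
  refine ⟨DensityOfStates.exists_isMorseChart (hG.mem_nhds hqc) (hV.analytic qc hqc) hzero hcrit'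
    hdet, fun φ hφ => ?_⟩
  obtain ⟨r₀, hr₀, hball, h⟩ :=
    hφ.exists_hasSingularDensity hN (DensityOfStates.morseIndex_le V qc) hdet
  refine ⟨r₀, hr₀, hball, fun r hr hr' => ⟨h r hr hr', fun Γ hΓ _ hR => ?_⟩⟩
  have hopen : IsOpen (φ.symm '' Metric.ball 0 r) :=
    φ.symm.isOpen_image_of_subset_source Metric.isOpen_ball
      ((Metric.ball_subset_closedBall.trans
        (Metric.closedBall_subset_closedBall hr'.le)).trans hball)
  exact (h r hr hr').of_sdiff hopen.measurableSet hΓ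
    (DensityOfStates.nonanalyticAtZero_leadingTerm hN hdet _) hR
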